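/- Let $\mathbb{K}$ be a field, $n\ge 2$, $R=\mathbb{K}[x_1,\dots,x_{n+1}]$, and let $T$ be the $2\times n$ matrix with rows $(x_1,\dots,x_n)$ and $(x_2,\dots,x_{n+1})$; let $P_n$ be the ideal of its $2\times 2$ minors. **Eagon–Northcott complex.** Let $G=\bigoplus_{i=1}^n R\,y_i$, let $\phi_q$ be the free $R$-module on the monomials $z_1^{v_1}z_2^{v_2}$ with $v_1+v_2=q$, and put $E_0=R$, $E_{r}=\bigwedge^{r+1}G\otimes\phi_{r-1}$ for $r\ge1$. With $\Delta_s(y_{i_1}\wedge\dots\wedge y_{i_k})=\sum_p(-1)^{p+1}T_{s,i_p}\,y_{i_1}\wedge\dots\wedge\widehat{y_{i_p}}\wedge\dots\wedge y_{i_k}$, the differential is $d(w\otimes z_1^{v_1}z_2^{v_2})=\Delta_1(w)\otimes z_1^{v_1-1}z_2^{v_2}+\Delta_2(w)\otimes z_1^{v_1}z_2^{v_2-1}$ on $E_r$, $r\geq 2$ (terms with a negative exponent are omitted), and $d(y_{i}\wedge y_{j}\otimes1)=x_{i}x_{j+1}-x_{j}x_{i+1}$ on $E_1$. **The complex $\mathcal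 F_{1,\Pi}$.** Let $C_{n+1}$ be the cycle on $1,\dots,n+1$ and $\Pi=\{\{1,n+1\},\{2\},\dots,\{n\}\}$. An acyclic $j$-partition $\mathcal C$ consists of a partition of the vertices of $C_{n+1}$ into $j$ connected sets, each a union of members of $\Pi$, and an acyclic orientation of the resulting quotient multigraph without loops (parallel edges point the same way and count as one directed edge $(U,W)$). Two of them are chip-firing equivalent if they are connected by a sequence of moves, each of which reverses all edges at a source, and of inverses of such moves; $[\mathcal C]$ is the class of $\mathcal C$. Let $D(\mathcal C)\in\mathbb N^{n+1}$ count, for every vertex $i$, the edges of $C_{n+1}$ at $i$ that are directed in $\mathcal C$ from the part of $i$ to another part. A directed edge $f$ is contractible in a class $\mathbf c$ if some $\mathcal C\in\mathbf c$ contains $f$ and the contraction $\mathcal C/f$ is acyclic; then $\mathbf c/f=[\mathcal C/f]$ and $m_{\mathbf c}(f)=\mathbf x^{D(\mathcal C)-D(\mathcal C/f)}$. Sign functions are families of functions $\mathrm{sign}_{\mathbf c}$ from contractible edges of $\mathbf c$ to $\{\pm1\}$ such that 1. $\mathrm{sign}_{\mathbf c}(f)\,\mathrm{sign}_{\mathbf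 c/f}(g)=-\mathrm{sign}_{\mathbf c}(g)\,\mathrm{sign}_{\mathbf c/g}(f)$ for distinct contractible edges $f,g$ of $\mathbf c$ such that $g$ is contractible in $\mathbf c/f$ and $f$ is contractible in $\mathbf c/g$; 2. $\mathrm{sign}_{\mathbf c}(U,W)=-\mathrm{sign}_{\mathbf c}(W,U)$ if both edges are contractible in the class $\mathbf c$ of acyclic $2$-partitions. They are called *strict* if (2) holds in the classes of acyclic $j$-partitions for all $j$. Given sign functions, $F_{1,\Pi,j}$ is the free $R$-module with basis $e_{\mathbf c}$, $\mathbf c$ ranging over the classes of acyclic $(j+1)$-partitions, and $\delta(e_{\mathbf c})=\sum_f\mathrm{sign}_{\mathbf c}(f)\,m_{\mathbf c}(f)\,e_{\mathbf c/f}$, the sum over all contractible edges $f$ of $\mathbf c$. $F_{1,\Pi,0}$ has rank one and is identified with $R$. **The map $\Psi$.** It is the identity of $R$ in degree $0$, and in degree $r\ge1$ the $R$-linear map $E_r\to F_{1,\Pi,r}$ that sends $y_{i_1}\wedge\dots\wedge y_{i_{r+1}}\otimes z_1^{v_1}z_2^{v_2}$ ($i_1<\dots<i_{r+1}$, $v_1+v_2=r-1$)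 to $e_{[\mathcal C]}$, where $\mathcal C$ has the parts $\{i_1+1,\dots,i_2\},\dots,\{i_r+1,\dots,i_{r+1}\},\{i_{r+1}+1,\dots,n+1,1,\dots,i_1\}$, its unique sink is the part containing $\{1,n+1\}$, and its source is the part containing $i_{v_2+1}+1$. **Theorem.** $E$ is a complex with $d(E_1)=P_n$, and there is exactly one $\mathcal C$ as in the definition of $\Psi$ for each basis element. Moreover: (a) There are sign functions such that $\mathcal F_{1,\Pi}$ is a complex and $\Psi$ is an isomorphism of complexes from $E$ to $\mathcal F_{1,\Pi}$. (b) There are strict sign functions such that $\mathcal F_{1,\Pi}$ is a complex and $\Psi$, with the image of $y_{i_1}\wedge\dots\wedge y_{i_{r+1}}\otimes z_1^{v_1}z_2^{v_2}$ multiplied by $(-1)^{v_2}$, is an isomorphism of complexes. (c) For all sign functions, $\mathcal F_{1,\Pi}$ is a complex, and $\Psi$ becomes an isomorphism of complexes after the images of the basis elements of the $E_r$, $r\ge1$, are multiplied by suitable signs $\pm1$. -/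

import Mathlib

open scoped TensorProduct

noncomputable section

namespace Parcycle

/-! ### Acyclic partitions of the parcycle `(C_N, Π)`

The vertices `1, …, N` of the cycle `C_N` are the elements `0, …, N - 1` of `Fin N`. -/

variable {N : ℕ}

/-- Two sets of vertices of the cycle `C_N` are joined by an edge of `C_N`. -/
def Joined (U W : Finset (Fin N)) : Prop :=
  ∃ u ∈ U, ∃ w ∈ W, (SimpleGraph.cycleGraph N).Adj u w

/-- An acyclic `j`-partition of the parcycle `(C_N, P)`: a partition of the vertices of `C_N` into
`j` connected sets that coarsens `P`, with an acyclic orientation of its partition graph.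
Parallel edges of the partition graph point the same way in an acyclic orientation, so that an
orientation is a set of ordered pairs of parts; `(U, W)` is the edge directed from `U` to `W`. -/
@[ext]
structure AcyclicPartition (P : Finpartition (Finset.univ : Finset (Fin N))) (j : ℕ) where
  part : Finpartition (Finset.univ : Finset (Fin N))
  coarsens : P ≤ part
  card_parts : part.parts.card = j
  connected : ∀ W ∈ part.parts,
    ((SimpleGraph.cycleGraph N).induce (W : Set (Fin N))).Connected
  edges : Finset (Finset (Fin N) × Finset (Fin N))
  edges_joined : ∀ e ∈ edges,
    e.1 ∈ part.parts ∧ e.2 ∈ part.parts ∧ e.1 ≠ e.2 ∧ Joined e.1 e.2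
  edges_total : ∀ U ∈ part.parts, ∀ W ∈ part.parts, U ≠ W → Joined U W →
    (U, W) ∈ edges ∨ (W, U) ∈ edges
  acyclic : ∀ U, ¬ Relation.TransGen (fun A B => (A, B) ∈ edges) U U

variable {P : Finpartition (Finset.univ : Finset (Fin N))} {j : ℕ}

namespace AcyclicPartition

/-- The part `U` is a sink. -/
def IsSink (C : AcyclicPartition P j) (U : Finset (Fin N)) : Prop :=
  U ∈ C.part.parts ∧ ∀ W, (U, W) ∉ C.edges

/-- The part `U` is a source. -/
def IsSource (C : AcyclicPartition P j) (U : Finset (Fin N)) : Prop :=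
  U ∈ C.part.parts ∧ ∀ W, (W, U) ∉ C.edges

/-- The divisor `D(C)`: the number of edges of the cycle at the vertex `i` that leave the part
of `i` along a directed edge of `C`. -/
def divisor (C : AcyclicPartition P j) (i : Fin N) : ℕ :=
  Set.ncard {l : Fin N |
    (SimpleGraph.cycleGraph N).Adj i l ∧ ∃ e ∈ C.edges, i ∈ e.1 ∧ l ∈ e.2}

/-- `C'` arises from `C` by firing a source: all edges at one source of `C` are reversed. -/
def FiresTo (C C' : AcyclicPartition P j) : Prop :=
  C'.part = C.part ∧ ∃ U, C.IsSource U ∧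
    C'.edges = C.edges.image (fun e => if e.1 = U then (e.2, e.1) else e)

end AcyclicPartition

/-- Chip-firing equivalence classes of acyclic `j`-partitions (`Quot` divides by the equivalence
relation generated by source firings). -/
def ChipClass (P : Finpartition (Finset.univ : Finset (Fin N))) (j : ℕ) : Type :=
  Quot (AcyclicPartition.FiresTo (P := P) (j := j))

/-- The class `[C]` of `C`. -/
def AcyclicPartition.cls (C : AcyclicPartition P j) : ChipClass P j := Quot.mk _ C

/-- The effect on parts of the contraction of the edge `f`: its two ends are merged. -/
def merge (f : Finset (Fin N) × Finset (Fin N)) (A : Finset (Fin N)) : Finset (Fin N) :=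
  if A = f.1 ∨ A = f.2 then f.1 ∪ f.2 else A

/-- The edge `g`, seen after the contraction of the edge `f`. -/
def mergeEdge (f g : Finset (Fin N) × Finset (Fin N)) : Finset (Fin N) × Finset (Fin N) :=
  (merge f g.1, merge f g.2)

/-- `C'` is the contraction `C/f` of the directed edge `f` of `C`. As `C'` is an acyclic
partition, such a `C'` exists exactly when the directed graph `C/f` is acyclic. -/
def AcyclicPartition.ContractsTo (C : AcyclicPartition P (j + 1))
    (f : Finset (Fin N) × Finset (Fin N)) (C' : AcyclicPartition P j) : Prop :=
  f ∈ C.edges ∧ C'.part.parts = C.part.parts.image (merge f) ∧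
    C'.edges = (C.edges.image (mergeEdge f)).filter (fun e => e.1 ≠ e.2)

namespace ChipClass

/-- `f` is a contractible edge in the class `c`: it is a contractible edge of some acyclic
partition in `c`. -/
def Contractible (c : ChipClass P (j + 1)) (f : Finset (Fin N) × Finset (Fin N)) : Prop :=
  ∃ CC : AcyclicPartition P (j + 1) × AcyclicPartition P j,
    CC.1.cls = c ∧ CC.1.ContractsTo f CC.2

/-- The class `c/f`, the class of `C/f` for a `C` in `c` in which `f` can be contracted. -/
def contract {c : ChipClass P (j + 1)} {f : Finset (Fin N) × Finset (Fin N)}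
    (h : c.Contractible f) : ChipClass P j :=
  h.choose.2.cls

/-- The monomial `m_c(f) = x ^ (D(C) - D(C/f))`, for a `C` in `c` in which `f` can be contracted. -/
def monomial (K : Type*) [Field K] {c : ChipClass P (j + 1)}
    {f : Finset (Fin N) × Finset (Fin N)} (h : c.Contractible f) : MvPolynomial (Fin N) K :=
  ∏ i, MvPolynomial.X i ^ (h.choose.1.divisor i - h.choose.2.divisor i)

end ChipClass

/-! ### Sign functions and the complex `F_{1,Π}` -/

/-- A candidate for the family of sign functions `sign_c` (only the values at contractible edges
matter). -/
abbrev SignFamily (P : Finpartition (Finset.univ : Finset (Fin N))) : Type :=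
  (j : ℕ) → ChipClass P j → Finset (Fin N) × Finset (Fin N) → ℤˣ

/-- `sign_c(f) sign_{c/f}(g) = - sign_c(g) sign_{c/g}(f)` for distinct contractible edges `f, g`
of `c`, whenever `g` is contractible in `c/f` and `f` is contractible in `c/g`. -/
def SignFamily.Anticommutes (σ : SignFamily P) : Prop :=
  ∀ (j : ℕ) (c : ChipClass P (j + 2)) (f g : Finset (Fin N) × Finset (Fin N))
    (hf : c.Contractible f) (hg : c.Contractible g), f ≠ g →
    (ChipClass.contract hf).Contractible (mergeEdge f g) →
    (ChipClass.contract hg).Contractible (mergeEdge g f) →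
    σ (j + 2) c f * σ (j + 1) (ChipClass.contract hf) (mergeEdge f g) =
      - (σ (j + 2) c g * σ (j + 1) (ChipClass.contract hg) (mergeEdge g f))

/-- `sign_c(U, W) = - sign_c(W, U)` if both edges are contractible in the class `c` of acyclic
`(j + 1)`-partitions. -/
def SignFamily.ReversesAt (σ : SignFamily P) (j : ℕ) : Prop :=
  ∀ (c : ChipClass P (j + 1)) (U W : Finset (Fin N)),
    c.Contractible (U, W) → c.Contractible (W, U) →
    σ (j + 1) c (U, W) = - σ (j + 1) c (W, U)

/-- Both sign rules, in all classes. -/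
def SignFamily.IsSign (σ : SignFamily P) : Prop :=
  σ.Anticommutes ∧ ∀ j, σ.ReversesAt j

/-- Both sign rules, the second one only in classes of acyclic `2`-partitions. -/
def SignFamily.IsWeakSign (σ : SignFamily P) : Prop :=
  σ.Anticommutes ∧ σ.ReversesAt 1

/-- The free module `F_{1,Π,j}` on the classes of acyclic `(j + 1)`-partitions. -/
abbrev TopplingModule (K : Type*) [Field K] (P : Finpartition (Finset.univ : Finset (Fin N)))
    (j : ℕ) : Type _ :=
  ChipClass P (j + 1) →₀ MvPolynomial (Fin N) K

open Classical in
/-- The differential `e_c ↦ ∑_f sign_c(f) m_c(f) e_{c/f}`, the sum over all contractible edges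
`f` of `c`. -/
def topplingD (K : Type*) [Field K] (σ : SignFamily P) (j : ℕ) :
    TopplingModule K P (j + 1) →ₗ[MvPolynomial (Fin N) K] TopplingModule K P j :=
  Finsupp.linearCombination (MvPolynomial (Fin N) K) fun c : ChipClass P (j + 2) =>
    ∑ f : Finset (Fin N) × Finset (Fin N),
      if h : c.Contractible f then
        Finsupp.single (ChipClass.contract h)
          (((σ (j + 2) c f : ℤ) : MvPolynomial (Fin N) K) * ChipClass.monomial K h)
      else 0

/-- Consecutive differentials of `F_{1,Π}` compose to zero. -/
def TopplingIsComplex (K : Type*) [Field K] (σ : SignFamily P) : Prop :=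
  ∀ j, topplingD K σ j ∘ₗ topplingD K σ (j + 1) = 0

end Parcycle

namespace RationalNormal

open Parcycle

variable (K : Type*) [Field K] (n : ℕ)

/-- The partition `{{1, n+1}, {2}, …, {n}}` of the vertices of `C_{n+1}`. -/
def partition (n : ℕ) : Finpartition (Finset.univ : Finset (Fin (n + 1))) :=
  Finpartition.ofExistsUnique
    (insert {0, Fin.last n}
      ((Finset.univ.filter (fun w : Fin (n + 1) => w ≠ 0 ∧ w ≠ Fin.last n)).image
        (fun w => {w})))
    (fun _ _ => Finset.subset_univ _)
    (by
      intro a _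
      by_cases ha : a = 0 ∨ a = Fin.last n
      · refine ⟨{0, Fin.last n}, ⟨Finset.mem_insert_self _ _, by simpa using ha⟩, ?_⟩
        rintro t ⟨ht, hat⟩
        rcases Finset.mem_insert.1 ht with rfl | ht
        · rfl
        · obtain ⟨w, hw, rfl⟩ := Finset.mem_image.1 ht
          rw [Finset.mem_singleton] at hat
          subst hat
          simp only [Finset.mem_filter, Finset.mem_univ, true_and] at hw
          tauto
      · refine ⟨{a}, ⟨?_, by simp⟩, ?_⟩
        · push Not at ha
          exact Finset.mem_insert_of_mem (Finset.mem_image.2 ⟨a, by simpa using ha, rfl⟩)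
        · rintro t ⟨ht, hat⟩
          rcases Finset.mem_insert.1 ht with rfl | ht
          · simp only [Finset.mem_insert, Finset.mem_singleton] at hat
            exact absurd hat ha
          · obtain ⟨w, _, rfl⟩ := Finset.mem_image.1 ht
            rw [Finset.mem_singleton] at hat
            rw [hat])
    (by
      intro h
      rcases Finset.mem_insert.1 h with h | h
      · exact Finset.notMem_empty _ (h ▸ Finset.mem_insert_self (0 : Fin (n + 1)) {Fin.last n})
      · obtain ⟨w, _, hw⟩ := Finset.mem_image.1 h
        exact Finset.singleton_ne_empty w hw)

/-! ### The Eagon–Northcott complex -/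

/-- `R_{n+1} = K[x_1, …, x_{n+1}]`, with `x_i` as `X (i - 1)`. -/
abbrev R : Type _ := MvPolynomial (Fin (n + 1)) K

/-- The matrix `T_n` with rows `x_1, …, x_n` and `x_2, …, x_{n+1}`. -/
def T : Matrix (Fin 2) (Fin n) (R K n) :=
  Matrix.of ![fun i => MvPolynomial.X i.castSucc, fun i => MvPolynomial.X i.succ]

/-- The basis `y_1, …, y_n` of the free module `G = R_{n+1}^n`. -/
abbrev y : Module.Basis (Fin n) (R K n) (Fin n → R K n) := Pi.basisFun (R K n) (Fin n)

/-- The basis `y_{i_1} ∧ ⋯ ∧ y_{i_k}`, `i_1 < ⋯ < i_k`, of the `k`-th exterior power of `G`. -/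
def wedgeBasis (k : ℕ) :
    Module.Basis (Fin k ↪o Fin n) (R K n) (⋀[R K n]^k (Fin n → R K n)) :=
  ((y K n).exteriorPower k).reindex Set.powersetCard.ofFinEmbEquiv.symm

lemma wedgeBasis_apply (k : ℕ) (i : Fin k ↪o Fin n) :
    wedgeBasis K n k i = exteriorPower.ιMulti (R K n) k (fun a => y K n (i a)) := by
  simp [wedgeBasis, exteriorPower.ιMulti_family, Function.comp_def]

/-- `Δ_s(y_{i_1} ∧ ⋯ ∧ y_{i_{k+1}}) =
∑_p (-1)^{p+1} (T_n)_{s,i_p} y_{i_1} ∧ ⋯ ∧ ŷ_{i_p} ∧ ⋯ ∧ y_{i_{k+1}}`; here `p` starts at `0`. -/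
def Delta (s : Fin 2) (k : ℕ) :
    ⋀[R K n]^(k + 1) (Fin n → R K n) →ₗ[R K n] ⋀[R K n]^k (Fin n → R K n) :=
  (wedgeBasis K n (k + 1)).constr (R K n) fun i =>
    ∑ p : Fin (k + 1), ((-1 : R K n) ^ (p : ℕ) * T K n s (i p)) •
      exteriorPower.ιMulti (R K n) k (fun a => y K n (i (p.succAbove a)))

/-- The exponents of the monomials `z_1^{v_1} z_2^{v_2}` of degree `q`. -/
abbrev Expo (q : ℕ) : Type := {v : ℕ × ℕ // v.1 + v.2 = q}

/-- The free module `φ_q` on the monomials `z_1^{v_1} z_2^{v_2}` of degree `q`. -/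
abbrev Phi (q : ℕ) : Type _ := Expo q →₀ R K n

/-- Division by `z_1` of the monomials divisible by `z_1`, the other ones going to zero. -/
def lower₁ (q : ℕ) : Phi K n (q + 1) →ₗ[R K n] Phi K n q :=
  Finsupp.linearCombination (R K n) fun v : Expo (q + 1) =>
    if h : 0 < v.1.1 then Finsupp.single ⟨(v.1.1 - 1, v.1.2), by have := v.2; omega⟩ 1 else 0

/-- Division by `z_2` of the monomials divisible by `z_2`, the other ones going to zero. -/
def lower₂ (q : ℕ) : Phi K n (q + 1) →ₗ[R K n] Phi K n q :=
  Finsupp.linearCombination (R K n) fun v : Expo (q + 1) =>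
    if h : 0 < v.1.2 then Finsupp.single ⟨(v.1.1, v.1.2 - 1), by have := v.2; omega⟩ 1 else 0

/-- `ENModule K n q` is the module `E_{q+1} = ⋀^{q+2} G ⊗ φ_q`, for `q ≥ 0` (it is zero for
`q + 1 > n - 1`); the module `E_0` is the ring. -/
abbrev ENModule (q : ℕ) : Type _ := ⋀[R K n]^(q + 2) (Fin n → R K n) ⊗[R K n] Phi K n q

/-- The index set of the standard basis of `E_{q+1}`. -/
abbrev ENIndex (q : ℕ) : Type := (Fin (q + 2) ↪o Fin n) × Expo q

/-- The basis `y_{i_1} ∧ ⋯ ∧ y_{i_{q+2}} ⊗ z_1^{v_1} z_2^{v_2}` of `E_{q+1}`. -/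
def enBasis (q : ℕ) : Module.Basis (ENIndex n q) (R K n) (ENModule K n q) :=
  (wedgeBasis K n (q + 2)).tensorProduct Finsupp.basisSingleOne

/-- The differential `E_{q+2} → E_{q+1}`. -/
def enD (q : ℕ) : ENModule K n (q + 1) →ₗ[R K n] ENModule K n q :=
  TensorProduct.map (Delta K n 0 (q + 2)) (lower₁ K n q) +
    TensorProduct.map (Delta K n 1 (q + 2)) (lower₂ K n q)

/-- The differential `E_1 → E_0 = R_{n+1}`,
`y_{i_1} ∧ y_{i_2} ⊗ 1 ↦ x_{i_1} x_{i_2 + 1} - x_{i_2} x_{i_1 + 1}`. -/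
def enDZero : ENModule K n 0 →ₗ[R K n] R K n :=
  (enBasis K n 0).constr (R K n) fun b =>
    T K n 0 (b.1 0) * T K n 1 (b.1 1) - T K n 0 (b.1 1) * T K n 1 (b.1 0)

/-- The ideal `P_n` of the rational normal curve, generated by the `2 × 2` minors of `T_n`. -/
def idealP : Ideal (R K n) :=
  Ideal.span {g | ∃ a b : Fin n, a < b ∧ g = T K n 0 a * T K n 1 b - T K n 0 b * T K n 1 a}

/-- Consecutive differentials of the Eagon–Northcott complex compose to zero. -/
def ENIsComplex : Prop :=
  enDZero K n ∘ₗ enD K n 0 = 0 ∧ ∀ q, enD K n q ∘ₗ enD K n (q + 1) = 0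

/-! ### The map `Ψ` -/

/-- The sets `{i_1+1, …, i_2}, {i_2+1, …, i_3}, …, {i_k+1, …, n+1, 1, …, i_1}` of vertices of
`C_{n+1}`. With indices from `0`, as here, the formulas are the same. -/
def psiPart {k : ℕ} (i : Fin (k + 1) ↪o Fin n) (l : Fin (k + 1)) : Finset (Fin (n + 1)) :=
  Finset.univ.filter fun w =>
    if h : (l : ℕ) + 1 < k + 1 then (i l : ℕ) < w ∧ (w : ℕ) ≤ i ⟨l + 1, h⟩
    else (i l : ℕ) < w ∨ (w : ℕ) ≤ i 0

/-- `C` is the acyclic partition attached to `y_{i_1} ∧ ⋯ ∧ y_{i_{q+2}} ⊗ z_1^{v_1} z_2^{v_2}`: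
its parts are the sets above, its unique sink is the part containing `{1, n+1}`, and its source is
the part containing the vertex `i_{v_2+1} + 1`. -/
structure IsPsiPartition {n q : ℕ} (b : ENIndex n q)
    (C : AcyclicPartition (partition n) (q + 2)) : Prop where
  parts : C.part.parts = Finset.univ.image (psiPart n b.1)
  sink : ∀ A ∈ C.part.parts, C.IsSink A ↔ {0, Fin.last n} ⊆ A
  source : ∀ A ∈ C.part.parts,
    C.IsSource A ↔ (b.1 ⟨b.2.1.2, by have := b.2.2; omega⟩).succ ∈ A

open Classical in
/-- The basis element `e_{[C]}` for the acyclic partition `C` attached to `b` (the zero branch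
does not occur). -/
def psiVec (q : ℕ) (b : ENIndex n q) : TopplingModule K (partition n) (q + 1) :=
  if h : ∃ C, IsPsiPartition b C then Finsupp.single h.choose.cls 1 else 0

/-- `Ψ : E_{q+1} → F_{1,Π,q+1}`. -/
def psi (q : ℕ) : ENModule K n q →ₗ[R K n] TopplingModule K (partition n) (q + 1) :=
  (enBasis K n q).constr (R K n) (psiVec K n q)

/-- `Ψ : E_{q+1} → F_{1,Π,q+1}`, with the image of the basis element `b` multiplied by the
sign `ε b`. -/
def psiSigned (q : ℕ) (ε : ENIndex n q → ℤˣ) :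
    ENModule K n q →ₗ[R K n] TopplingModule K (partition n) (q + 1) :=
  (enBasis K n q).constr (R K n) fun b => ((ε b : ℤ) : R K n) • psiVec K n q b

/-- The unique acyclic `1`-partition of the parcycle. -/
def onePart (n : ℕ) : AcyclicPartition (partition n) 1 where
  part := Finpartition.indiscrete Finset.univ_nonempty.ne_empty
  coarsens := fun _ _ => ⟨Finset.univ, by simp, Finset.subset_univ _⟩
  card_parts := by simp
  connected := by
    intro W hW
    simp only [Finpartition.indiscrete_parts, Finset.mem_singleton] at hW
    subst hW
    rw [Finset.coe_univ]
    exact (SimpleGraph.induceUnivIso _).connected_iff.2 SimpleGraph.cycleGraph_connected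
  edges := ∅
  edges_joined := by simp
  edges_total := by
    intro U hU W hW hne
    simp only [Finpartition.indiscrete_parts, Finset.mem_singleton] at hU hW
    exact absurd (hU.trans hW.symm) hne
  acyclic := by
    intro U h
    obtain ⟨_, h, _⟩ := Relation.TransGen.head'_iff.1 h
    simp at h

/-- The identification `E_0 = R_{n+1} = F_{1,Π,0}`: the unit goes to the class of the `1`-partition. -/
def psiZero : R K n →ₗ[R K n] TopplingModule K (partition n) 0 :=
  Finsupp.lsingle (onePart n).cls

/-- The identity in degree `0` and the maps `Φ q` in degrees `q + 1` form an isomorphism from the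
Eagon–Northcott complex to `F_{1,Π}`: they are bijective and commute with the differentials. -/
def IsComplexIso (σ : SignFamily (partition n))
    (Φ : ∀ q, ENModule K n q →ₗ[R K n] TopplingModule K (partition n) (q + 1)) : Prop :=
  Function.Bijective (psiZero K n) ∧ (∀ q, Function.Bijective (Φ q)) ∧
    topplingD K σ 0 ∘ₗ Φ 0 = psiZero K n ∘ₗ enDZero K n ∧
    ∀ q, topplingD K σ (q + 1) ∘ₗ Φ (q + 1) = Φ q ∘ₗ enD K n q

end RationalNormal

end

/-! Vertices 1 and n+1 always share a part, so the edge joining them is never cut, and a connected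
partition into j ≥ 2 parts is the same as a set S of j cut edges among the other n edges of the
cycle. An orientation gives each cut edge one of the two directions around the cycle, and acyclicity
means that both directions occur (`height_lt`, `exists_ori_eq`). Firing a source exchanges the
directions of its two boundary edges, so the numbers a and b of cut edges in the two directions are
invariants; conversely, sorting the directions by adjacent exchanges shows that S, a, b determine
the class (`numOri_true_eq_of_firesTo`, `cls_eq_cls`). Hence classes are triples (S, a, b) with a, b
≥ 1 and a + b = |S|. These are the data of a basis element y_S ⊗ z_1^(a-1) z_2^(b-1), and Ψ is this
correspondence (`psiClass_bijective`).

With at least three parts, a cut edge s with direction x is contractible exactly when x occurs twice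
in the class, that is, when the corresponding z divides the monomial. Contraction removes s from S
and lowers one count, and its coefficient is the variable at the tail of s, an entry of T
(`contractible_iff`, `monomial_eq`). So the differentials agree up to signs. With two parts the two
cut edges are parallel, and the two directed edges give the two products of a minor
(`monomial_two`).

The sign (-1)^(position of s in S), negated for the downward direction, obeys the strict rules
(`edgeSign_anticomm`, `edgeSign_not`) and matches the Eagon–Northcott signs after the factor
(-1)^(v_2) (`basisSign_mul`); this is (b). Changing the signs of the e_c keeps the weak rules, and
the change (-1)^(b-1) gives (a). For (c), every family of sign functions arises by such a change
(`gauge_compatible`): the sign of e_c is computed along one chain of contractions, and the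
anticommutation rule makes it independent of the chain (`gauge_eq`), since any two contractible
edges are linked through pairs that can be contracted successively (`eq_of_pairwise_eq`). That F is
a complex is transported from E, where Δ_1 and Δ_2 are contractions with linear forms in the
exterior algebra (`coe_Delta`). -/

open scoped TensorProduct

noncomputable section

namespace RationalNormal

open Parcycle

/-! ### Cyclic intervals cut out by a set of edges

The edge of the cycle between the vertices `s` and `s + 1` is `s : Fin n`. -/

section Cuts

variable {n : ℕ}

/-- The number of cut edges below the vertex `v`. -/
def cnt (S : Finset (Fin n)) (v : Fin (n + 1)) : ℕ :=
  (S.filter fun s : Fin n => (s : ℕ) < v).card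

lemma cnt_le (S : Finset (Fin n)) (v : Fin (n + 1)) : cnt S v ≤ S.card :=
  Finset.card_filter_le _ _

lemma cnt_mono (S : Finset (Fin n)) {v w : Fin (n + 1)} (h : (v : ℕ) ≤ w) : cnt S v ≤ cnt S w :=
  Finset.card_le_card (Finset.monotone_filter_right _ fun _ _ hs => lt_of_lt_of_le hs h)

@[simp] lemma cnt_zero (S : Finset (Fin n)) : cnt S 0 = 0 := by
  simp [cnt]

@[simp] lemma cnt_last (S : Finset (Fin n)) : cnt S (Fin.last n) = S.card := by
  simp [cnt]

lemma cnt_succ (S : Finset (Fin n)) (s : Fin n) :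
    cnt S s.succ = cnt S s.castSucc + if s ∈ S then 1 else 0 := by
  have h : (S.filter fun r : Fin n => (r : ℕ) < s.succ) =
      (S.filter fun r : Fin n => (r : ℕ) < s.castSucc) ∪ S.filter fun r : Fin n => r = s := by
    ext r
    simp only [Finset.mem_filter, Finset.mem_union, Fin.val_succ, Fin.val_castSucc, Fin.ext_iff]
    grind
  rw [cnt, h, Finset.card_union_of_disjoint, cnt, Finset.filter_eq']
  · split_ifs <;> simp
  · rw [Finset.disjoint_filter]
    rintro r _ h1 rfl
    simp at h1

lemma cnt_succ_of_mem {S : Finset (Fin n)} {s : Fin n} (hs : s ∈ S) :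
    cnt S s.succ = cnt S s.castSucc + 1 := by
  rw [cnt_succ, if_pos hs]

lemma cnt_succ_of_notMem {S : Finset (Fin n)} {s : Fin n} (hs : s ∉ S) :
    cnt S s.succ = cnt S s.castSucc := by
  rw [cnt_succ, if_neg hs, add_zero]

lemma cnt_castSucc_lt {S : Finset (Fin n)} {s : Fin n} (hs : s ∈ S) :
    cnt S s.castSucc < S.card := by
  have := cnt_le S s.succ
  rw [cnt_succ_of_mem hs] at this
  omega

lemma cnt_lt_cnt {S : Finset (Fin n)} {s t : Fin n} (hs : s ∈ S) (h : s < t) :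
    cnt S s.castSucc < cnt S t.castSucc := by
  have := cnt_mono S (v := s.succ) (w := t.castSucc) (by simpa using h)
  rw [cnt_succ_of_mem hs] at this
  omega

lemma cnt_lt_cnt_iff {S : Finset (Fin n)} {s t : Fin n} (hs : s ∈ S) (ht : t ∈ S) :
    cnt S s.castSucc < cnt S t.castSucc ↔ s < t := by
  refine ⟨fun h => ?_, cnt_lt_cnt hs⟩
  by_contra hle
  rcases (not_lt.1 hle).eq_or_lt with rfl | hlt
  · exact lt_irrefl _ h
  · exact lt_asymm h (cnt_lt_cnt ht hlt)

lemma cnt_injOn {S : Finset (Fin n)} {s t : Fin n} (hs : s ∈ S) (ht : t ∈ S)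
    (h : cnt S s.castSucc = cnt S t.castSucc) : s = t := by
  rcases lt_trichotomy s t with hlt | rfl | hlt
  · exact absurd h (cnt_lt_cnt hs hlt).ne
  · rfl
  · exact absurd h (cnt_lt_cnt ht hlt).ne'

/-- On `S` the count is injective with values below `S.card`, so it is onto by cardinality. This
enumerates the cut edges by position. -/
lemma exists_cnt_eq {S : Finset (Fin n)} {l : ℕ} (hl : l < S.card) :
    ∃ s ∈ S, cnt S s.castSucc = l := by
  have h : S.image (fun s => cnt S s.castSucc) = Finset.range S.card := by
    refine Finset.eq_of_subset_of_card_le ?_ ?_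
    · intro l hl
      obtain ⟨s, hs, rfl⟩ := Finset.mem_image.1 hl
      exact Finset.mem_range.2 (cnt_castSucc_lt hs)
    · rw [Finset.card_range, Finset.card_image_of_injOn fun s hs t ht h => cnt_injOn hs ht h]
  have := h ▸ Finset.mem_range.2 hl
  simpa using this

lemma cnt_erase {S : Finset (Fin n)} {s : Fin n} (hs : s ∈ S) (v : Fin (n + 1)) :
    cnt (S.erase s) v + (if (s : ℕ) < v then 1 else 0) = cnt S v := by
  rw [cnt, cnt, Finset.filter_erase]
  split_ifs with h
  · rw [Finset.card_erase_add_one (Finset.mem_filter.2 ⟨hs, h⟩)]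
  · rw [Finset.erase_eq_of_notMem (by simp [h]), add_zero]

lemma cnt_pos_iff {S : Finset (Fin n)} {s : Fin n} (hs : s ∈ S) (v : Fin (n + 1)) :
    (s : ℕ) < v ↔ cnt S s.castSucc < cnt S v := by
  constructor
  · intro h
    have := cnt_mono S (v := s.succ) (w := v) (by simpa using h)
    rw [cnt_succ_of_mem hs] at this
    omega
  · intro h
    by_contra hle
    exact absurd (cnt_mono S (v := v) (w := s.castSucc) (by simpa using hle)) (by omega)

/-- The cyclic position of the interval that contains `v`. -/
def lab (S : Finset (Fin n)) (v : Fin (n + 1)) : ℕ :=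
  if cnt S v = S.card then 0 else cnt S v

lemma lab_eq_iff (S : Finset (Fin n)) (v w : Fin (n + 1)) : lab S v = lab S w ↔
    cnt S v = cnt S w ∨ (cnt S v = 0 ∧ cnt S w = S.card) ∨ (cnt S v = S.card ∧ cnt S w = 0) := by
  unfold lab
  split_ifs <;> omega

@[simp] lemma lab_zero (S : Finset (Fin n)) : lab S 0 = 0 := by
  simp [lab]

@[simp] lemma lab_last (S : Finset (Fin n)) : lab S (Fin.last n) = 0 := by
  simp [lab]

lemma lab_castSucc {S : Finset (Fin n)} {s : Fin n} (hs : s ∈ S) :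
    lab S s.castSucc = cnt S s.castSucc :=
  if_neg (cnt_castSucc_lt hs).ne

lemma lab_succ {S : Finset (Fin n)} {s : Fin n} (hs : s ∈ S) :
    lab S s.succ = if cnt S s.castSucc + 1 = S.card then 0 else cnt S s.castSucc + 1 := by
  rw [lab, cnt_succ_of_mem hs]

lemma lab_succ_eq_castSucc {S : Finset (Fin n)} {s : Fin n} (hs : s ∉ S) :
    lab S s.succ = lab S s.castSucc := by
  rw [lab, cnt_succ_of_notMem hs, lab]

lemma lab_succ_ne {S : Finset (Fin n)} (hS : 2 ≤ S.card) {s : Fin n} (hs : s ∈ S) :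
    lab S s.succ ≠ lab S s.castSucc := by
  have := cnt_castSucc_lt hs
  rw [lab_succ hs, lab_castSucc hs]
  split_ifs <;> omega

lemma lab_lt {S : Finset (Fin n)} (hS : S.Nonempty) (v : Fin (n + 1)) : lab S v < S.card := by
  have := cnt_le S v
  have := hS.card_pos
  unfold lab
  split_ifs <;> omega

lemma lab_castSucc_injOn {S : Finset (Fin n)} {s t : Fin n} (hs : s ∈ S) (ht : t ∈ S)
    (h : lab S s.castSucc = lab S t.castSucc) : s = t := by
  rw [lab_castSucc hs, lab_castSucc ht] at h
  exact cnt_injOn hs ht h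

lemma lab_succ_injOn {S : Finset (Fin n)} {s t : Fin n} (hs : s ∈ S) (ht : t ∈ S)
    (h : lab S s.succ = lab S t.succ) : s = t := by
  rw [lab_succ hs, lab_succ ht] at h
  have := cnt_castSucc_lt hs
  have := cnt_castSucc_lt ht
  apply cnt_injOn hs ht
  split_ifs at h <;> omega

/-- The part of `v` in the partition of the cycle by the cut edges in `S`. -/
def block (S : Finset (Fin n)) (v : Fin (n + 1)) : Finset (Fin (n + 1)) :=
  Finset.univ.filter fun w => lab S w = lab S v

lemma mem_block {S : Finset (Fin n)} {v w : Fin (n + 1)} : w ∈ block S v ↔ lab S w = lab S v := by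
  simp [block]

lemma self_mem_block (S : Finset (Fin n)) (v : Fin (n + 1)) : v ∈ block S v :=
  mem_block.2 rfl

lemma block_eq_iff {S : Finset (Fin n)} {v w : Fin (n + 1)} :
    block S v = block S w ↔ lab S v = lab S w :=
  ⟨fun h => mem_block.1 (h ▸ self_mem_block S v), fun h => by rw [block, h, block]⟩

/-- The partition of the cycle by the cut edges in `S`. -/
def cutPart (S : Finset (Fin n)) : Finpartition (Finset.univ : Finset (Fin (n + 1))) :=
  Finpartition.ofExistsUnique (Finset.univ.image (block S)) (fun _ _ => Finset.subset_univ _)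
    (by
      intro v _
      refine ⟨block S v, ⟨Finset.mem_image_of_mem _ (Finset.mem_univ _), self_mem_block S v⟩, ?_⟩
      rintro W ⟨hW, hv⟩
      obtain ⟨w, _, rfl⟩ := Finset.mem_image.1 hW
      exact (block_eq_iff.2 (mem_block.1 hv)).symm)
    (by
      intro h
      obtain ⟨w, _, hw⟩ := Finset.mem_image.1 h
      exact Finset.notMem_empty w (hw ▸ self_mem_block S w))

lemma cutPart_parts (S : Finset (Fin n)) : (cutPart S).parts = Finset.univ.image (block S) := rfl

lemma mem_cutPart {S : Finset (Fin n)} {W : Finset (Fin (n + 1))} :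
    W ∈ (cutPart S).parts ↔ ∃ v, block S v = W := by
  simp [cutPart_parts]

lemma block_mem_cutPart (S : Finset (Fin n)) (v : Fin (n + 1)) :
    block S v ∈ (cutPart S).parts := mem_cutPart.2 ⟨v, rfl⟩

lemma card_cutPart {S : Finset (Fin n)} (hS : S.Nonempty) :
    (cutPart S).parts.card = S.card := by
  have h1 : (cutPart S).parts = S.image fun s => block S s.castSucc := by
    ext W
    rw [mem_cutPart, Finset.mem_image]
    constructor
    · rintro ⟨v, rfl⟩
      obtain ⟨s, hs, h⟩ := exists_cnt_eq (lab_lt hS v)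
      exact ⟨s, hs, block_eq_iff.2 (by rw [lab_castSucc hs, h])⟩
    · rintro ⟨s, _, rfl⟩
      exact ⟨_, rfl⟩
  rw [h1, Finset.card_image_of_injOn]
  intro s hs t ht h
  exact lab_castSucc_injOn hs ht (block_eq_iff.1 h)

/-- The endpoint at which the edge `s` starts, in the orientation `x`
(`true` is the direction from `s` to `s + 1`). -/
def tail (s : Fin n) (x : Bool) : Fin (n + 1) := if x then s.castSucc else s.succ

@[simp] lemma tail_true (s : Fin n) : tail s true = s.castSucc := rfl

@[simp] lemma tail_false (s : Fin n) : tail s false = s.succ := rfl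

/-- The directed edge of the partition graph that comes from the edge `s` of the cycle. -/
def eg (S : Finset (Fin n)) (s : Fin n) (x : Bool) :
    Finset (Fin (n + 1)) × Finset (Fin (n + 1)) :=
  (block S (tail s x), block S (tail s !x))

lemma eg_swap (S : Finset (Fin n)) (s : Fin n) (x : Bool) :
    eg S s (!x) = ((eg S s x).2, (eg S s x).1) := by
  simp [eg]

lemma eg_ne {S : Finset (Fin n)} (hS : 2 ≤ S.card) {s : Fin n} (hs : s ∈ S) (x : Bool) :
    (eg S s x).1 ≠ (eg S s x).2 := by
  have := lab_succ_ne hS hs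
  cases x <;> simp only [eg, tail, ne_eq, block_eq_iff] <;> simp [this, this.symm]

/-- With three arcs or more, two arcs share at most one cut edge, so there are no parallel edges. -/
lemma eg_inj {S : Finset (Fin n)} (hS : 3 ≤ S.card) {s t : Fin n} (hs : s ∈ S) (ht : t ∈ S)
    {x y : Bool} (h : eg S s x = eg S t y) : s = t ∧ x = y := by
  have hs' := cnt_castSucc_lt hs
  have ht' := cnt_castSucc_lt ht
  cases x <;> cases y <;> simp only [eg, tail, Prod.mk.injEq, block_eq_iff] at h <;>
    simp at h
  · exact ⟨lab_succ_injOn hs ht h.1, rfl⟩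
  · rw [lab_succ hs, lab_succ ht, lab_castSucc hs, lab_castSucc ht] at h
    split_ifs at h <;> omega
  · rw [lab_succ hs, lab_succ ht, lab_castSucc hs, lab_castSucc ht] at h
    split_ifs at h <;> omega
  · exact ⟨lab_castSucc_injOn hs ht h.1, rfl⟩

/-- With two arcs the cut edges are parallel: going up across one joins the same arcs as going down
across the other. -/
lemma eg_eq_of_card_two {S : Finset (Fin n)} (hS : S.card = 2) {s t : Fin n} (hs : s ∈ S)
    (ht : t ∈ S) (hst : s ≠ t) (x : Bool) : eg S t (!x) = eg S s x := by
  have hs' := cnt_castSucc_lt hs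
  have ht' := cnt_castSucc_lt ht
  have hne : cnt S s.castSucc ≠ cnt S t.castSucc := fun h => hst (cnt_injOn hs ht h)
  have h1 : lab S t.succ = lab S s.castSucc := by
    rw [lab_succ ht, lab_castSucc hs]
    split_ifs <;> omega
  have h2 : lab S t.castSucc = lab S s.succ := by
    rw [lab_succ hs, lab_castSucc ht]
    split_ifs <;> omega
  cases x <;> simp [eg, block_eq_iff, h1, h2]

lemma eg_eq_cases {S : Finset (Fin n)} (hS : 2 ≤ S.card) {s t : Fin n} (hs : s ∈ S) (ht : t ∈ S)
    {x y : Bool} (h : eg S s x = eg S t y) :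
    (s = t ∧ x = y) ∨ (S.card = 2 ∧ s ≠ t ∧ y = !x) := by
  rcases hS.eq_or_lt with h2 | h3
  · by_cases hst : s = t
    · subst hst
      left
      refine ⟨rfl, ?_⟩
      by_contra hxy
      obtain rfl : y = !x := by cases x <;> cases y <;> simp_all
      rw [eg_swap] at h
      exact eg_ne h2.le hs x (congrArg Prod.fst h)
    · right
      refine ⟨h2.symm, hst, ?_⟩
      by_contra hxy
      obtain rfl : y = x := by cases x <;> cases y <;> simp_all
      rw [← eg_eq_of_card_two h2.symm hs ht hst, eg_swap] at h
      exact eg_ne h2.le ht y (congrArg Prod.snd h)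
  · exact Or.inl (eg_inj h3 hs ht h)

/-! ### Adjacency and connectedness -/

/-- The wrap-around edge is kept apart because its ends always have the same label; only the linear
edges can be cut. -/
lemma adj_iff (hn : 2 ≤ n) {u v : Fin (n + 1)} : (SimpleGraph.cycleGraph (n + 1)).Adj u v ↔
    (∃ s : Fin n, ∃ x, tail s x = u ∧ tail s (!x) = v) ∨
      (u = 0 ∧ v = Fin.last n) ∨ (u = Fin.last n ∧ v = 0) := by
  obtain ⟨m, rfl⟩ : ∃ m, n = m + 1 := ⟨n - 1, by omega⟩
  have key : ∀ a b : Fin (m + 1 + 1), a - b = 1 ↔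
      ((a : ℕ) = b + 1 ∨ (a = 0 ∧ b = Fin.last (m + 1))) := by
    intro a b
    have ha := a.2
    have hb := b.2
    rw [Fin.ext_iff, Fin.ext_iff, Fin.ext_iff, Fin.sub_def, Fin.val_last, Fin.val_zero,
      Fin.val_one]
    simp only
    rcases le_or_gt (b : ℕ) a with h | h
    · rw [show m + 1 + 1 - (b : ℕ) + a = (a - b) + (m + 1 + 1) by omega, Nat.add_mod_right,
        Nat.mod_eq_of_lt (by omega)]
      omega
    · rw [Nat.mod_eq_of_lt (by omega)]
      omega
  rw [SimpleGraph.cycleGraph_adj, key, key]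
  constructor
  · rintro ((h | ⟨h1, h2⟩) | (h | ⟨h1, h2⟩))
    · exact Or.inl ⟨⟨v, by omega⟩, false, by ext; simp [h], by ext; simp⟩
    · exact Or.inr (Or.inl ⟨h1, h2⟩)
    · exact Or.inl ⟨⟨u, by omega⟩, true, by ext; simp, by ext; simp [h]⟩
    · exact Or.inr (Or.inr ⟨h2, h1⟩)
  · rintro (⟨s, x, rfl, rfl⟩ | ⟨h1, h2⟩ | ⟨h1, h2⟩)
    · cases x <;> simp
    · exact Or.inl (Or.inr ⟨h1, h2⟩)
    · exact Or.inr (Or.inr ⟨h2, h1⟩)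

lemma adj_tail (hn : 2 ≤ n) (s : Fin n) (x : Bool) :
    (SimpleGraph.cycleGraph (n + 1)).Adj (tail s x) (tail s !x) :=
  (adj_iff hn).2 (Or.inl ⟨s, x, rfl, rfl⟩)

lemma reachable_block (hn : 2 ≤ n) (S : Finset (Fin n)) (v : Fin (n + 1)) (k : ℕ) :
    ∀ (u w : Fin (n + 1)) (hu : u ∈ block S v) (hw : w ∈ block S v), (u : ℕ) + k = w →
      cnt S u = cnt S w →
      ((SimpleGraph.cycleGraph (n + 1)).induce (block S v : Set (Fin (n + 1)))).Reachable
        ⟨u, hu⟩ ⟨w, hw⟩ := by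
  induction k with
  | zero =>
    intro u w hu hw h _
    obtain rfl : u = w := Fin.ext (by omega)
    exact SimpleGraph.Reachable.refl _
  | succ k ih =>
    intro u w hu hw h hc
    have hun : (u : ℕ) < n := by omega
    set s : Fin n := ⟨u, hun⟩ with hs
    have hus : u = s.castSucc := Fin.ext (by simp [hs])
    have h1 := cnt_mono S (v := u) (w := s.succ) (by simp [hs])
    have h2 := cnt_mono S (v := s.succ) (w := w) (by simp [hs]; omega)
    have hc' : cnt S s.succ = cnt S w := by omega
    have hmem : s.succ ∈ block S v := by
      rw [mem_block] at hu ⊢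
      rw [← hu, lab, lab, hc', ← hc]
    refine SimpleGraph.Reachable.trans (SimpleGraph.Adj.reachable ?_)
      (ih s.succ w hmem hw (by simp [hs]; omega) hc')
    simp only [SimpleGraph.comap_adj, Function.Embedding.subtype_apply, hus]
    exact adj_tail hn s true

lemma connected_block (hn : 2 ≤ n) (S : Finset (Fin n)) (v : Fin (n + 1)) :
    ((SimpleGraph.cycleGraph (n + 1)).induce (block S v : Set (Fin (n + 1)))).Connected := by
  have key : ∀ (u w : Fin (n + 1)) (hu : u ∈ block S v) (hw : w ∈ block S v), cnt S u = cnt S w →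
      ((SimpleGraph.cycleGraph (n + 1)).induce (block S v : Set (Fin (n + 1)))).Reachable
        ⟨u, hu⟩ ⟨w, hw⟩ := by
    intro u w hu hw h
    rcases le_total (u : ℕ) w with hle | hle
    · exact reachable_block hn S v (w - u) u w hu hw (by omega) h
    · exact (reachable_block hn S v (u - w) w u hw hu (by omega) h.symm).symm
  -- The block with label 0 consists of two linear intervals, glued by the wrap-around edge.
  have key2 : ∀ (u w : Fin (n + 1)) (hu : u ∈ block S v) (hw : w ∈ block S v), cnt S u = 0 →
      cnt S w = S.card →
      ((SimpleGraph.cycleGraph (n + 1)).induce (block S v : Set (Fin (n + 1)))).Reachable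
        ⟨u, hu⟩ ⟨w, hw⟩ := by
    intro u w hu hw h1 h2
    have hv : lab S v = 0 := by
      rw [← mem_block.1 hw, lab, if_pos h2]
    refine (key u 0 hu (by simp [mem_block, hv]) (by simp [h1])).trans
      (SimpleGraph.Reachable.trans (SimpleGraph.Adj.reachable ?_)
        (key (Fin.last n) w (by simp [mem_block, hv]) hw (by simp [h2])))
    exact (adj_iff hn).2 (Or.inr (Or.inl ⟨rfl, rfl⟩))
  have : Nonempty (block S v : Set (Fin (n + 1))) := ⟨⟨v, self_mem_block S v⟩⟩
  refine SimpleGraph.Connected.mk ?_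
  rintro ⟨u, hu⟩ ⟨w, hw⟩
  have h := (mem_block.1 hu).trans (mem_block.1 hw).symm
  rw [lab_eq_iff] at h
  rcases h with h | ⟨h1, h2⟩ | ⟨h1, h2⟩
  · exact key u w hu hw h
  · exact key2 u w hu hw h1 h2
  · exact (key2 w u hw hu h2 h1).symm

/-! ### Orientations -/

/-- The weighted height along which the directed edges of an orientation descend. -/
def height (S : Finset (Fin n)) (o : Fin n → Bool) (v : Fin (n + 1)) : ℤ :=
  (S.filter fun s => o s = true).card * cnt (S.filter fun s => o s = false) v -
    (S.filter fun s => o s = false).card * cnt (S.filter fun s => o s = true) v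

lemma card_filter_add (S : Finset (Fin n)) (o : Fin n → Bool) :
    (S.filter fun s => o s = true).card + (S.filter fun s => o s = false).card = S.card := by
  rw [← Finset.card_filter_add_card_filter_not (s := S) (fun s => o s = true)]
  simp

lemma cnt_filter_add (S : Finset (Fin n)) (o : Fin n → Bool) (v : Fin (n + 1)) :
    cnt (S.filter fun s => o s = true) v + cnt (S.filter fun s => o s = false) v = cnt S v := by
  rw [cnt, cnt, cnt, Finset.filter_comm, Finset.filter_comm (p := fun s => o s = false)]
  exact card_filter_add _ o

/-- The weights are chosen so that the total change over a full turn is a * b - b * a = 0; hence the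
height is well defined on blocks, including the one that wraps around. -/
lemma height_congr {S : Finset (Fin n)} (o : Fin n → Bool) {v w : Fin (n + 1)}
    (h : lab S v = lab S w) : height S o v = height S o w := by
  have key : ∀ v w : Fin (n + 1), (v : ℕ) ≤ w → lab S v = lab S w →
      height S o v = height S o w := by
    intro v w hvw h
    have h1 := cnt_mono (S.filter fun s => o s = true) hvw
    have h2 := cnt_mono (S.filter fun s => o s = false) hvw
    have h3 := cnt_filter_add S o v
    have h4 := cnt_filter_add S o w
    have h5 := card_filter_add S o
    have h6 := cnt_le (S.filter fun s => o s = true) w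
    have h7 := cnt_le (S.filter fun s => o s = false) w
    have h8 := cnt_mono S hvw
    unfold height
    rw [lab_eq_iff] at h
    rcases h with h | ⟨ha, hb⟩ | ⟨ha, hb⟩
    · rw [show cnt (S.filter fun s => o s = true) v = cnt (S.filter fun s => o s = true) w by omega,
        show cnt (S.filter fun s => o s = false) v = cnt (S.filter fun s => o s = false) w by omega]
    · rw [show cnt (S.filter fun s => o s = true) v = 0 by omega,
        show cnt (S.filter fun s => o s = false) v = 0 by omega,
        show cnt (S.filter fun s => o s = true) w = (S.filter fun s => o s = true).card by omega,
        show cnt (S.filter fun s => o s = false) w = (S.filter fun s => o s = false).card by omega]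
      push_cast
      ring
    · rw [show cnt (S.filter fun s => o s = true) v = cnt (S.filter fun s => o s = true) w by omega,
        show cnt (S.filter fun s => o s = false) v = cnt (S.filter fun s => o s = false) w by omega]
  rcases le_total (v : ℕ) w with hle | hle
  · exact key v w hle h
  · exact (key w v hle h.symm).symm

/-- Crossing a cut edge along its direction lowers the height by the number of cut edges with the
opposite direction, which is positive because both directions occur. -/
lemma height_lt {S : Finset (Fin n)} {o : Fin n → Bool} (ho : ∀ x, ∃ s ∈ S, o s = x) {s : Fin n}
    (hs : s ∈ S) : height S o (tail s !o s) < height S o (tail s (o s)) := by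
  have hpos : ∀ x, 0 < ((S.filter fun s => o s = x).card : ℤ) := by
    intro x
    obtain ⟨r, hr, hx⟩ := ho x
    exact_mod_cast Finset.card_pos.2 ⟨r, Finset.mem_filter.2 ⟨hr, hx⟩⟩
  unfold height
  cases h : o s
  · have h1 := cnt_succ_of_mem (S := S.filter fun s => o s = false) (s := s) (by simp [hs, h])
    have h2 := cnt_succ_of_notMem (S := S.filter fun s => o s = true) (s := s) (by simp [h])
    simp only [tail_true, tail_false, Bool.not_false, h1, h2]
    have := hpos true
    push_cast
    linarith
  · have h1 := cnt_succ_of_mem (S := S.filter fun s => o s = true) (s := s) (by simp [hs, h])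
    have h2 := cnt_succ_of_notMem (S := S.filter fun s => o s = false) (s := s) (by simp [h])
    simp only [tail_true, tail_false, Bool.not_true, h1, h2]
    have := hpos false
    push_cast
    linarith

/-- The directed edges of the orientation `o` of the partition graph. -/
def cutEdges (S : Finset (Fin n)) (o : Fin n → Bool) :
    Finset (Finset (Fin (n + 1)) × Finset (Fin (n + 1))) :=
  S.image fun s => eg S s (o s)

lemma mem_cutEdges {S : Finset (Fin n)} {o : Fin n → Bool}
    {e : Finset (Fin (n + 1)) × Finset (Fin (n + 1))} :
    e ∈ cutEdges S o ↔ ∃ s ∈ S, eg S s (o s) = e := by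
  simp [cutEdges]

lemma height_lt_of_transGen {S : Finset (Fin n)} {o : Fin n → Bool} (ho : ∀ x, ∃ s ∈ S, o s = x)
    {U W : Finset (Fin (n + 1))}
    (h : Relation.TransGen (fun A B => (A, B) ∈ cutEdges S o) U W) :
    U.Nonempty ∧ ∀ v ∈ U, ∀ w ∈ W, height S o w < height S o v := by
  have step : ∀ A B, (A, B) ∈ cutEdges S o →
      A.Nonempty ∧ ∀ v ∈ A, ∀ w ∈ B, height S o w < height S o v := by
    intro A B hAB
    obtain ⟨s, hs, he⟩ := mem_cutEdges.1 hAB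
    obtain ⟨rfl, rfl⟩ := Prod.mk.inj he
    refine ⟨⟨_, self_mem_block _ _⟩, fun v hv w hw => ?_⟩
    rw [height_congr o (mem_block.1 hv), height_congr o (mem_block.1 hw)]
    exact height_lt ho hs
  induction h with
  | single h => exact step _ _ h
  | tail _ h2 ih =>
    refine ⟨ih.1, fun v hv w hw => ?_⟩
    obtain ⟨⟨b, hb⟩, h3⟩ := step _ _ h2
    exact (h3 b hb w hw).trans (ih.2 v hv b hb)

lemma exists_of_joined (hn : 2 ≤ n) {S : Finset (Fin n)} {U W : Finset (Fin (n + 1))}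
    (hU : U ∈ (cutPart S).parts) (hW : W ∈ (cutPart S).parts) (hne : U ≠ W) (h : Joined U W) :
    ∃ s ∈ S, ∃ x, eg S s x = (U, W) := by
  obtain ⟨u, hu, w, hw, hadj⟩ := h
  obtain ⟨u', rfl⟩ := mem_cutPart.1 hU
  obtain ⟨w', rfl⟩ := mem_cutPart.1 hW
  rw [← block_eq_iff.2 (mem_block.1 hu), ← block_eq_iff.2 (mem_block.1 hw)] at hne ⊢
  rcases (adj_iff hn).1 hadj with ⟨s, x, rfl, rfl⟩ | ⟨rfl, rfl⟩ | ⟨rfl, rfl⟩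
  · refine ⟨s, ?_, x, rfl⟩
    by_contra hs
    apply hne
    rw [block_eq_iff]
    cases x <;> simp [lab_succ_eq_castSucc hs]
  · exact absurd (block_eq_iff.2 (by simp)) hne
  · exact absurd (block_eq_iff.2 (by simp)) hne

lemma partition_le_cutPart (S : Finset (Fin n)) : partition n ≤ cutPart S := by
  intro A hA
  change A ∈ insert _ _ at hA
  rcases Finset.mem_insert.1 hA with rfl | hA
  · refine ⟨block S 0, block_mem_cutPart S 0, ?_⟩
    intro w hw
    rw [Finset.mem_insert, Finset.mem_singleton] at hw
    rcases hw with rfl | rfl <;> simp [mem_block]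
  · obtain ⟨w, _, rfl⟩ := Finset.mem_image.1 hA
    exact ⟨block S w, block_mem_cutPart S w, by simpa using self_mem_block S w⟩

/-- The acyclic partition with cut edges `S` and orientation `o`. -/
def ofCuts (hn : 2 ≤ n) {j : ℕ} (S : Finset (Fin n)) (o : Fin n → Bool)
    (ho : ∀ x, ∃ s ∈ S, o s = x) (hj : S.card = j) : AcyclicPartition (partition n) j where
  part := cutPart S
  coarsens := partition_le_cutPart S
  card_parts := by
    obtain ⟨s, hs, _⟩ := ho true
    rw [card_cutPart ⟨s, hs⟩, hj]
  connected := by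
    intro W hW
    obtain ⟨v, rfl⟩ := mem_cutPart.1 hW
    exact connected_block hn S v
  edges := cutEdges S o
  edges_joined := by
    intro e he
    obtain ⟨s, hs, rfl⟩ := mem_cutEdges.1 he
    have hS : 2 ≤ S.card := by
      obtain ⟨a, ha, hat⟩ := ho true
      obtain ⟨b, hb, hbf⟩ := ho false
      exact Finset.one_lt_card.2 ⟨a, ha, b, hb, fun h => by simp [h, hbf] at hat⟩
    exact ⟨block_mem_cutPart _ _, block_mem_cutPart _ _, eg_ne hS hs _,
      ⟨_, self_mem_block _ _, _, self_mem_block _ _, adj_tail hn s _⟩⟩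
  edges_total := by
    intro U hU W hW hne h
    obtain ⟨s, hs, x, hx⟩ := exists_of_joined hn hU hW hne h
    by_cases ho : o s = x
    · exact Or.inl (mem_cutEdges.2 ⟨s, hs, by rw [ho, hx]⟩)
    · refine Or.inr (mem_cutEdges.2 ⟨s, hs, ?_⟩)
      rw [show o s = !x by cases x <;> simpa using ho, eg_swap, hx]
  acyclic := by
    intro U h
    obtain ⟨⟨u, hu⟩, h⟩ := height_lt_of_transGen ho h
    exact lt_irrefl _ (h u hu u hu)

end Cuts

/-! ### Every acyclic partition comes from cut edges and directions -/

section Encode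

variable {n : ℕ}

lemma zero_last_mem_partition (n : ℕ) : ({0, Fin.last n} : Finset _) ∈ (partition n).parts :=
  Finset.mem_insert_self _ _

/-- A connected set of vertices does not cross two vertices outside of it. -/
lemma between_of_connected (hn : 2 ≤ n) {W : Finset (Fin (n + 1))}
    (hW : ((SimpleGraph.cycleGraph (n + 1)).induce (W : Set (Fin (n + 1)))).Connected)
    {x y a b : Fin (n + 1)} (hx : x ∉ W) (hy : y ∉ W) (ha : a ∈ W) (hb : b ∈ W)
    (hxb : x < b) (hby : b < y) : x < a ∧ a < y := by
  have h := hW.preconnected ⟨b, hb⟩ ⟨a, ha⟩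
  rw [SimpleGraph.reachable_iff_reflTransGen] at h
  suffices H : ∀ c : (W : Set (Fin (n + 1))), Relation.ReflTransGen
      ((SimpleGraph.cycleGraph (n + 1)).induce (W : Set (Fin (n + 1)))).Adj ⟨b, hb⟩ c →
      x < c.1 ∧ c.1 < y from H _ h
  intro c hc
  induction hc with
  | refl => exact ⟨hxb, hby⟩
  | @tail c d _ hcd ih =>
    have hdx : d.1 ≠ x := fun h => hx (h ▸ d.2)
    have hdy : d.1 ≠ y := fun h => hy (h ▸ d.2)
    simp only [SimpleGraph.comap_adj, Function.Embedding.subtype_apply] at hcd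
    rw [Fin.lt_def, Fin.lt_def] at ih ⊢
    rw [Ne, Fin.ext_iff] at hdx hdy
    have hyn := y.2
    rcases (adj_iff hn).1 hcd with ⟨s, z, h1, h2⟩ | ⟨h1, h2⟩ | ⟨h1, h2⟩
    · rw [← h1] at ih
      rw [← h2] at hdx hdy ⊢
      cases z <;> simp only [tail_true, tail_false, Bool.not_true, Bool.not_false, Fin.val_succ,
        Fin.val_castSucc] at ih hdx hdy ⊢ <;> omega
    -- The wrap-around edge cannot be used: its ends 0 and `Fin.last n` are never strictly between
    -- `x` and `y`.
    · rw [h1] at ih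
      simp at ih
    · rw [h1, Fin.val_last] at ih
      omega

variable {j : ℕ} (C : AcyclicPartition (partition n) j)

/-- The edges of the cycle between different parts of `C`. -/
def cut : Finset (Fin n) :=
  Finset.univ.filter fun s => C.part.part s.castSucc ≠ C.part.part s.succ

/-- The direction in which an edge of the cycle is oriented in `C`. -/
def ori (s : Fin n) : Bool :=
  decide ((C.part.part s.castSucc, C.part.part s.succ) ∈ C.edges)

variable {C}

lemma mem_cut {s : Fin n} : s ∈ cut C ↔ C.part.part s.castSucc ≠ C.part.part s.succ := by
  simp [cut]

lemma part_zero_eq_part_last : C.part.part 0 = C.part.part (Fin.last n) := by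
  obtain ⟨W, hW, hle⟩ := C.coarsens (zero_last_mem_partition n)
  rw [C.part.part_eq_of_mem hW (hle (by simp)), C.part.part_eq_of_mem hW (hle (by simp))]

lemma part_eq_of_cnt_eq {v w : Fin (n + 1)} (hvw : (v : ℕ) ≤ w)
    (h : cnt (cut C) v = cnt (cut C) w) : C.part.part v = C.part.part w := by
  obtain ⟨k, hk⟩ := Nat.exists_eq_add_of_le hvw
  induction k generalizing v with
  | zero => rw [show v = w from Fin.ext (by omega)]
  | succ k ih =>
    obtain ⟨s, rfl⟩ : ∃ s : Fin n, s.castSucc = v := ⟨⟨v, by omega⟩, rfl⟩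
    rw [Fin.val_castSucc] at hk
    have h1 := cnt_succ (cut C) s
    have h2 := cnt_mono (cut C) (v := s.succ) (w := w) (by rw [Fin.val_succ]; omega)
    have hs : s ∉ cut C := by
      intro hs
      rw [if_pos hs] at h1
      omega
    rw [if_neg hs] at h1
    rw [mem_cut, not_not] at hs
    rw [hs]
    exact ih (by rw [Fin.val_succ]; omega) (by omega) (by rw [Fin.val_succ]; omega)

lemma mem_part_iff {v w : Fin (n + 1)} : w ∈ C.part.part v ↔ C.part.part w = C.part.part v :=
  C.part.mem_part_iff_part_eq_part (Finset.mem_univ _) (Finset.mem_univ _)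

/-- A part other than that of 0 also misses `Fin.last n`, so by connectedness it contains every
vertex between two of its members, and no cut edge lies between them. -/
lemma cnt_eq_of_part_eq (hn : 2 ≤ n) {v w : Fin (n + 1)} (hvw : (v : ℕ) ≤ w)
    (h : C.part.part v = C.part.part w) (h0 : C.part.part v ≠ C.part.part 0) :
    cnt (cut C) v = cnt (cut C) w := by
  have hconn := C.connected (C.part.part v) (C.part.part_mem.2 (Finset.mem_univ v))
  have key : ∀ u : Fin (n + 1), v ≤ u → u ≤ w → C.part.part u = C.part.part v := by
    intro u hvu huw
    by_contra hu
    have hne : u ≠ w := by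
      rintro rfl
      exact hu h.symm
    have hlast : (Fin.last n) ∉ C.part.part v := by
      rw [mem_part_iff, ← part_zero_eq_part_last]
      exact h0.symm
    have hwl : w < Fin.last n := by
      refine lt_of_le_of_ne (Fin.le_last _) ?_
      rintro rfl
      exact h0 (h.trans part_zero_eq_part_last.symm)
    have := (between_of_connected hn hconn (x := u) (y := Fin.last n) (a := v) (b := w)
      (by rwa [mem_part_iff]) hlast (mem_part_iff.2 rfl) (mem_part_iff.2 h.symm)
      (lt_of_le_of_ne huw hne) hwl).1
    exact absurd hvu (not_le.2 this)
  have key2 : ∀ k : ℕ, ∀ u : Fin (n + 1), (u : ℕ) = v + k → u ≤ w →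
      cnt (cut C) u = cnt (cut C) v := by
    intro k
    induction k with
    | zero =>
      intro u hu _
      rw [show u = v from Fin.ext hu]
    | succ k ih =>
      intro u hu huw
      rw [Fin.le_def] at huw
      obtain ⟨s, rfl⟩ : ∃ s : Fin n, s.succ = u := ⟨⟨u - 1, by omega⟩, Fin.ext (by simp; omega)⟩
      rw [Fin.val_succ] at hu huw
      have h1 : C.part.part s.castSucc = C.part.part s.succ := by
        rw [key s.castSucc (by rw [Fin.le_def, Fin.val_castSucc]; omega)
            (by rw [Fin.le_def, Fin.val_castSucc]; omega),
          key s.succ (by rw [Fin.le_def, Fin.val_succ]; omega)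
            (by rw [Fin.le_def, Fin.val_succ]; omega)]
      rw [cnt_succ_of_notMem (by rw [mem_cut, not_not, h1])]
      exact ih s.castSucc (by rw [Fin.val_castSucc]; omega)
        (by rw [Fin.le_def, Fin.val_castSucc]; omega)
  exact (key2 (w - v) w (by omega) le_rfl).symm

/-- The ends of a cut edge lie in different parts, so at most one of them is in the part of 0. -/
lemma exists_notMem_of_cut {s : Fin n} (hs : s ∈ cut C) :
    ∃ u : Fin (n + 1), (s : ℕ) ≤ u ∧ (u : ℕ) ≤ s + 1 ∧ C.part.part u ≠ C.part.part 0 := by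
  by_cases h : C.part.part s.castSucc = C.part.part 0
  · refine ⟨s.succ, by simp, by simp, fun h' => ?_⟩
    exact mem_cut.1 hs (h.trans h'.symm)
  · exact ⟨s.castSucc, by simp, by simp, h⟩

/-- Otherwise there are cut edges below and above `v`. Each has an end outside the part of 0, and
these two ends separate `v` from 0 within that part. -/
lemma cnt_eq_of_part_eq_zero (hn : 2 ≤ n) {v : Fin (n + 1)}
    (h0 : C.part.part v = C.part.part 0) :
    cnt (cut C) v = 0 ∨ cnt (cut C) v = (cut C).card := by
  by_contra! hcon
  obtain ⟨h1, h2⟩ := hcon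
  have hconn := C.connected (C.part.part 0) (C.part.part_mem.2 (Finset.mem_univ 0))
  have hle := cnt_le (cut C) v
  obtain ⟨s, hs, hs0⟩ := exists_cnt_eq (S := cut C) (l := 0) (by omega)
  obtain ⟨t, ht, htv⟩ := exists_cnt_eq (S := cut C) (l := cnt (cut C) v) (by omega)
  have hsv : (s : ℕ) < v := (cnt_pos_iff hs v).2 (by omega)
  have htv : ¬ (t : ℕ) < v := fun h => absurd ((cnt_pos_iff ht v).1 h) (by omega)
  obtain ⟨x, _, hx2, hx⟩ := exists_notMem_of_cut hs
  obtain ⟨y, hy1, _, hy⟩ := exists_notMem_of_cut ht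
  have hxv : x ≠ v := by
    rintro rfl
    exact hx h0
  have hyv : y ≠ v := by
    rintro rfl
    exact hy h0
  rw [Ne, Fin.ext_iff] at hxv hyv
  have := (between_of_connected hn hconn (x := x) (y := y) (a := 0) (b := v)
    (by rwa [mem_part_iff]) (by rwa [mem_part_iff]) (mem_part_iff.2 rfl) (mem_part_iff.2 h0)
    (by rw [Fin.lt_def]; omega) (by rw [Fin.lt_def]; omega)).1
  simp at this

lemma part_eq_iff_lab_eq (hn : 2 ≤ n) {v w : Fin (n + 1)} :
    C.part.part v = C.part.part w ↔ lab (cut C) v = lab (cut C) w := by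
  rw [lab_eq_iff]
  constructor
  · intro h
    by_cases h0 : C.part.part v = C.part.part 0
    · have h1 := cnt_eq_of_part_eq_zero hn h0
      have h2 := cnt_eq_of_part_eq_zero hn (h.symm.trans h0)
      omega
    · rcases le_total (v : ℕ) w with hle | hle
      · exact Or.inl (cnt_eq_of_part_eq hn hle h h0)
      · exact Or.inl (cnt_eq_of_part_eq hn hle h.symm (h ▸ h0)).symm
  · have key : ∀ v w, cnt (cut C) v = 0 → cnt (cut C) w = (cut C).card →
        C.part.part v = C.part.part w := by
      intro v w hv hw
      rw [← part_eq_of_cnt_eq (v := 0) (w := v) (by simp) (by simp [hv]), part_zero_eq_part_last,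
        ← part_eq_of_cnt_eq (v := w) (w := Fin.last n) (Fin.le_last _) (by simp [hw])]
    rintro (h | ⟨h1, h2⟩ | ⟨h1, h2⟩)
    · rcases le_total (v : ℕ) w with hle | hle
      · exact part_eq_of_cnt_eq hle h
      · exact (part_eq_of_cnt_eq hle h.symm).symm
    · exact key v w h1 h2
    · exact (key w v h2 h1).symm

lemma part_part_eq_block (hn : 2 ≤ n) (v : Fin (n + 1)) :
    C.part.part v = block (cut C) v := by
  ext w
  rw [mem_part_iff, part_eq_iff_lab_eq hn, mem_block]

lemma parts_eq_image_part (P : Finpartition (Finset.univ : Finset (Fin (n + 1)))) :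
    P.parts = Finset.univ.image P.part := by
  ext W
  simp only [Finset.mem_image, Finset.mem_univ, true_and]
  constructor
  · intro hW
    obtain ⟨w, hw⟩ := P.nonempty_of_mem_parts hW
    exact ⟨w, P.part_eq_of_mem hW hw⟩
  · rintro ⟨w, rfl⟩
    exact P.part_mem.2 (Finset.mem_univ w)

lemma part_eq_cutPart (hn : 2 ≤ n) : C.part = cutPart (cut C) := by
  apply Finpartition.ext
  rw [parts_eq_image_part, cutPart_parts]
  congr 1
  ext1 v
  exact part_part_eq_block hn v

lemma eg_cut (hn : 2 ≤ n) (s : Fin n) :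
    (C.part.part s.castSucc, C.part.part s.succ) = eg (cut C) s true := by
  simp [part_part_eq_block hn, eg]

lemma eg_mem_edges_iff (hn : 2 ≤ n) {s : Fin n} (hs : s ∈ cut C) (x : Bool) :
    eg (cut C) s x ∈ C.edges ↔ ori C s = x := by
  have hasymm : ∀ U W, (U, W) ∈ C.edges → (W, U) ∉ C.edges := fun U W h h' =>
    C.acyclic U (Relation.TransGen.head h (Relation.TransGen.single h'))
  have htot : eg (cut C) s true ∈ C.edges ∨ eg (cut C) s false ∈ C.edges := by
    rw [← Bool.not_true, eg_swap, ← eg_cut hn]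
    have h1 := C.part.part_mem.2 (Finset.mem_univ s.castSucc)
    have h2 := C.part.part_mem.2 (Finset.mem_univ s.succ)
    exact C.edges_total _ h1 _ h2 (mem_cut.1 hs)
      ⟨_, mem_part_iff.2 rfl, _, mem_part_iff.2 rfl, adj_tail hn s true⟩
  rw [ori, eg_cut hn]
  have h3 : eg (cut C) s true ∈ C.edges → eg (cut C) s false ∉ C.edges := by
    rw [← Bool.not_true, eg_swap]
    exact hasymm _ _
  cases x
  · rw [decide_eq_false_iff_not]
    tauto
  · rw [decide_eq_true_iff]

lemma edges_eq_cutEdges (hn : 2 ≤ n) : C.edges = cutEdges (cut C) (ori C) := by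
  ext e
  rw [mem_cutEdges]
  constructor
  · intro he
    obtain ⟨h1, h2, h3, h4⟩ := C.edges_joined e he
    rw [part_eq_cutPart hn] at h1 h2
    obtain ⟨s, hs, x, hx⟩ := exists_of_joined hn h1 h2 h3 h4
    refine ⟨s, hs, ?_⟩
    rw [Prod.mk.eta] at hx
    rw [(eg_mem_edges_iff hn hs x).1 (hx ▸ he), hx]
  · rintro ⟨s, hs, rfl⟩
    exact (eg_mem_edges_iff hn hs _).2 rfl

lemma cut_nonempty (hn : 2 ≤ n) (hj : 2 ≤ j) : (cut C).Nonempty := by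
  by_contra h
  rw [Finset.not_nonempty_iff_eq_empty] at h
  have h1 := C.card_parts
  have h2 : (cutPart (cut C)).parts ⊆ {block (cut C) 0} := by
    intro W hW
    obtain ⟨v, rfl⟩ := mem_cutPart.1 hW
    rw [Finset.mem_singleton, block_eq_iff, h]
    simp [lab, cnt]
  have := Finset.card_le_card h2
  rw [← part_eq_cutPart hn, h1, Finset.card_singleton] at this
  omega

lemma card_cut (hn : 2 ≤ n) (hj : 2 ≤ j) : (cut C).card = j := by
  rw [← card_cutPart (cut_nonempty hn hj), ← part_eq_cutPart hn, C.card_parts]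

/-- The walk from 0 up to `Fin.last n` closes up, since both ends lie in one block; it contains at
least one step because there are cut edges. The relation is left general so that the walk can also
be read backwards. -/
lemma transGen_of_cut (hn : 2 ≤ n) (hj : 2 ≤ j)
    (r : Finset (Fin (n + 1)) → Finset (Fin (n + 1)) → Prop)
    (hr : ∀ s ∈ cut C, r (block (cut C) s.castSucc) (block (cut C) s.succ)) :
    Relation.TransGen r (block (cut C) 0) (block (cut C) 0) := by
  have key : ∀ v : Fin (n + 1), cnt (cut C) v = 0 ∨
      Relation.TransGen r (block (cut C) 0) (block (cut C) v) := by
    intro v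
    induction v using Fin.induction with
    | zero => simp
    | succ s ih =>
      by_cases hs : s ∈ cut C
      · right
        rcases ih with ih | ih
        · rw [show block (cut C) 0 = block (cut C) s.castSucc by
            rw [block_eq_iff, lab_castSucc hs, ih, lab_zero]]
          exact Relation.TransGen.single (hr s hs)
        · exact ih.tail (hr s hs)
      · rw [cnt_succ_of_notMem hs, block_eq_iff.2 (lab_succ_eq_castSucc hs)]
        exact ih
  rcases key (Fin.last n) with h | h
  · rw [cnt_last, card_cut hn hj] at h
    omega
  · rwa [show block (cut C) (Fin.last n) = block (cut C) 0 by simp [block_eq_iff]] at h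

/-- If all cut edges had the same direction, the walk around the cycle would be a directed cycle. -/
lemma exists_ori_eq (hn : 2 ≤ n) (hj : 2 ≤ j) (x : Bool) : ∃ s ∈ cut C, ori C s = x := by
  by_contra! h
  cases x
  · refine C.acyclic (block (cut C) 0)
      (transGen_of_cut hn hj (fun A B => (A, B) ∈ C.edges) fun s hs => ?_)
    exact (eg_mem_edges_iff hn hs true).2 (by simpa using h s hs)
  · refine C.acyclic (block (cut C) 0) (Relation.transGen_swap.1
      (transGen_of_cut hn hj (Function.swap fun A B => (A, B) ∈ C.edges) fun s hs => ?_))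
    exact (eg_mem_edges_iff hn hs false).2 (by simpa using h s hs)

/-- Every acyclic partition with at least two parts is given by its cut edges and orientation. -/
lemma eq_ofCuts (hn : 2 ≤ n) (hj : 2 ≤ j) :
    C = ofCuts hn (cut C) (ori C) (exists_ori_eq hn hj) (card_cut hn hj) :=
  AcyclicPartition.ext (part_eq_cutPart hn) (edges_eq_cutEdges hn)

lemma cutPart_part (S : Finset (Fin n)) (v : Fin (n + 1)) : (cutPart S).part v = block S v :=
  (cutPart S).part_eq_of_mem (block_mem_cutPart S v) (self_mem_block S v)

lemma two_le_card {S : Finset (Fin n)} {o : Fin n → Bool} (ho : ∀ x, ∃ s ∈ S, o s = x) :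
    2 ≤ S.card := by
  obtain ⟨a, ha, hat⟩ := ho true
  obtain ⟨b, hb, hbf⟩ := ho false
  exact Finset.one_lt_card.2 ⟨a, ha, b, hb, fun h => by simp [h, hbf] at hat⟩

/-- A single cut edge leaves just one block, so `S` can be recovered only when it has at least two
elements. -/
lemma cut_eq_of_part_eq {S : Finset (Fin n)} (hS : 2 ≤ S.card) (h : C.part = cutPart S) :
    cut C = S := by
  ext s
  rw [mem_cut, h, cutPart_part, cutPart_part, Ne, block_eq_iff]
  constructor
  · intro h
    by_contra hs
    exact h (lab_succ_eq_castSucc hs).symm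
  · intro hs h
    exact lab_succ_ne hS hs h.symm

lemma cut_ofCuts (hn : 2 ≤ n) {S : Finset (Fin n)} {o : Fin n → Bool}
    (ho : ∀ x, ∃ s ∈ S, o s = x) (hj : S.card = j) : cut (ofCuts hn S o ho hj) = S :=
  cut_eq_of_part_eq (two_le_card ho) rfl

lemma ori_ofCuts (hn : 2 ≤ n) {S : Finset (Fin n)} {o : Fin n → Bool}
    (ho : ∀ x, ∃ s ∈ S, o s = x) (hj : S.card = j) {s : Fin n} (hs : s ∈ S) :
    ori (ofCuts hn S o ho hj) s = o s := by
  rw [← eg_mem_edges_iff hn (by rwa [cut_ofCuts]), cut_ofCuts]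
  exact mem_cutEdges.2 ⟨s, hs, rfl⟩

lemma ofCuts_congr (hn : 2 ≤ n) {S S' : Finset (Fin n)} {o o' : Fin n → Bool}
    (ho : ∀ x, ∃ s ∈ S, o s = x) (hj : S.card = j) (ho' : ∀ x, ∃ s ∈ S', o' s = x)
    (hj' : S'.card = j) (hS : S = S') (h : ∀ s ∈ S, o s = o' s) :
    ofCuts hn S o ho hj = ofCuts hn S' o' ho' hj' := by
  subst hS
  refine AcyclicPartition.ext rfl ?_
  exact Finset.image_congr fun s hs => by simp only [h s hs]

/-- The number of cut edges with the orientation `x`. -/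
def numOri (C : AcyclicPartition (partition n) j) (x : Bool) : ℕ :=
  ((cut C).filter fun s => ori C s = x).card

lemma numOri_add (C : AcyclicPartition (partition n) j) :
    numOri C true + numOri C false = (cut C).card :=
  card_filter_add _ _

lemma numOri_pos (hn : 2 ≤ n) (hj : 2 ≤ j) (x : Bool) : 0 < numOri C x := by
  obtain ⟨s, hs, hx⟩ := exists_ori_eq (C := C) hn hj x
  exact Finset.card_pos.2 ⟨s, Finset.mem_filter.2 ⟨hs, hx⟩⟩

lemma numOri_ofCuts (hn : 2 ≤ n) {S : Finset (Fin n)} {o : Fin n → Bool}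
    (ho : ∀ x, ∃ s ∈ S, o s = x) (hj : S.card = j) (x : Bool) :
    numOri (ofCuts hn S o ho hj) x = (S.filter fun s => o s = x).card := by
  unfold numOri
  rw [cut_ofCuts]
  congr 1
  exact Finset.filter_congr fun s hs => by rw [ori_ofCuts hn ho hj hs]

end Encode

/-! ### Chip-firing classes and their invariants -/

section Classes

variable {n j : ℕ}

lemma sum_castSucc_eq_sum_succ (f : Fin (n + 1) → ℕ) (h : f 0 = f (Fin.last n)) :
    ∑ s : Fin n, f s.castSucc = ∑ s : Fin n, f s.succ := by
  have := (Fin.sum_univ_castSucc f).symm.trans (Fin.sum_univ_succ f)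
  omega

lemma ori_eq_of_eg_notMem (hn : 2 ≤ n) {C : AcyclicPartition (partition n) j} {s : Fin n}
    (hs : s ∈ cut C) {x : Bool} (h : eg (cut C) s (!x) ∉ C.edges) : ori C s = x := by
  rw [eg_mem_edges_iff hn hs] at h
  cases x <;> simpa using h

lemma cut_eq_of_firesTo {C C' : AcyclicPartition (partition n) j} (h : C.FiresTo C') :
    cut C = cut C' := by
  ext s
  rw [mem_cut, mem_cut, h.1]

/-- The change of direction of a cut edge is the difference of the indicator function of the fired
block at its two ends. Uncut edges contribute difference 0, so the total change telescopes to the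
difference between `Fin.last n` and 0, which vanishes. -/
lemma numOri_true_eq_of_firesTo (hn : 2 ≤ n) {C C' : AcyclicPartition (partition n) j}
    (h : C.FiresTo C') : numOri C true = numOri C' true := by
  have hcut := cut_eq_of_firesTo h
  obtain ⟨_, U, ⟨hU, hsrc⟩, hE⟩ := h
  rw [part_eq_cutPart hn] at hU
  obtain ⟨v, rfl⟩ := mem_cutPart.1 hU
  set S := cut C with hS
  have pt : ∀ s ∈ S, (if ori C' s = true then 1 else 0) + (if s.castSucc ∈ block S v then 1 else 0)
      = (if ori C s = true then 1 else 0) + (if s.succ ∈ block S v then 1 else 0) := by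
    intro s hs
    have hs' : s ∈ cut C' := hcut ▸ hs
    have himg : ∀ e ∈ C.edges, (if e.1 = block S v then (e.2, e.1) else e) ∈ C'.edges :=
      fun e he => hE ▸ Finset.mem_image_of_mem _ he
    have hne : s.succ ∈ block S v → s.castSucc ∉ block S v := by
      intro h1 h2
      rw [mem_block] at h1 h2
      exact mem_cut.1 hs ((part_eq_iff_lab_eq hn).2 (h2.trans h1.symm))
    by_cases h1 : s.castSucc ∈ block S v
    · have h1' := block_eq_iff.2 (mem_block.1 h1)
      have ho : ori C s = true := by
        refine ori_eq_of_eg_notMem hn hs ?_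
        have := hsrc (block S s.succ)
        rwa [← h1'] at this
      have hm := himg _ ((eg_mem_edges_iff hn hs true).2 ho)
      rw [if_pos (by simpa [eg] using h1'), ← eg_swap, ← hS, hcut,
        eg_mem_edges_iff hn hs'] at hm
      have h2 : s.succ ∉ block S v := fun h => hne h h1
      simp [ho, hm, h1, h2]
    · by_cases h2 : s.succ ∈ block S v
      · have h2' := block_eq_iff.2 (mem_block.1 h2)
        have ho : ori C s = false := by
          refine ori_eq_of_eg_notMem hn hs ?_
          have := hsrc (block S s.castSucc)
          rwa [← h2'] at this
        have hm := himg _ ((eg_mem_edges_iff hn hs false).2 ho)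
        rw [if_pos (by simpa [eg] using h2'), ← eg_swap, ← hS, hcut,
          eg_mem_edges_iff hn hs'] at hm
        simp only [Bool.not_false] at hm
        simp [ho, hm, h1, h2]
      · have hm := himg _ ((eg_mem_edges_iff hn hs _).2 rfl)
        rw [if_neg, ← hS, hcut, eg_mem_edges_iff hn hs'] at hm
        · simp [hm, h1, h2]
        · rw [← hS, eg, block_eq_iff, ← mem_block]
          cases ori C s <;> simpa [tail]
  have hsum := Finset.sum_congr (rfl : S = S) pt
  rw [Finset.sum_add_distrib, Finset.sum_add_distrib] at hsum
  have htel := sum_castSucc_eq_sum_succ (fun w => if w ∈ block S v then 1 else 0)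
    (by simp [mem_block])
  rw [← Finset.sum_add_sum_compl S,
    ← Finset.sum_add_sum_compl S (fun s => if s.succ ∈ _ then 1 else 0)]
    at htel
  have hcompl : ∑ s ∈ Sᶜ, (if s.castSucc ∈ block S v then 1 else 0) =
      ∑ s ∈ Sᶜ, (if s.succ ∈ block S v then 1 else 0) := by
    refine Finset.sum_congr rfl fun s hs => ?_
    rw [Finset.mem_compl] at hs
    simp only [mem_block, lab_succ_eq_castSucc hs]
  rw [numOri, numOri, Finset.card_filter, Finset.card_filter, ← hcut, ← hS]
  omega

lemma numOri_eq_of_firesTo (hn : 2 ≤ n) {C C' : AcyclicPartition (partition n) j}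
    (h : C.FiresTo C') (x : Bool) : numOri C x = numOri C' x := by
  have h1 := numOri_true_eq_of_firesTo hn h
  have h2 := numOri_add C
  have h3 := numOri_add C'
  rw [cut_eq_of_firesTo h] at h2
  cases x <;> omega

/-- The cut edges of a class. -/
def clsCut (c : ChipClass (partition n) j) : Finset (Fin n) :=
  Quot.lift cut (fun _ _ h => cut_eq_of_firesTo h) c

/-- The number of cut edges with the orientation `x` in a class. -/
def clsNum (hn : 2 ≤ n) (c : ChipClass (partition n) j) (x : Bool) : ℕ :=
  Quot.lift (fun C => numOri C x) (fun _ _ h => numOri_eq_of_firesTo hn h x) c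

@[simp] lemma clsCut_cls (C : AcyclicPartition (partition n) j) : clsCut C.cls = cut C := rfl

@[simp] lemma clsNum_cls (hn : 2 ≤ n) (C : AcyclicPartition (partition n) j) (x : Bool) :
    clsNum hn C.cls x = numOri C x := rfl

lemma exists_cls_eq (c : ChipClass (partition n) j) : ∃ C : AcyclicPartition (partition n) j,
    C.cls = c := Quot.exists_rep c

lemma card_clsCut (hn : 2 ≤ n) (hj : 2 ≤ j) (c : ChipClass (partition n) j) :
    (clsCut c).card = j := by
  obtain ⟨C, rfl⟩ := exists_cls_eq c
  exact card_cut hn hj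

lemma clsNum_pos (hn : 2 ≤ n) (hj : 2 ≤ j) (c : ChipClass (partition n) j) (x : Bool) :
    0 < clsNum hn c x := by
  obtain ⟨C, rfl⟩ := exists_cls_eq c
  exact numOri_pos hn hj x

lemma clsNum_add (hn : 2 ≤ n) (hj : 2 ≤ j) (c : ChipClass (partition n) j) :
    clsNum hn c true + clsNum hn c false = j := by
  obtain ⟨C, rfl⟩ := exists_cls_eq c
  rw [clsNum_cls, clsNum_cls, numOri_add, card_cut hn hj]

/-! ### A class is determined by its cut edges and the number of positive edges -/

lemma isSource_iff (hn : 2 ≤ n) {C : AcyclicPartition (partition n) j} {v : Fin (n + 1)} :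
    C.IsSource (block (cut C) v) ↔
      ∀ s ∈ cut C, lab (cut C) (tail s !ori C s) ≠ lab (cut C) v := by
  have hmem : block (cut C) v ∈ C.part.parts := by
    rw [part_eq_cutPart hn]
    exact block_mem_cutPart _ _
  constructor
  · rintro ⟨_, h⟩ s hs heq
    refine h (block (cut C) (tail s (ori C s))) ?_
    rw [← block_eq_iff.2 heq]
    exact (eg_mem_edges_iff hn hs _).2 rfl
  · refine fun h => ⟨hmem, fun W hW => ?_⟩
    rw [edges_eq_cutEdges hn] at hW
    obtain ⟨s, hs, he⟩ := mem_cutEdges.1 hW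
    exact h s hs (block_eq_iff.1 (Prod.mk.inj he).2)

lemma isSink_iff (hn : 2 ≤ n) {C : AcyclicPartition (partition n) j} {v : Fin (n + 1)} :
    C.IsSink (block (cut C) v) ↔
      ∀ s ∈ cut C, lab (cut C) (tail s (ori C s)) ≠ lab (cut C) v := by
  have hmem : block (cut C) v ∈ C.part.parts := by
    rw [part_eq_cutPart hn]
    exact block_mem_cutPart _ _
  constructor
  · rintro ⟨_, h⟩ s hs heq
    refine h (block (cut C) (tail s !(ori C s))) ?_
    rw [← block_eq_iff.2 heq]
    exact (eg_mem_edges_iff hn hs _).2 rfl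
  · refine fun h => ⟨hmem, fun W hW => ?_⟩
    rw [edges_eq_cutEdges hn] at hW
    obtain ⟨s, hs, he⟩ := mem_cutEdges.1 hW
    exact h s hs (block_eq_iff.1 (Prod.mk.inj he).1)

/-- Exchanging the orientations of two consecutive cut edges is a chip-firing move. -/
lemma exists_cls_eq_swap (hn : 2 ≤ n) (hj : 2 ≤ j) (C : AcyclicPartition (partition n) j)
    {s t : Fin n} (hs : s ∈ cut C) (ht : t ∈ cut C)
    (hst : cnt (cut C) t.castSucc = cnt (cut C) s.castSucc + 1) (hos : ori C s = true)
    (hot : ori C t = false) : ∃ C' : AcyclicPartition (partition n) j, C'.cls = C.cls ∧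
      cut C' = cut C ∧ ∀ r ∈ cut C, ori C' r = if r = s then false else if r = t then true
        else ori C r := by
  set S := cut C with hS
  set o : Fin n → Bool := fun r => if r = s then false else if r = t then true else ori C r with ho
  have hne : t ≠ s := by
    rintro rfl
    omega
  have hos' : o s = false := by simp [ho]
  have hot' : o t = true := by simp [ho, hne]
  have hox : ∀ x, ∃ r ∈ S, o r = x := by
    intro x
    cases x
    · exact ⟨s, hs, hos'⟩
    · exact ⟨t, ht, hot'⟩
  have hcard : S.card = j := card_cut hn hj
  have hlab : lab S s.succ = lab S t.castSucc := by
    rw [lab_succ hs, lab_castSucc ht, hst, if_neg]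
    have := cnt_castSucc_lt ht
    omega
  have hcut := cut_ofCuts hn hox hcard
  have hori : ∀ r ∈ S, ori (ofCuts hn S o hox hcard) r = o r :=
    fun r hr => ori_ofCuts hn hox hcard hr
  -- In `C` the arc between `s` and `t` is a sink; after the exchange it is a source. So it is the
  -- new partition that fires to `C`.
  refine ⟨ofCuts hn S o hox hcard, Quot.sound ⟨part_eq_cutPart hn, block S t.castSucc, ?_, ?_⟩,
    hcut, hori⟩
  · have := isSource_iff hn (C := ofCuts hn S o hox hcard) (v := t.castSucc)
    rw [hcut] at this
    refine this.2 fun r hr h => ?_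
    rw [hori r hr] at h
    cases hr' : o r <;> rw [hr'] at h
    · rw [lab_castSucc_injOn hr ht h, hot'] at hr'
      exact Bool.noConfusion hr'
    · rw [lab_succ_injOn hr hs (h.trans hlab.symm), hos'] at hr'
      exact Bool.noConfusion hr'
  · change C.edges = Finset.image _ (cutEdges S o)
    rw [edges_eq_cutEdges hn, cutEdges, cutEdges, Finset.image_image]
    refine Finset.image_congr fun r hr => ?_
    simp only [Function.comp_apply]
    by_cases hrs : r = s
    · subst hrs
      rw [hos, hos', if_pos (by simpa [eg, block_eq_iff] using hlab), ← eg_swap, Bool.not_false]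
    · by_cases hrt : r = t
      · subst hrt
        rw [hot, hot', if_pos (by simp [eg]), ← eg_swap, Bool.not_true]
      · have : o r = ori C r := by simp [ho, hrs, hrt]
        rw [this, if_neg]
        intro h
        rw [eg, block_eq_iff] at h
        cases hr' : ori C r <;> simp only [hr', tail_true, tail_false] at h
        · exact hrs (lab_succ_injOn hr hs (h.trans hlab.symm))
        · exact hrt (lab_castSucc_injOn hr ht h)

lemma exists_sorted (hn : 2 ≤ n) (hj : 2 ≤ j) (N : ℕ) : ∀ C : AcyclicPartition (partition n) j,
    (∑ s ∈ (cut C).filter (fun s => ori C s = false), (s : ℕ)) = N →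
    ∃ C' : AcyclicPartition (partition n) j, C'.cls = C.cls ∧
      ∀ a ∈ cut C', ∀ b ∈ cut C', ori C' a = true → ori C' b = false → b < a := by
  induction N using Nat.strong_induction_on with
  | _ N ih =>
    intro C hN
    by_cases hsw : ∃ s ∈ cut C, ∃ t ∈ cut C,
        cnt (cut C) t.castSucc = cnt (cut C) s.castSucc + 1 ∧ ori C s = true ∧ ori C t = false
    · obtain ⟨s, hs, t, ht, hst, hos, hot⟩ := hsw
      have hlt : s < t := (cnt_lt_cnt_iff hs ht).1 (by omega)
      obtain ⟨C₁, hcls, hcut, hori⟩ := exists_cls_eq_swap hn hj C hs ht hst hos hot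
      have hF : (cut C₁).filter (fun s => ori C₁ s = false) =
          insert s (((cut C).filter (fun s => ori C s = false)).erase t) := by
        ext r
        rw [hcut]
        simp only [Finset.mem_filter, Finset.mem_insert, Finset.mem_erase]
        constructor
        · rintro ⟨h1, h2⟩
          rw [hori r h1] at h2
          by_cases hrs : r = s
          · exact Or.inl hrs
          · by_cases hrt : r = t
            · simp [hrt] at h2
              exact absurd h2 hlt.ne'
            · exact Or.inr ⟨hrt, h1, by simpa [hrs, hrt] using h2⟩
        · rintro (rfl | ⟨h1, h2, h3⟩)
          · exact ⟨hs, by simp [hori r hs]⟩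
          · exact ⟨h2, by simp [hori r h2, h1, h3]⟩
      -- The exchange replaces `t` by the smaller `s` among the downward edges, so the sum of their
      -- positions decreases.
      have hsum : (∑ s ∈ (cut C₁).filter (fun s => ori C₁ s = false), (s : ℕ)) < N := by
        rw [hF, Finset.sum_insert (by simp [hos]), ← hN,
          ← Finset.sum_erase_add _ _ (Finset.mem_filter.2 ⟨ht, hot⟩)]
        have : (s : ℕ) < t := hlt
        omega
      obtain ⟨C', h1, h2⟩ := ih _ hsum C₁ rfl
      exact ⟨C', h1.trans hcls, h2⟩
    · refine ⟨C, rfl, ?_⟩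
      push Not at hsw
      have key : ∀ k : ℕ, ∀ a ∈ cut C, ∀ b ∈ cut C,
          cnt (cut C) b.castSucc = cnt (cut C) a.castSucc + k → ori C a = true →
          ori C b = true := by
        intro k
        induction k with
        | zero =>
          intro a ha b hb h hoa
          rwa [cnt_injOn hb ha h]
        | succ k ihk =>
          intro a ha b hb h hoa
          have := cnt_castSucc_lt hb
          obtain ⟨r, hr, hrk⟩ := exists_cnt_eq (S := cut C) (l := cnt (cut C) a.castSucc + k)
            (by omega)
          have h1 := ihk a ha r hr hrk hoa
          simpa using hsw r hr b hb (by omega) h1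
      intro a ha b hb hoa hob
      by_contra hle
      have := cnt_mono (cut C) (v := a.castSucc) (w := b.castSucc) (by simpa using hle)
      have := key (cnt (cut C) b.castSucc - cnt (cut C) a.castSucc) a ha b hb (by omega) hoa
      rw [hob] at this
      exact Bool.noConfusion this

/-- When all downward edges precede all upward ones, their number fixes the orientation. This is the
normal form of a class. -/
lemma ori_of_sorted {C : AcyclicPartition (partition n) j}
    (h : ∀ a ∈ cut C, ∀ b ∈ cut C, ori C a = true → ori C b = false → b < a) {s : Fin n}
    (hs : s ∈ cut C) : ori C s = decide (numOri C false ≤ cnt (cut C) s.castSucc) := by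
  cases ho : ori C s
  · rw [eq_comm, decide_eq_false_iff_not, not_le]
    refine Finset.card_lt_card ((Finset.ssubset_iff_of_subset ?_).2
      ⟨s, Finset.mem_filter.2 ⟨hs, ho⟩, by simp⟩)
    intro r hr
    rw [Finset.mem_filter, Fin.val_castSucc] at hr
    refine Finset.mem_filter.2 ⟨hr.1, ?_⟩
    by_contra hor
    exact absurd (h r hr.1 s hs (by simpa using hor) ho) (not_lt.2 (le_of_lt hr.2))
  · rw [eq_comm, decide_eq_true_iff]
    refine Finset.card_le_card fun r hr => ?_
    rw [Finset.mem_filter] at hr ⊢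
    exact ⟨hr.1, by simpa using h s hs r hr.1 ho hr.2⟩

lemma cls_eq_cls (hn : 2 ≤ n) (hj : 2 ≤ j) {C C' : AcyclicPartition (partition n) j}
    (hcut : cut C = cut C') (hnum : numOri C true = numOri C' true) : C.cls = C'.cls := by
  obtain ⟨D, hD, hDs⟩ := exists_sorted hn hj _ C rfl
  obtain ⟨D', hD', hDs'⟩ := exists_sorted hn hj _ C' rfl
  rw [← hD, ← hD']
  have h1 : cut D = cut D' := by
    rw [← clsCut_cls, ← clsCut_cls, hD, hD', clsCut_cls, clsCut_cls, hcut]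
  have h2 : numOri D false = numOri D' false := by
    have hC := numOri_add C
    have hC' := numOri_add C'
    rw [← clsNum_cls hn, ← clsNum_cls hn, hD, hD', clsNum_cls, clsNum_cls]
    rw [hcut] at hC
    omega
  rw [eq_ofCuts (C := D) hn hj, eq_ofCuts (C := D') hn hj]
  congr 1
  refine ofCuts_congr hn _ _ _ _ h1 fun s hs => ?_
  rw [ori_of_sorted hDs hs, ori_of_sorted hDs' (h1 ▸ hs), h1, h2]

lemma chipClass_ext (hn : 2 ≤ n) (hj : 2 ≤ j) {c c' : ChipClass (partition n) j}
    (hcut : clsCut c = clsCut c') (x : Bool) (hnum : clsNum hn c x = clsNum hn c' x) : c = c' := by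
  have h1 := clsNum_add hn hj c
  have h2 := clsNum_add hn hj c'
  have h3 : clsNum hn c true = clsNum hn c' true := by
    cases x <;> omega
  obtain ⟨C, rfl⟩ := exists_cls_eq c
  obtain ⟨C', rfl⟩ := exists_cls_eq c'
  exact cls_eq_cls hn hj hcut h3

lemma eq_onePart (C : AcyclicPartition (partition n) 1) : C = onePart n := by
  have hpart : C.part.parts = {Finset.univ} := by
    obtain ⟨W, hW⟩ := Finset.card_eq_one.1 C.card_parts
    have := C.part.sup_parts
    rw [hW, Finset.sup_singleton, id] at this
    rw [hW, this]
  refine AcyclicPartition.ext (Finpartition.ext (hpart.trans ?_)) ?_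
  · simp [onePart]
  · change C.edges = ∅
    rw [Finset.eq_empty_iff_forall_notMem]
    intro e he
    obtain ⟨h1, h2, h3, _⟩ := C.edges_joined e he
    rw [hpart, Finset.mem_singleton] at h1 h2
    exact h3 (h1.trans h2.symm)

lemma chipClass_one_unique (c : ChipClass (partition n) 1) : c = (onePart n).cls := by
  obtain ⟨C, rfl⟩ := exists_cls_eq c
  rw [eq_onePart C]

instance : Subsingleton (ChipClass (partition n) 1) :=
  ⟨fun a b => (chipClass_one_unique a).trans (chipClass_one_unique b).symm⟩

end Classes

/-! ### Contraction of edges in a class -/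

section Contraction

variable {n : ℕ}

/-- Labels after `s` shift down by one and the others stay. The inner exception occurs only if `s`
is the last cut edge, when the last block joins the block with label 0. -/
lemma lab_erase {S : Finset (Fin n)} {s : Fin n} (hs : s ∈ S) (v : Fin (n + 1)) :
    lab (S.erase s) v = if lab S v ≤ lab S s.castSucc then
      (if lab S v + 1 = S.card then 0 else lab S v) else lab S v - 1 := by
  have h1 := cnt_erase hs v
  have h3 := cnt_pos_iff hs v
  have h5 := cnt_castSucc_lt hs
  have h6 := cnt_le S v
  have h8 := Finset.card_erase_add_one hs
  rw [lab_castSucc hs]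
  unfold lab
  split_ifs at * <;> omega

lemma lab_erase_eq_iff {S : Finset (Fin n)} {s : Fin n} (hs : s ∈ S) (v w : Fin (n + 1)) :
    lab (S.erase s) v = lab (S.erase s) w ↔ lab S v = lab S w ∨
      ((lab S v = lab S s.castSucc ∨ lab S v = lab S s.succ) ∧
        (lab S w = lab S s.castSucc ∨ lab S w = lab S s.succ)) := by
  have h1 := lab_lt ⟨s, hs⟩ v
  have h2 := lab_lt ⟨s, hs⟩ w
  have h5 := cnt_castSucc_lt hs
  rw [lab_erase hs, lab_erase hs, lab_succ hs, lab_castSucc hs]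
  generalize lab S v = a at *
  generalize lab S w = b at *
  generalize cnt S s.castSucc = p at *
  split_ifs <;> omega

lemma merge_block {S : Finset (Fin n)} {s : Fin n} (hs : s ∈ S) (x : Bool) (v : Fin (n + 1)) :
    merge (eg S s x) (block S v) = block (S.erase s) v := by
  ext w
  rw [mem_block, lab_erase_eq_iff hs]
  unfold merge
  split_ifs with h <;> cases x <;>
    simp only [eg, tail_true, tail_false, Bool.not_true, Bool.not_false, block_eq_iff,
      Finset.mem_union, mem_block] at h ⊢ <;> grind

lemma mergeEdge_eg {S : Finset (Fin n)} {s : Fin n} (hs : s ∈ S) (x : Bool) (t : Fin n)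
    (y : Bool) : mergeEdge (eg S s x) (eg S t y) = eg (S.erase s) t y := by
  rw [mergeEdge]
  conv_lhs => rw [eg.eq_1 S t y]
  rw [merge_block hs, merge_block hs, eg]

lemma image_merge_parts {S : Finset (Fin n)} {s : Fin n} (hs : s ∈ S) (x : Bool) :
    (cutPart S).parts.image (merge (eg S s x)) = (cutPart (S.erase s)).parts := by
  rw [cutPart_parts, cutPart_parts, Finset.image_image]
  exact Finset.image_congr fun v _ => merge_block hs x v

lemma exists_eg_of_mem_edges (hn : 2 ≤ n) {j : ℕ} {C : AcyclicPartition (partition n) j}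
    {f : Finset (Fin (n + 1)) × Finset (Fin (n + 1))} (hf : f ∈ C.edges) :
    ∃ s ∈ cut C, f = eg (cut C) s (ori C s) := by
  rw [edges_eq_cutEdges hn] at hf
  obtain ⟨s, hs, he⟩ := mem_cutEdges.1 hf
  exact ⟨s, hs, he.symm⟩

/-- At least two parts remain after the contraction, so the contracted partition still determines
its cut edges; the two-part case is treated separately in `contractible_two`. -/
lemma contractsTo_iff (hn : 2 ≤ n) {q : ℕ} {C : AcyclicPartition (partition n) (q + 2 + 1)}
    {C' : AcyclicPartition (partition n) (q + 2)} {s : Fin n} (hs : s ∈ cut C) :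
    C.ContractsTo (eg (cut C) s (ori C s)) C' ↔
      cut C' = (cut C).erase s ∧ ∀ t ∈ (cut C).erase s, ori C' t = ori C t := by
  have hcard : 2 ≤ ((cut C).erase s).card := by
    rw [Finset.card_erase_of_mem hs, card_cut hn (by omega)]
    omega
  constructor
  · rintro ⟨_, hp, he⟩
    have hcut : cut C' = (cut C).erase s := by
      refine cut_eq_of_part_eq hcard (Finpartition.ext ?_)
      rw [hp, part_eq_cutPart hn, image_merge_parts hs]
    refine ⟨hcut, fun t ht => ?_⟩
    rw [← eg_mem_edges_iff hn (by rwa [hcut]), he, hcut]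
    refine Finset.mem_filter.2 ⟨Finset.mem_image.2 ⟨eg (cut C) t (ori C t), ?_,
      mergeEdge_eg hs _ _ _⟩, eg_ne hcard ht _⟩
    exact (eg_mem_edges_iff hn (Finset.mem_of_mem_erase ht) _).2 rfl
  · rintro ⟨hcut, hori⟩
    refine ⟨(eg_mem_edges_iff hn hs _).2 rfl, ?_, ?_⟩
    · rw [part_eq_cutPart hn, part_eq_cutPart (C := C) hn, image_merge_parts hs, hcut]
    · rw [edges_eq_cutEdges hn, edges_eq_cutEdges (C := C) hn, hcut]
      ext e
      rw [mem_cutEdges, Finset.mem_filter, cutEdges, Finset.image_image, Finset.mem_image]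
      simp only [Function.comp_apply, mergeEdge_eg hs]
      constructor
      · rintro ⟨t, ht, rfl⟩
        exact ⟨⟨t, Finset.mem_of_mem_erase ht, by rw [hori t ht]⟩, eg_ne hcard ht _⟩
      · rintro ⟨⟨t, ht, rfl⟩, hne⟩
        have ht' : t ∈ (cut C).erase s := by
          refine Finset.mem_erase.2 ⟨?_, ht⟩
          rintro rfl
          apply hne
          -- The contracted edge becomes a loop, and exactly this edge is removed by the filter.
          have : lab ((cut C).erase t) t.succ = lab ((cut C).erase t) t.castSucc :=
            lab_succ_eq_castSucc (by simp)
          cases ori C t <;> simp [eg, block_eq_iff, this]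
        exact ⟨t, ht', by rw [hori t ht']⟩

lemma numOri_of_contractsTo (hn : 2 ≤ n) {q : ℕ} {C : AcyclicPartition (partition n) (q + 2 + 1)}
    {C' : AcyclicPartition (partition n) (q + 2)} {s : Fin n} (hs : s ∈ cut C)
    (h : C.ContractsTo (eg (cut C) s (ori C s)) C') (y : Bool) :
    numOri C' y + (if ori C s = y then 1 else 0) = numOri C y := by
  obtain ⟨hcut, hori⟩ := (contractsTo_iff hn hs).1 h
  unfold numOri
  rw [hcut, Finset.filter_congr (q := fun t => ori C t = y) fun t ht => by rw [hori t ht],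
    Finset.filter_erase]
  split_ifs with h
  · rw [Finset.card_erase_add_one (Finset.mem_filter.2 ⟨hs, h⟩)]
  · rw [Finset.erase_eq_of_notMem (by simp [h]), add_zero]

/-- Only the numbers of directions matter in a class, so the direction of `s` may be exchanged with
that of any cut edge `t` directed as required. -/
lemma exists_rep_ori (hn : 2 ≤ n) {j : ℕ} (hj : 2 ≤ j) (c : ChipClass (partition n) j)
    {s : Fin n} (hs : s ∈ clsCut c) (x : Bool) :
    ∃ C : AcyclicPartition (partition n) j, C.cls = c ∧ ori C s = x := by
  obtain ⟨C, rfl⟩ := exists_cls_eq c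
  rw [clsCut_cls] at hs
  obtain ⟨t, ht, hx⟩ := exists_ori_eq (C := C) hn hj x
  have hmem : ∀ r ∈ cut C, Equiv.swap s t r ∈ cut C := by
    intro r hr
    by_cases h1 : r = s
    · simpa [h1]
    · by_cases h2 : r = t
      · simpa [h2]
      · rwa [Equiv.swap_apply_of_ne_of_ne h1 h2]
  have ho : ∀ y, ∃ r ∈ cut C, ori C (Equiv.swap s t r) = y := by
    intro y
    obtain ⟨r, hr, hy⟩ := exists_ori_eq (C := C) hn hj y
    exact ⟨Equiv.swap s t r, hmem r hr, by rwa [Equiv.swap_apply_self]⟩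
  have hcard : (cut C).card = j := card_cut hn hj
  refine ⟨ofCuts hn (cut C) (fun r => ori C (Equiv.swap s t r)) ho hcard, ?_, ?_⟩
  · refine cls_eq_cls hn hj (cut_ofCuts hn ho hcard) ?_
    rw [numOri_ofCuts, numOri]
    refine Finset.card_nbij' (Equiv.swap s t) (Equiv.swap s t) ?_ ?_ ?_ ?_
    · intro r hr
      simp only [Finset.coe_filter, Set.mem_ofPred_eq] at hr ⊢
      exact ⟨hmem r hr.1, hr.2⟩
    · intro r hr
      simp only [Finset.coe_filter, Set.mem_ofPred_eq] at hr ⊢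
      exact ⟨hmem r hr.1, by rw [Equiv.swap_apply_self]; exact hr.2⟩
    · intro r _
      exact Equiv.swap_apply_self _ _ _
    · intro r _
      exact Equiv.swap_apply_self _ _ _
  · rw [ori_ofCuts hn ho hcard hs, Equiv.swap_apply_left, hx]

lemma exists_eg_of_contractible (hn : 2 ≤ n) {j : ℕ} {c : ChipClass (partition n) (j + 1)}
    {f : Finset (Fin (n + 1)) × Finset (Fin (n + 1))} (h : c.Contractible f) :
    ∃ s ∈ clsCut c, ∃ x, f = eg (clsCut c) s x := by
  obtain ⟨⟨C, C'⟩, rfl, hC⟩ := h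
  obtain ⟨s, hs, hf⟩ := exists_eg_of_mem_edges hn hC.1
  exact ⟨s, hs, _, hf⟩

lemma not_contractible_of_eq {j : ℕ} {c : ChipClass (partition n) (j + 1)}
    {f : Finset (Fin (n + 1)) × Finset (Fin (n + 1))} (h : f.1 = f.2) : ¬ c.Contractible f := by
  rintro ⟨⟨C, C'⟩, rfl, hC⟩
  exact (C.edges_joined f hC.1).2.2.1 h

lemma not_contractible_one (c : ChipClass (partition n) 1)
    (f : Finset (Fin (n + 1)) × Finset (Fin (n + 1))) :
    ¬ ChipClass.Contractible (j := 0) c f := by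
  rintro ⟨⟨C, C'⟩, rfl, hC⟩
  have := hC.1
  simp only [eq_onePart C] at this
  simp [onePart] at this

/-- The contracted orientation is acyclic when both directions survive, so one further edge with
direction `x` is needed. The location of `s` is irrelevant by `exists_rep_ori`. -/
lemma contractible_iff (hn : 2 ≤ n) {q : ℕ} {c : ChipClass (partition n) (q + 2 + 1)} {s : Fin n}
    (hs : s ∈ clsCut c) (x : Bool) :
    c.Contractible (eg (clsCut c) s x) ↔ 2 ≤ clsNum hn c x := by
  constructor
  · rintro ⟨⟨C, C'⟩, hc, hC⟩
    dsimp only at hc hC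
    subst hc
    rw [clsCut_cls] at hs hC
    have hx := (eg_mem_edges_iff hn hs x).1 hC.1
    subst hx
    have := numOri_of_contractsTo hn hs hC (ori C s)
    rw [if_pos rfl] at this
    have := numOri_pos (C := C') hn (by omega) (ori C s)
    rw [clsNum_cls]
    omega
  · intro h
    obtain ⟨C, rfl, rfl⟩ := exists_rep_ori hn (by omega) c hs x
    rw [clsCut_cls] at hs ⊢
    rw [clsNum_cls] at h
    have ho : ∀ y, ∃ t ∈ (cut C).erase s, ori C t = y := by
      intro y
      by_cases hy : ori C s = y
      · subst hy
        obtain ⟨t, ht, hts⟩ := Finset.exists_mem_ne (by exact h) s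
        rw [Finset.mem_filter] at ht
        exact ⟨t, Finset.mem_erase.2 ⟨hts, ht.1⟩, ht.2⟩
      · obtain ⟨t, ht, hty⟩ := exists_ori_eq (C := C) hn (by omega) y
        refine ⟨t, Finset.mem_erase.2 ⟨?_, ht⟩, hty⟩
        rintro rfl
        exact hy hty
    have hcard : ((cut C).erase s).card = q + 2 := by
      rw [Finset.card_erase_of_mem hs, card_cut hn (by omega)]
      omega
    refine ⟨⟨C, ofCuts hn _ (ori C) ho hcard⟩, rfl, (contractsTo_iff hn hs).2 ⟨?_, ?_⟩⟩
    · exact cut_ofCuts hn ho hcard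
    · exact fun t ht => ori_ofCuts hn ho hcard ht

lemma block_eq_univ {S : Finset (Fin n)} (hS : S.card = 1) (v : Fin (n + 1)) :
    block S v = Finset.univ := by
  ext w
  have h := lab_lt (S := S) (Finset.card_pos.1 (by omega))
  have h1 := h v
  have h2 := h w
  simp only [mem_block, Finset.mem_univ, iff_true]
  omega

/-- Here both parallel cut edges disappear together and no orientation is left, so the numerical
condition of `contractible_iff` is absent. -/
lemma contractible_two (hn : 2 ≤ n) {c : ChipClass (partition n) (1 + 1)} {s : Fin n}
    (hs : s ∈ clsCut c) (x : Bool) : c.Contractible (eg (clsCut c) s x) := by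
  obtain ⟨C, rfl, rfl⟩ := exists_rep_ori hn (by omega) c hs x
  rw [clsCut_cls] at hs ⊢
  have hcard : ((cut C).erase s).card = 1 := by
    rw [Finset.card_erase_of_mem hs, card_cut hn (by omega)]
  refine ⟨⟨C, onePart n⟩, rfl, (eg_mem_edges_iff hn hs _).2 rfl, ?_, ?_⟩
  · dsimp only
    rw [part_eq_cutPart (C := C) hn, image_merge_parts hs, cutPart_parts,
      show block ((cut C).erase s) = fun _ => Finset.univ from funext (block_eq_univ hcard),
      Finset.image_const Finset.univ_nonempty]
    simp [onePart]
  · dsimp only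
    rw [eq_comm, edges_eq_cutEdges (C := C) hn]
    change _ = ∅
    rw [Finset.filter_eq_empty_iff]
    intro e he
    rw [cutEdges, Finset.image_image] at he
    obtain ⟨t, _, rfl⟩ := Finset.mem_image.1 he
    simp only [Function.comp_apply, mergeEdge_eg hs]
    simp [eg, block_eq_univ hcard]

variable {q : ℕ} {c : ChipClass (partition n) (q + 2 + 1)} {s : Fin n} {x : Bool}

lemma contract_spec (hn : 2 ≤ n) (hs : s ∈ clsCut c)
    (h : c.Contractible (eg (clsCut c) s x)) :
    ∃ (C : AcyclicPartition (partition n) (q + 2 + 1))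
      (C' : AcyclicPartition (partition n) (q + 2)),
      h.choose = (C, C') ∧ C.cls = c ∧ C'.cls = ChipClass.contract h ∧ ori C s = x ∧
        C.ContractsTo (eg (cut C) s (ori C s)) C' := by
  have key : ∀ CC :
      AcyclicPartition (partition n) (q + 2 + 1) × AcyclicPartition (partition n) (q + 2),
      CC.1.cls = c → CC.1.ContractsTo (eg (clsCut c) s x) CC.2 →
      ori CC.1 s = x ∧ CC.1.ContractsTo (eg (cut CC.1) s (ori CC.1 s)) CC.2 := by
    rintro ⟨C, C'⟩ hc hC
    dsimp only at hc hC ⊢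
    subst hc
    have hx := (eg_mem_edges_iff hn hs x).1 hC.1
    exact ⟨hx, hx ▸ hC⟩
  exact ⟨h.choose.1, h.choose.2, rfl, h.choose_spec.1, rfl,
    key _ h.choose_spec.1 h.choose_spec.2⟩

variable {f : Finset (Fin (n + 1)) × Finset (Fin (n + 1))}

lemma clsCut_contract (hn : 2 ≤ n) (hs : s ∈ clsCut c) (hf : f = eg (clsCut c) s x)
    (h : c.Contractible f) : clsCut (ChipClass.contract h) = (clsCut c).erase s := by
  subst hf
  obtain ⟨C, C', _, h1, h2, _, h3⟩ := contract_spec hn hs h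
  rw [← h2, clsCut_cls]
  have hs' : s ∈ cut C := by rwa [← clsCut_cls, h1]
  rw [((contractsTo_iff hn hs').1 h3).1, ← clsCut_cls, h1]

lemma clsNum_contract (hn : 2 ≤ n) (hs : s ∈ clsCut c) (hf : f = eg (clsCut c) s x)
    (h : c.Contractible f) (y : Bool) :
    clsNum hn (ChipClass.contract h) y + (if x = y then 1 else 0) = clsNum hn c y := by
  subst hf
  obtain ⟨C, C', _, h1, h2, h4, h3⟩ := contract_spec hn hs h
  have hs' : s ∈ cut C := by rwa [← clsCut_cls, h1]
  have := numOri_of_contractsTo hn hs' h3 y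
  rwa [← clsNum_cls hn, h2, ← clsNum_cls hn C, h1, h4] at this

/-! ### Divisors and monomials -/

lemma divisor_eq (hn : 2 ≤ n) {j : ℕ} (C : AcyclicPartition (partition n) j) (i : Fin (n + 1)) :
    C.divisor i = ((cut C).filter fun s => tail s (ori C s) = i).card := by
  have hset : {l : Fin (n + 1) | (SimpleGraph.cycleGraph (n + 1)).Adj i l ∧
      ∃ e ∈ C.edges, i ∈ e.1 ∧ l ∈ e.2} =
      (((cut C).filter fun s => tail s (ori C s) = i).image fun s => tail s !ori C s :
        Finset (Fin (n + 1))) := by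
    ext l
    simp only [Set.mem_ofPred_eq, Finset.coe_image, Finset.coe_filter, Set.mem_image]
    constructor
    · rintro ⟨hadj, e, he, hi, hl⟩
      have he1 : e = (block (cut C) i, block (cut C) l) := by
        have := he
        obtain ⟨t, _, rfl⟩ := exists_eg_of_mem_edges hn he
        simp only [eg] at hi hl ⊢
        rw [block_eq_iff.2 (mem_block.1 hi), block_eq_iff.2 (mem_block.1 hl)]
      have hne := (C.edges_joined e he).2.2.1
      rw [he1] at hne he
      simp only [ne_eq, block_eq_iff] at hne
      rcases (adj_iff hn).1 hadj with ⟨s, x, rfl, rfl⟩ | ⟨rfl, rfl⟩ | ⟨rfl, rfl⟩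
      · have hs : s ∈ cut C := by
          by_contra hs
          apply hne
          cases x <;> simp [lab_succ_eq_castSucc hs]
        have hx := (eg_mem_edges_iff hn hs x).1 he
        exact ⟨s, ⟨hs, by rw [hx]⟩, by rw [hx]⟩
      · simp at hne
      · simp at hne
    · rintro ⟨s, ⟨hs, rfl⟩, rfl⟩
      exact ⟨adj_tail hn s _, _, (eg_mem_edges_iff hn hs _).2 rfl, self_mem_block _ _,
        self_mem_block _ _⟩
  -- The divisor counts heads of edges at `i`; a cut edge is determined by its tail and head.
  rw [AcyclicPartition.divisor, hset, Set.ncard_coe_finset, Finset.card_image_of_injOn]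
  intro s hs t ht h
  simp only [Finset.coe_filter, Set.mem_ofPred_eq] at hs ht h
  have h1 := hs.2.trans ht.2.symm
  rw [Fin.ext_iff] at h h1 ⊢
  cases hxs : ori C s <;> cases hxt : ori C t <;> rw [hxs, hxt] at h h1 <;>
    simp at h h1 <;> omega

variable (K : Type*) [Field K]

/-- All other cut edges keep their directions, so the divisor loses exactly one unit, at the tail of
`s`. The result does not depend on the chosen representative. -/
lemma monomial_eq (hn : 2 ≤ n) (hs : s ∈ clsCut c) (h : c.Contractible (eg (clsCut c) s x)) :
    ChipClass.monomial K h = MvPolynomial.X (tail s x) := by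
  obtain ⟨C, C', hCC, h1, h2, h4, h3⟩ := contract_spec hn hs h
  have hs' : s ∈ cut C := by rwa [← clsCut_cls, h1]
  obtain ⟨hcut, hori⟩ := (contractsTo_iff hn hs').1 h3
  have hdiv : ∀ i, C.divisor i - C'.divisor i = if tail s x = i then 1 else 0 := by
    intro i
    rw [divisor_eq hn, divisor_eq hn, hcut, Finset.filter_congr
      (q := fun t => tail t (ori C t) = i) (s := (cut C).erase s) fun t ht => by rw [hori t ht],
      Finset.filter_erase]
    split_ifs with hi
    · have hm : s ∈ (cut C).filter fun t => tail t (ori C t) = i :=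
        Finset.mem_filter.2 ⟨hs', by rw [h4, hi]⟩
      have := Finset.card_erase_add_one hm
      omega
    · rw [Finset.erase_eq_of_notMem (by simp [h4, hi]), Nat.sub_self]
  rw [ChipClass.monomial, hCC]
  simp only [hdiv]
  rw [Finset.prod_eq_single (tail s x)]
  · simp
  · intro i _ hi
    rw [if_neg hi.symm, pow_zero]
  · simp

/-- The divisor drops to 0, so both parallel cut edges contribute their tails. As the edges point in
opposite directions around the cycle, this is one product of a minor of T. -/
lemma monomial_two (hn : 2 ≤ n) {c : ChipClass (partition n) (1 + 1)} {s t : Fin n} {x : Bool}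
    (hs : s ∈ clsCut c) (ht : t ∈ clsCut c) (hst : s ≠ t)
    (h : c.Contractible (eg (clsCut c) s x)) :
    ChipClass.monomial K h = MvPolynomial.X (tail s x) * MvPolynomial.X (tail t !x) := by
  obtain ⟨h1, h2⟩ := h.choose_spec
  have hcut : clsCut c = cut h.choose.1 := by rw [← clsCut_cls, h1]
  have hmem := h2.1
  have hcard : (cut h.choose.1).card = 2 := card_cut hn (by omega)
  rw [hcut] at hs ht
  have hos : ori h.choose.1 s = x := (eg_mem_edges_iff hn hs x).1 (by rwa [← hcut])
  have hot : ori h.choose.1 t = !x := by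
    refine (eg_mem_edges_iff hn ht _).1 ?_
    rw [eg_eq_of_card_two hcard hs ht hst]
    rwa [← hcut]
  have hS : cut h.choose.1 = {s, t} := by
    refine (Finset.eq_of_subset_of_card_le ?_ ?_).symm
    · intro r hr
      rw [Finset.mem_insert, Finset.mem_singleton] at hr
      rcases hr with rfl | rfl <;> assumption
    · rw [hcard, Finset.card_pair hst]
  have h0 : ∀ i, h.choose.2.divisor i = 0 := by
    intro i
    rw [eq_onePart h.choose.2]
    simp [AcyclicPartition.divisor, onePart]
  have hdiv : ∀ i, h.choose.1.divisor i - h.choose.2.divisor i =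
      (if tail s x = i then 1 else 0) + if tail t (!x) = i then 1 else 0 := by
    intro i
    rw [h0, Nat.sub_zero, divisor_eq hn, Finset.card_filter, hS, Finset.sum_pair hst, hos, hot]
  rw [ChipClass.monomial]
  simp only [hdiv, pow_add]
  rw [Finset.prod_mul_distrib]
  congr 1
  · rw [Finset.prod_eq_single (tail s x)]
    · simp
    · intro i _ hi
      rw [if_neg hi.symm, pow_zero]
    · simp
  · rw [Finset.prod_eq_single (tail t !x)]
    · simp
    · intro i _ hi
      rw [if_neg hi.symm, pow_zero]
    · simp

end Contraction

/-! ### Strict sign functions and changes of signs -/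

section Signs

variable {n : ℕ}

/-- The sign of the edge `s` with the orientation `x`: alternating along the cut edges, and
reversed with the orientation. -/
def edgeSign (S : Finset (Fin n)) (s : Fin n) (x : Bool) : ℤˣ :=
  (-1) ^ cnt S s.castSucc * if x then 1 else -1

lemma edgeSign_not (S : Finset (Fin n)) (s : Fin n) (x : Bool) :
    edgeSign S s (!x) = -edgeSign S s x := by
  cases x <;> simp [edgeSign]

open Classical in
/-- The sign of a directed edge of the partition graph. -/
def sgn (S : Finset (Fin n)) (f : Finset (Fin (n + 1)) × Finset (Fin (n + 1))) : ℤˣ :=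
  if h : ∃ p : Fin n × Bool, p.1 ∈ S ∧ f = eg S p.1 p.2 then
    edgeSign S h.choose.1 h.choose.2 else 1

/-- The choice in `sgn` is ambiguous only for two parallel cut edges. There both the position and
the direction change, and the two minus signs cancel. -/
lemma sgn_eg {S : Finset (Fin n)} (hS : 2 ≤ S.card) {s : Fin n} (hs : s ∈ S) (x : Bool) :
    sgn S (eg S s x) = edgeSign S s x := by
  have h : ∃ p : Fin n × Bool, p.1 ∈ S ∧ eg S s x = eg S p.1 p.2 := ⟨(s, x), hs, rfl⟩
  rw [sgn, dif_pos h]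
  obtain ⟨h1, h2⟩ := h.choose_spec
  generalize h.choose = p at h1 h2
  obtain ⟨t, y⟩ := p
  rcases eg_eq_cases hS hs h1 h2 with ⟨rfl, rfl⟩ | ⟨hc, hst, hy⟩
  · rfl
  · dsimp only at hy hst h1 ⊢
    subst hy
    have hs' := cnt_castSucc_lt hs
    have ht' := cnt_castSucc_lt h1
    have hne : cnt S s.castSucc ≠ cnt S t.castSucc := fun h => hst (cnt_injOn hs h1 h)
    rw [edgeSign_not, edgeSign, edgeSign]
    rcases (show cnt S s.castSucc = 0 ∧ cnt S t.castSucc = 1 ∨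
      cnt S s.castSucc = 1 ∧ cnt S t.castSucc = 0 by omega) with ⟨h3, h4⟩ | ⟨h3, h4⟩ <;>
      cases x <;> simp [h3, h4]

/-- Deleting the smaller cut edge shifts the position of the larger one by one, while deleting the
larger does not affect the smaller. -/
lemma edgeSign_anticomm {S : Finset (Fin n)} {s t : Fin n} (hs : s ∈ S) (ht : t ∈ S)
    (hst : s ≠ t) (x y : Bool) :
    edgeSign S s x * edgeSign (S.erase s) t y = -(edgeSign S t y * edgeSign (S.erase t) s x) := by
  have key : ∀ (s t : Fin n) (x y : Bool), s ∈ S → t ∈ S → s < t →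
      edgeSign S s x * edgeSign (S.erase s) t y =
        -(edgeSign S t y * edgeSign (S.erase t) s x) := by
    intro s t x y hs ht hlt
    have h1 := cnt_erase hs t.castSucc
    have h2 := cnt_erase ht s.castSucc
    rw [if_pos (by simpa using hlt)] at h1
    rw [if_neg (by simpa using hlt.le), add_zero] at h2
    rw [edgeSign, edgeSign, edgeSign, edgeSign, ← h1, h2, pow_succ]
    simp [mul_comm]
  rcases hst.lt_or_gt with h | h
  · exact key s t x y hs ht h
  · rw [key t s y x ht hs h, neg_neg]

lemma sgn_anticomm {S : Finset (Fin n)} (hS : 3 ≤ S.card) {s t : Fin n} (hs : s ∈ S) (ht : t ∈ S)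
    (hst : s ≠ t) (x y : Bool) :
    sgn S (eg S s x) * sgn (S.erase s) (eg (S.erase s) t y) =
      -(sgn S (eg S t y) * sgn (S.erase t) (eg (S.erase t) s x)) := by
  have h1 := Finset.card_erase_add_one hs
  have h2 := Finset.card_erase_add_one ht
  rw [sgn_eg (by omega) hs, sgn_eg (by omega) ht,
    sgn_eg (by omega) (Finset.mem_erase.2 ⟨hst.symm, ht⟩),
    sgn_eg (by omega) (Finset.mem_erase.2 ⟨hst, hs⟩), edgeSign_anticomm hs ht hst]

lemma mergeEdge_self {f : Finset (Fin (n + 1)) × Finset (Fin (n + 1))} :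
    (mergeEdge f f).1 = (mergeEdge f f).2 ∧
      (mergeEdge f (f.2, f.1)).1 = (mergeEdge f (f.2, f.1)).2 := by
  simp [mergeEdge, merge]

/-- The data of two edges that can be contracted one after the other. -/
lemma exists_of_contractible_mergeEdge (hn : 2 ≤ n) {q : ℕ}
    {c : ChipClass (partition n) (q + 2 + 1)}
    {f g : Finset (Fin (n + 1)) × Finset (Fin (n + 1))} (hf : c.Contractible f)
    (hg : c.Contractible g) (h : (ChipClass.contract hf).Contractible (mergeEdge f g)) :
    ∃ s ∈ clsCut c, ∃ t ∈ clsCut c, s ≠ t ∧ ∃ x y, f = eg (clsCut c) s x ∧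
      g = eg (clsCut c) t y := by
  obtain ⟨s, hs, x, hfe⟩ := exists_eg_of_contractible hn hf
  obtain ⟨t, ht, y, hge⟩ := exists_eg_of_contractible hn hg
  refine ⟨s, hs, t, ht, ?_, x, y, hfe, hge⟩
  rintro rfl
  refine not_contractible_of_eq ?_ h
  by_cases hxy : y = x
  · rw [hge, hxy, ← hfe]
    exact mergeEdge_self.1
  · rw [hge, show y = !x by cases x <;> cases y <;> simp_all, eg_swap, ← hfe]
    exact mergeEdge_self.2

section Comm

variable {q : ℕ} {c : ChipClass (partition n) (q + 2 + 1)}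
  {f g : Finset (Fin (n + 1)) × Finset (Fin (n + 1))} {s t : Fin n} {x y : Bool}

lemma mergeEdge_eq (hn : 2 ≤ n) (hs : s ∈ clsCut c) (hfe : f = eg (clsCut c) s x)
    (hge : g = eg (clsCut c) t y) (hf : c.Contractible f) :
    mergeEdge f g = eg (clsCut (ChipClass.contract hf)) t y := by
  rw [clsCut_contract hn hs hfe hf, hfe, hge, mergeEdge_eg hs]

/-- Both orders remove the same two cut edges and lower the same direction counts, and these
invariants determine the class. If one part remains, there is only one class. -/
lemma contract_comm (hn : 2 ≤ n) (hs : s ∈ clsCut c) (ht : t ∈ clsCut c) (hst : s ≠ t)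
    (hfe : f = eg (clsCut c) s x) (hge : g = eg (clsCut c) t y) (hf : c.Contractible f)
    (hg : c.Contractible g) (h₁ : (ChipClass.contract hf).Contractible (mergeEdge f g))
    (h₂ : (ChipClass.contract hg).Contractible (mergeEdge g f)) :
    ChipClass.contract h₁ = ChipClass.contract h₂ := by
  cases q with
  | zero => exact Subsingleton.elim (α := ChipClass (partition n) 1) _ _
  | succ q =>
    have hcf := clsCut_contract hn hs hfe hf
    have hcg := clsCut_contract hn ht hge hg
    have ht' : t ∈ clsCut (ChipClass.contract hf) := by
      rw [hcf]
      exact Finset.mem_erase.2 ⟨hst.symm, ht⟩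
    have hs' : s ∈ clsCut (ChipClass.contract hg) := by
      rw [hcg]
      exact Finset.mem_erase.2 ⟨hst, hs⟩
    have e₁ := mergeEdge_eq hn hs hfe hge hf
    have e₂ := mergeEdge_eq hn ht hge hfe hg
    refine chipClass_ext hn (by omega) ?_ true ?_
    · rw [clsCut_contract hn ht' e₁ h₁, clsCut_contract hn hs' e₂ h₂, hcf, hcg,
        Finset.erase_right_comm]
    · have a1 := clsNum_contract hn ht' e₁ h₁ true
      have a2 := clsNum_contract hn hs' e₂ h₂ true
      have a3 := clsNum_contract hn hs hfe hf true
      have a4 := clsNum_contract hn ht hge hg true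
      omega

lemma sgn_anticomm_cls (hn : 2 ≤ n) (hs : s ∈ clsCut c) (ht : t ∈ clsCut c) (hst : s ≠ t)
    (hfe : f = eg (clsCut c) s x) (hge : g = eg (clsCut c) t y) (hf : c.Contractible f)
    (hg : c.Contractible g) :
    sgn (clsCut c) f * sgn (clsCut (ChipClass.contract hf)) (mergeEdge f g) =
      -(sgn (clsCut c) g * sgn (clsCut (ChipClass.contract hg)) (mergeEdge g f)) := by
  rw [clsCut_contract hn hs hfe hf, clsCut_contract hn ht hge hg, hfe, hge, mergeEdge_eg hs,
    mergeEdge_eg ht]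
  exact sgn_anticomm (by rw [card_clsCut hn (by omega) c]; omega) hs ht hst x y

end Comm

/-- A family of signs on the classes of acyclic `(j + 1)`-partitions. -/
abbrev ClassSigns (n : ℕ) : Type := (j : ℕ) → ChipClass (partition n) (j + 1) → ℤˣ

open Classical in
/-- The strict sign functions, twisted by a change of signs of the basis elements `e_c`. -/
def twist (η : ClassSigns n) : SignFamily (partition n)
  | 0, _, _ => 1
  | 1, _, _ => 1
  | j + 2, c, f => sgn (clsCut c) f * (η (j + 1) c *
      if h : ChipClass.Contractible (j := j + 1) c f then η j (ChipClass.contract h) else 1)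

/-- The sign functions `σ` are the strict ones after the change of signs `η`. -/
def Compatible (σ : SignFamily (partition n)) (η : ClassSigns n) : Prop :=
  (∀ c, η 0 c = 1) ∧ ∀ (j : ℕ) (c : ChipClass (partition n) (j + 2))
    (f : Finset (Fin (n + 1)) × Finset (Fin (n + 1))) (h : c.Contractible f),
    σ (j + 2) c f = sgn (clsCut c) f * (η (j + 1) c * η j (ChipClass.contract h))

lemma twist_apply (η : ClassSigns n) {j : ℕ} {c : ChipClass (partition n) (j + 2)}
    {f : Finset (Fin (n + 1)) × Finset (Fin (n + 1))} (h : c.Contractible f) :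
    twist η (j + 2) c f = sgn (clsCut c) f * (η (j + 1) c * η j (ChipClass.contract h)) := by
  rw [twist, dif_pos h]

lemma twist_compatible {η : ClassSigns n} (h : ∀ c, η 0 c = 1) : Compatible (twist η) η :=
  ⟨h, fun _ _ _ h => twist_apply η h⟩

/-- Along either order the sign of the intermediate class occurs twice and cancels; the signs of the
two end classes are common by `contract_comm`. -/
lemma twist_anticommutes (hn : 2 ≤ n) (η : ClassSigns n) : (twist η).Anticommutes := by
  intro j c f g hf hg hfg h₁ h₂
  cases j with
  | zero => exact absurd h₁ (not_contractible_one _ _)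
  | succ q =>
    obtain ⟨s, hs, t, ht, hst, x, y, hfe, hge⟩ := exists_of_contractible_mergeEdge hn hf hg h₁
    rw [twist_apply η hf, twist_apply η hg, twist_apply η h₁, twist_apply η h₂,
      contract_comm hn hs ht hst hfe hge hf hg h₁ h₂]
    have key : ∀ a b c d e : ℤˣ, a * (d * b) * (c * (b * e)) = a * c * (d * e) := by
      intro a b c d e
      calc a * (d * b) * (c * (b * e)) = a * c * (d * e) * (b * b) := by
            simp only [mul_comm, mul_left_comm]
        _ = _ := by rw [Int.units_mul_self, mul_one]
    rw [key, key, sgn_anticomm_cls hn hs ht hst hfe hge hf hg, neg_mul]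

/-- An arbitrary `η` is harmless for two parts because both contractions end in the unique class of
`1`-partitions. With more parts c/(U, W) and c/(W, U) differ, which is why the strict rule is proved
only for constant `η`. -/
lemma twist_isWeakSign (hn : 2 ≤ n) (η : ClassSigns n) : (twist η).IsWeakSign := by
  refine ⟨twist_anticommutes hn η, fun c U W h₁ h₂ => ?_⟩
  obtain ⟨s, hs, x, h⟩ := exists_eg_of_contractible hn h₁
  rw [twist_apply η h₁, twist_apply η h₂,
    Subsingleton.elim (α := ChipClass (partition n) 1) (ChipClass.contract h₁)
      (ChipClass.contract h₂), ← neg_mul]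
  congr 1
  have h' : (W, U) = eg (clsCut c) s !x := by rw [eg_swap, ← h]
  rw [h, h', sgn_eg (card_clsCut hn le_rfl c).ge hs, sgn_eg (card_clsCut hn le_rfl c).ge hs,
    edgeSign_not, neg_neg]

lemma twist_one_isSign (hn : 2 ≤ n) : (twist (n := n) fun _ _ => 1).IsSign := by
  refine ⟨twist_anticommutes hn _, fun j c U W h₁ h₂ => ?_⟩
  cases j with
  | zero => exact absurd h₁ (not_contractible_one _ _)
  | succ j =>
    obtain ⟨s, hs, x, h⟩ := exists_eg_of_contractible hn h₁
    rw [twist_apply _ h₁, twist_apply _ h₂, mul_one, mul_one, mul_one]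
    have h' : (W, U) = eg (clsCut c) s !x := by rw [eg_swap, ← h]
    have hcard : 2 ≤ (clsCut c).card := by
      rw [card_clsCut hn (by omega) c]
      omega
    rw [h, h', sgn_eg hcard hs, sgn_eg hcard hs, edgeSign_not, neg_neg]

/-! ### All sign functions are strict ones after a change of signs -/

lemma exists_mem_ne_ne {S : Finset (Fin n)} (hS : 3 ≤ S.card) (s t : Fin n) :
    ∃ u ∈ S, u ≠ s ∧ u ≠ t := by
  obtain ⟨u, hu⟩ : ((S.erase s).erase t).Nonempty := by
    rw [← Finset.card_pos]
    have := Finset.pred_card_le_card_erase (s := S) (a := s)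
    have := Finset.pred_card_le_card_erase (s := S.erase s) (a := t)
    omega
  simp only [Finset.mem_erase] at hu
  exact ⟨u, hu.2.2, hu.2.1, hu.1⟩

/-- The contractible edges of a class are connected by pairs of edges that can be contracted
one after the other. -/
lemma eq_of_pairwise_eq {α : Type*} {q : ℕ} {S : Finset (Fin n)} (hS : S.card = q + 3)
    {N : Bool → ℕ} (hN : N true + N false = q + 3) (hpos : ∀ x, 0 < N x) (G : Fin n → Bool → α)
    (h : ∀ s ∈ S, ∀ t ∈ S, s ≠ t → ∀ x y, 2 ≤ N x → 2 ≤ N y →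
      (q = 0 ∨ ∀ z, 1 + (if x = z then 1 else 0) + (if y = z then 1 else 0) ≤ N z) →
      G s x = G t y)
    {s t : Fin n} (hs : s ∈ S) (ht : t ∈ S) {x y : Bool} (hx : 2 ≤ N x) (hy : 2 ≤ N y) :
    G s x = G t y := by
  have hS3 : 3 ≤ S.card := by omega
  have hne : ∀ s ∈ S, ∀ t ∈ S, s ≠ t → ∀ x, 2 ≤ N x → 2 ≤ N (!x) → G s x = G t !x := by
    intro s hs t ht hst x hx hx'
    refine h s hs t ht hst x (!x) hx hx' (Or.inr fun z => ?_)
    have := hpos z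
    cases x <;> cases z <;> simp at * <;> omega
  have hsum : N x + N (!x) = q + 3 := by
    cases x
    · rw [Bool.not_false, add_comm, hN]
    · exact hN
  by_cases hxy : y = x
  · subst hxy
    by_cases hst : s = t
    · rw [hst]
    · by_cases h3 : q = 0 ∨ 3 ≤ N y
      · refine h s hs t ht hst y y hx hy (h3.imp_right fun h3 z => ?_)
        have := hpos z
        by_cases hyz : y = z
        · subst hyz
          simpa using h3
        · simpa [hyz] using Nat.succ_le_of_lt this
      -- Only two edges have direction `y`, and contracting both would exhaust it. The opposite
      -- direction then occurs at least twice, and the link passes through a third cut edge taken in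
      -- that direction.
      · obtain ⟨u, hu, hus, hut⟩ := exists_mem_ne_ne hS3 s t
        rw [hne s hs u hu hus.symm y hx (by omega), ← hne t ht u hu hut.symm y hx (by omega)]
  · obtain rfl : y = !x := by cases x <;> cases y <;> simp_all
    by_cases hst : s = t
    · subst hst
      -- The two directions of one cut edge are linked in three steps, alternating directions over
      -- `s`, `u`, `r`, `s`.
      obtain ⟨u, hu, hus, _⟩ := exists_mem_ne_ne hS3 s s
      obtain ⟨r, hr, hrs, hru⟩ := exists_mem_ne_ne hS3 s u
      rw [hne s hs u hu hus.symm x hx hy, ← hne r hr u hu hru x hx hy,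
        hne r hr s hs hrs x hx hy]
    · exact hne s hs t ht hst x hx hy

open Classical in
/-- The change of signs that turns `σ` into the strict sign functions, computed along a chain of
contractions. -/
def gauge (σ : SignFamily (partition n)) : ClassSigns n
  | 0, _ => 1
  | j + 1, c =>
    if h : ∃ f, ChipClass.Contractible (j := j + 1) c f then
      σ (j + 2) c h.choose * sgn (clsCut c) h.choose * gauge σ j (ChipClass.contract h.choose_spec)
    else 1

/-- The numerical condition says that both directions survive both contractions. It is not needed
for `q = 0`, where the second contraction reaches a single part. -/
lemma contract_contractible (hn : 2 ≤ n) {q : ℕ} {c : ChipClass (partition n) (q + 2 + 1)}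
    {f g : Finset (Fin (n + 1)) × Finset (Fin (n + 1))} {s t : Fin n} {x y : Bool}
    (hs : s ∈ clsCut c) (ht : t ∈ clsCut c) (hst : s ≠ t) (hfe : f = eg (clsCut c) s x)
    (hge : g = eg (clsCut c) t y) (hf : c.Contractible f)
    (h : q = 0 ∨ ∀ z, 1 + (if x = z then 1 else 0) + (if y = z then 1 else 0) ≤ clsNum hn c z) :
    (ChipClass.contract hf).Contractible (mergeEdge f g) := by
  rw [mergeEdge_eq hn hs hfe hge hf]
  have ht' : t ∈ clsCut (ChipClass.contract hf) := by
    rw [clsCut_contract hn hs hfe hf]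
    exact Finset.mem_erase.2 ⟨hst.symm, ht⟩
  cases q with
  | zero => exact contractible_two hn ht' y
  | succ q =>
    refine (contractible_iff hn ht' y).2 ?_
    have h1 := (h.resolve_left (by omega)) y
    have h2 := clsNum_contract hn hs hfe hf y
    rw [if_pos rfl] at h1
    omega

lemma exists_gauge_succ_eq (σ : SignFamily (partition n)) {j : ℕ}
    {c : ChipClass (partition n) (j + 2)} (hex : ∃ f, ChipClass.Contractible (j := j + 1) c f) :
    ∃ (f : _) (h : ChipClass.Contractible (j := j + 1) c f), gauge σ (j + 1) c =
      σ (j + 2) c f * sgn (clsCut c) f * gauge σ j (ChipClass.contract h) :=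
  ⟨_, hex.choose_spec, by rw [gauge, dif_pos hex]⟩

/-- The recursion in `gauge` does not depend on the chosen edge. For two edges contractible in
either order, the recursion values reach the same twofold contraction, and `σ` and `sgn` change by
the same minus sign; connectivity of the edges gives the rest. -/
lemma gauge_eq (hn : 2 ≤ n) {σ : SignFamily (partition n)} (hσ : σ.IsWeakSign) (j : ℕ) :
    ∀ (c : ChipClass (partition n) (j + 2)) (f : Finset (Fin (n + 1)) × Finset (Fin (n + 1)))
      (h : c.Contractible f),
      gauge σ (j + 1) c = σ (j + 2) c f * sgn (clsCut c) f * gauge σ j (ChipClass.contract h) := by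
  induction j with
  | zero =>
    intro c f hf
    obtain ⟨g, hg, hgauge⟩ := exists_gauge_succ_eq σ ⟨f, hf⟩
    rw [hgauge, gauge, gauge, mul_one, mul_one]
    obtain ⟨s, hs, x, hfe⟩ := exists_eg_of_contractible hn hf
    obtain ⟨t, ht, y, hge⟩ := exists_eg_of_contractible hn hg
    have hcard := card_clsCut hn le_rfl c
    -- With two arcs every edge can be written over `s`, so only the reversed edge must be compared;
    -- there the second sign rule applies to both families.
    obtain ⟨z, rfl⟩ : ∃ z, g = eg (clsCut c) s z := by
      by_cases hst : s = t
      · exact ⟨y, by rw [hst, hge]⟩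
      · exact ⟨!y, by rw [← eg_eq_of_card_two hcard hs ht hst, Bool.not_not, hge]⟩
    by_cases hzx : z = x
    · rw [hzx, hfe]
    · obtain rfl : z = !x := by cases x <;> cases z <;> simp_all
      subst hfe
      have hrev : ∀ f g : Finset (Fin (n + 1)) × Finset (Fin (n + 1)), g = (f.2, f.1) →
          c.Contractible f → c.Contractible g → σ 2 c f = -σ 2 c g := by
        rintro ⟨U, W⟩ _ rfl h₁ h₂
        exact hσ.2 c U W h₁ h₂
      rw [hrev _ _ (eg_swap _ s x) hf hg, sgn_eg hcard.ge hs, sgn_eg hcard.ge hs,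
        edgeSign_not, mul_neg, neg_mul]
  | succ q ih =>
    intro c f hf
    obtain ⟨g, hg, hgauge⟩ := exists_gauge_succ_eq σ ⟨f, hf⟩
    rw [hgauge]
    obtain ⟨s, hs, x, hfe⟩ := exists_eg_of_contractible hn hf
    obtain ⟨t, ht, y, hge⟩ := exists_eg_of_contractible hn hg
    classical
    -- The value of the recursion if it starts with this edge; the default 1 is never used, as only
    -- contractible edges are compared.
    set G : Fin n → Bool → ℤˣ := fun s x =>
      if h : ChipClass.Contractible (j := q + 2) c (eg (clsCut c) s x) then
        σ (q + 3) c (eg (clsCut c) s x) * sgn (clsCut c) (eg (clsCut c) s x) *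
          gauge σ (q + 1) (ChipClass.contract h)
      else 1 with hG
    suffices H : G s x = G t y by
      subst hfe hge
      simp only [hG] at H
      rw [dif_pos hf, dif_pos hg] at H
      exact H.symm
    have hcard : (clsCut c).card = q + 3 := card_clsCut hn (by omega) c
    refine eq_of_pairwise_eq hcard (clsNum_add hn (by omega) c) (clsNum_pos hn (by omega) c) G ?_
      hs ht ((contractible_iff hn hs x).1 (hfe ▸ hf)) ((contractible_iff hn ht y).1 (hge ▸ hg))
    clear! f g s t x y
    intro s hs t ht hst x y hx hy h
    have hf := (contractible_iff hn hs x).2 hx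
    have hg := (contractible_iff hn ht y).2 hy
    have h₁ := contract_contractible hn hs ht hst rfl rfl hf h
    have h₂ := contract_contractible (x := y) (y := x) hn ht hs hst.symm rfl rfl hg
      (h.imp_right fun h z => by have := h z; omega)
    simp only [hG]
    rw [dif_pos hf, dif_pos hg, ih _ _ h₁, ih _ _ h₂,
      contract_comm hn hs ht hst rfl rfl hf hg h₁ h₂]
    have e₁ := hσ.1 (q + 1) c _ _ hf hg
      (fun h => hst (eg_inj (by omega) hs ht h).1) h₁ h₂
    have e₂ := sgn_anticomm_cls hn hs ht hst rfl rfl hf hg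
    have key : ∀ a b a' b' d e d' e' E : ℤˣ, a * a' = -(d * d') → b * b' = -(e * e') →
        a * b * (a' * b' * E) = d * e * (d' * e' * E) := by
      intro a b a' b' d e d' e' E h1 h2
      rw [← mul_assoc, mul_mul_mul_comm, h1, h2, neg_mul_neg, mul_mul_mul_comm, mul_assoc]
    exact key _ _ _ _ _ _ _ _ _ e₁ e₂

/-- Signs are their own inverses, so the recursion for `gauge` can be solved for `σ`. -/
lemma gauge_compatible (hn : 2 ≤ n) {σ : SignFamily (partition n)} (hσ : σ.IsWeakSign) :
    Compatible σ (gauge σ) := by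
  refine ⟨fun c => by rw [gauge], fun j c f h => ?_⟩
  rw [gauge_eq hn hσ j c f h]
  have key : ∀ a b d : ℤˣ, a = b * (a * b * d * d) := by
    intro a b d
    calc a = a * (b * b) * (d * d) := by
          rw [Int.units_mul_self, Int.units_mul_self, mul_one, mul_one]
      _ = _ := by simp only [mul_comm, mul_left_comm]
  exact key _ _ _

end Signs

/-! ### The Eagon–Northcott complex -/

section EagonNorthcott

/-- Contraction of a product of vectors with a linear form in the exterior algebra. -/
lemma contractLeft_ιMulti {A M : Type*} [CommRing A] [AddCommGroup M] [Module A M]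
    (d : Module.Dual A M) (k : ℕ) (v : Fin (k + 1) → M) :
    CliffordAlgebra.contractLeft d (ExteriorAlgebra.ιMulti A (k + 1) v) =
      ∑ p : Fin (k + 1), ((-1 : A) ^ (p : ℕ) * d (v p)) •
        ExteriorAlgebra.ιMulti A k fun a => v (p.succAbove a) := by
  induction k with
  | zero =>
    rw [ExteriorAlgebra.ιMulti_succ_apply, CliffordAlgebra.contractLeft_ι_mul]
    simp
  | succ k ih =>
    rw [ExteriorAlgebra.ιMulti_succ_apply, CliffordAlgebra.contractLeft_ι_mul, ih,
      Fin.sum_univ_succ (n := k + 1), sub_eq_add_neg, Finset.mul_sum, ← Finset.sum_neg_distrib]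
    congr 1
    · simp [Matrix.vecTail, Function.comp_def]
    · refine Finset.sum_congr rfl fun p _ => ?_
      rw [ExteriorAlgebra.ιMulti_succ_apply, mul_smul_comm, ← neg_smul]
      congr 1
      · simp only [Matrix.vecTail, Function.comp_apply, Fin.val_succ, pow_succ]
        ring
      · simp [Matrix.vecTail, Function.comp_def]

variable (K : Type*) [Field K] (n : ℕ)

/-- The linear form on `G` given by a row of the matrix `T`. -/
def rowForm (s : Fin 2) : Module.Dual (R K n) (Fin n → R K n) :=
  (y K n).constr (R K n) (T K n s)

lemma rowForm_y (s : Fin 2) (i : Fin n) : rowForm K n s (y K n i) = T K n s i :=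
  (y K n).constr_basis _ _ _

/-- Passing to the exterior algebra makes Δ a contraction with a linear form; contractions square to
zero and anticommute. -/
lemma coe_Delta (s : Fin 2) (k : ℕ) (w : ⋀[R K n]^(k + 1) (Fin n → R K n)) :
    (Delta K n s k w : ExteriorAlgebra (R K n) (Fin n → R K n)) =
      CliffordAlgebra.contractLeft (rowForm K n s)
        (w : ExteriorAlgebra (R K n) (Fin n → R K n)) := by
  have h : (⋀[R K n]^k (Fin n → R K n)).subtype ∘ₗ Delta K n s k =
      CliffordAlgebra.contractLeft (rowForm K n s) ∘ₗ
        (⋀[R K n]^(k + 1) (Fin n → R K n)).subtype := by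
    refine (wedgeBasis K n (k + 1)).ext fun i => ?_
    rw [LinearMap.comp_apply, LinearMap.comp_apply, Delta, Module.Basis.constr_basis,
      wedgeBasis_apply, Submodule.subtype_apply, Submodule.subtype_apply,
      exteriorPower.ιMulti_apply_coe, contractLeft_ιMulti]
    simp only [rowForm_y, AddSubmonoidClass.coe_finsetSum, Submodule.coe_smul,
      exteriorPower.ιMulti_apply_coe]
  exact LinearMap.congr_fun h w

lemma Delta_comp_self (s : Fin 2) (k : ℕ) : Delta K n s k ∘ₗ Delta K n s (k + 1) = 0 := by
  ext1
  apply AlternatingMap.ext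
  intro w
  apply Subtype.ext
  simp only [LinearMap.compAlternatingMap_apply, LinearMap.comp_apply, coe_Delta,
    CliffordAlgebra.contractLeft_contractLeft, LinearMap.zero_apply, Submodule.coe_zero]

lemma Delta_comp (s t : Fin 2) (k : ℕ) : Delta K n s k ∘ₗ Delta K n t (k + 1) =
    -(Delta K n t k ∘ₗ Delta K n s (k + 1)) := by
  ext1
  apply AlternatingMap.ext
  intro w
  apply Subtype.ext
  simp only [LinearMap.compAlternatingMap_apply, LinearMap.comp_apply, coe_Delta,
    LinearMap.neg_apply, Submodule.coe_neg]
  rw [CliffordAlgebra.contractLeft_comm]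

variable {n}

/-- An exponent of `z_1` (`true`) or `z_2` (`false`). -/
def expo {q : ℕ} (v : Expo q) (x : Bool) : ℕ := if x then v.1.1 else v.1.2

/-- The exponents after division by `z_1` (`true`) or `z_2` (`false`). -/
def lowerExpo {q : ℕ} (v : Expo (q + 1)) (x : Bool) (h : 0 < expo v x) : Expo q :=
  ⟨(v.1.1 - (if x then 1 else 0), v.1.2 - (if x then 0 else 1)), by
    have := v.2
    cases x <;> simp [expo] at h ⊢ <;> omega⟩

lemma lower₁_single {q : ℕ} (v : Expo (q + 1)) : lower₁ K n q (Finsupp.single v 1) =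
    if h : 0 < expo v true then Finsupp.single (lowerExpo v true h) 1 else 0 := by
  rw [lower₁, Finsupp.linearCombination_single, one_smul]
  rfl

lemma lower₂_single {q : ℕ} (v : Expo (q + 1)) : lower₂ K n q (Finsupp.single v 1) =
    if h : 0 < expo v false then Finsupp.single (lowerExpo v false h) 1 else 0 := by
  rw [lower₂, Finsupp.linearCombination_single, one_smul]
  rfl

lemma lower_comm (q : ℕ) :
    lower₁ K n q ∘ₗ lower₂ K n (q + 1) = lower₂ K n q ∘ₗ lower₁ K n (q + 1) := by
  refine Finsupp.basisSingleOne.ext fun v => ?_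
  rw [Finsupp.coe_basisSingleOne, LinearMap.comp_apply, LinearMap.comp_apply, lower₁_single,
    lower₂_single]
  obtain ⟨⟨a, b⟩, hv⟩ := v
  by_cases ha : 0 < a <;> by_cases hb : 0 < b <;>
    simp [expo, lowerExpo, ha, hb, lower₁_single, lower₂_single]

/-- Of the four composites two vanish, and the mixed ones cancel: the left factors anticommute while
the right factors commute. -/
lemma map_add_map_comp_eq_zero {A M₁ M₂ M₃ N₁ N₂ N₃ : Type*} [CommRing A]
    [AddCommGroup M₁] [Module A M₁] [AddCommGroup M₂] [Module A M₂] [AddCommGroup M₃] [Module A M₃]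
    [AddCommGroup N₁] [Module A N₁] [AddCommGroup N₂] [Module A N₂] [AddCommGroup N₃] [Module A N₃]
    {f f' : M₂ →ₗ[A] M₃} {g g' : M₁ →ₗ[A] M₂} {h h' : N₂ →ₗ[A] N₃} {k k' : N₁ →ₗ[A] N₂}
    (h₁ : f ∘ₗ g = 0) (h₂ : f' ∘ₗ g' = 0) (h₃ : f ∘ₗ g' = -(f' ∘ₗ g)) (h₄ : h ∘ₗ k' = h' ∘ₗ k) :
    (TensorProduct.map f h + TensorProduct.map f' h') ∘ₗ
      (TensorProduct.map g k + TensorProduct.map g' k') = 0 := by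
  rw [LinearMap.add_comp, LinearMap.comp_add, LinearMap.comp_add, ← TensorProduct.map_comp,
    ← TensorProduct.map_comp, ← TensorProduct.map_comp, ← TensorProduct.map_comp, h₁, h₂, h₄,
    TensorProduct.map_zero_left, TensorProduct.map_zero_left, zero_add, add_zero,
    ← TensorProduct.map_add_left, h₃, neg_add_cancel, TensorProduct.map_zero_left]

lemma enD_comp (q : ℕ) : enD K n q ∘ₗ enD K n (q + 1) = 0 :=
  map_add_map_comp_eq_zero (Delta_comp_self K n 0 _) (Delta_comp_self K n 1 _)
    (Delta_comp K n 0 1 _) (lower_comm K q)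

/-- Omission of the index at the position `p`. -/
def del {k : ℕ} (i : Fin (k + 1) ↪o Fin n) (p : Fin (k + 1)) : Fin k ↪o Fin n :=
  (Fin.succAboveOrderEmb p).trans i

@[simp] lemma del_apply {k : ℕ} (i : Fin (k + 1) ↪o Fin n) (p : Fin (k + 1)) (a : Fin k) :
    del i p a = i (p.succAbove a) := rfl

lemma Delta_wedgeBasis (s : Fin 2) (k : ℕ) (i : Fin (k + 1) ↪o Fin n) :
    Delta K n s k (wedgeBasis K n (k + 1) i) =
      ∑ p : Fin (k + 1), ((-1 : R K n) ^ (p : ℕ) * T K n s (i p)) •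
        wedgeBasis K n k (del i p) := by
  rw [Delta, Module.Basis.constr_basis]
  simp only [wedgeBasis_apply, del_apply]

lemma enBasis_apply (q : ℕ) (b : ENIndex n q) :
    enBasis K n q b = wedgeBasis K n (q + 2) b.1 ⊗ₜ Finsupp.single b.2 1 := by
  rw [enBasis, Module.Basis.tensorProduct_apply', Finsupp.coe_basisSingleOne]

lemma T_zero (i : Fin n) : T K n 0 i = MvPolynomial.X (tail i true) := rfl

lemma T_one (i : Fin n) : T K n 1 i = MvPolynomial.X (tail i false) := rfl

lemma enD_enBasis (q : ℕ) (b : ENIndex n (q + 1)) : enD K n q (enBasis K n (q + 1) b) =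
    ∑ p : Fin (q + 3), ∑ x : Bool, if h : 0 < expo b.2 x then
      ((-1 : R K n) ^ (p : ℕ) * MvPolynomial.X (tail (b.1 p) x)) •
        enBasis K n q (del b.1 p, lowerExpo b.2 x h) else 0 := by
  rw [enBasis_apply, enD, LinearMap.add_apply, TensorProduct.map_tmul, TensorProduct.map_tmul,
    Delta_wedgeBasis, Delta_wedgeBasis, TensorProduct.sum_tmul, TensorProduct.sum_tmul,
    ← Finset.sum_add_distrib, lower₁_single, lower₂_single]
  refine Finset.sum_congr rfl fun p _ => ?_
  rw [Fintype.sum_bool, T_zero, T_one]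
  congr 1
  · split_ifs with h
    · rw [enBasis_apply, TensorProduct.smul_tmul']
    · rw [TensorProduct.tmul_zero]
  · split_ifs with h
    · rw [enBasis_apply, TensorProduct.smul_tmul']
    · rw [TensorProduct.tmul_zero]

lemma enDZero_enBasis (b : ENIndex n 0) : enDZero K n (enBasis K n 0 b) =
    T K n 0 (b.1 0) * T K n 1 (b.1 1) - T K n 0 (b.1 1) * T K n 1 (b.1 0) := by
  rw [enDZero, Module.Basis.constr_basis]

/-- The image of a basis element is the expansion of a 3 × 3 determinant with a repeated row of T;
the exponent of z_1 or z_2 selects the row. -/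
lemma enDZero_comp : enDZero K n ∘ₗ enD K n 0 = 0 := by
  refine (enBasis K n 1).ext fun b => ?_
  obtain ⟨i, ⟨⟨v₁, v₂⟩, hv⟩⟩ := b
  rw [LinearMap.comp_apply, enD_enBasis, LinearMap.zero_apply, Fin.sum_univ_three,
    Fintype.sum_bool, Fintype.sum_bool, Fintype.sum_bool]
  have h12 : (v₁ = 1 ∧ v₂ = 0) ∨ (v₁ = 0 ∧ v₂ = 1) := by omega
  have e0 : (0 : Fin 3).succAbove (0 : Fin 2) = 1 := rfl
  have e1 : (0 : Fin 3).succAbove (1 : Fin 2) = 2 := rfl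
  have e2 : (1 : Fin 3).succAbove (0 : Fin 2) = 0 := rfl
  have e3 : (1 : Fin 3).succAbove (1 : Fin 2) = 2 := rfl
  have e4 : (2 : Fin 3).succAbove (0 : Fin 2) = 0 := rfl
  have e5 : (2 : Fin 3).succAbove (1 : Fin 2) = 1 := rfl
  rcases h12 with ⟨rfl, rfl⟩ | ⟨rfl, rfl⟩
  · have h1 : 0 < expo (q := 1) ⟨(1, 0), hv⟩ true := Nat.one_pos
    have h2 : ¬ 0 < expo (q := 1) ⟨(1, 0), hv⟩ false := lt_irrefl 0
    simp only [dif_pos h1, dif_neg h2, map_add, map_smul, map_zero, enDZero_enBasis, del_apply,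
      smul_eq_mul, T_zero, T_one, Nat.reduceAdd, e0, e1, e2, e3, e4, e5, tail_true, tail_false,
      Fin.val_zero, Fin.val_one, Fin.val_two]
    ring
  · have h1 : 0 < expo (q := 1) ⟨(0, 1), hv⟩ false := Nat.one_pos
    have h2 : ¬ 0 < expo (q := 1) ⟨(0, 1), hv⟩ true := lt_irrefl 0
    simp only [dif_pos h1, dif_neg h2, map_add, map_smul, map_zero, enDZero_enBasis, del_apply,
      smul_eq_mul, T_zero, T_one, Nat.reduceAdd, e0, e1, e2, e3, e4, e5, tail_true, tail_false,
      Fin.val_zero, Fin.val_one, Fin.val_two]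
    ring

lemma enIsComplex : ENIsComplex K n :=
  ⟨enDZero_comp K, enD_comp K⟩

lemma range_enDZero : LinearMap.range (enDZero K n) = idealP K n := by
  rw [LinearMap.range_eq_map, ← (enBasis K n 0).span_eq, Submodule.map_span, idealP, Ideal.span]
  congr 1
  ext g
  constructor
  · rintro ⟨_, ⟨b, rfl⟩, rfl⟩
    exact ⟨b.1 0, b.1 1, b.1.strictMono (by simp), enDZero_enBasis K b⟩
  · rintro ⟨a, b, hab, rfl⟩
    refine ⟨_, ⟨(OrderEmbedding.ofStrictMono ![a, b] ?_, ⟨(0, 0), rfl⟩), rfl⟩, ?_⟩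
    · rw [Fin.strictMono_iff_lt_succ]
      intro i
      fin_cases i
      exact hab
    · rw [enDZero_enBasis]
      rfl

end EagonNorthcott

/-! ### The classes attached to the Eagon–Northcott basis -/

section PsiPartition

variable {n k : ℕ}

/-- The set of the indices of a basis element. -/
def supp (i : Fin k ↪o Fin n) : Finset (Fin n) := Finset.univ.map i.toEmbedding

lemma mem_supp {i : Fin k ↪o Fin n} {s : Fin n} : s ∈ supp i ↔ ∃ p, i p = s := by
  simp [supp]

lemma apply_mem_supp (i : Fin k ↪o Fin n) (p : Fin k) : i p ∈ supp i := mem_supp.2 ⟨p, rfl⟩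

lemma card_supp (i : Fin k ↪o Fin n) : (supp i).card = k := by
  simp [supp]

lemma cnt_supp (i : Fin k ↪o Fin n) (p : Fin k) : cnt (supp i) (i p).castSucc = p := by
  rw [cnt, supp, Finset.filter_map, Finset.card_map]
  have : (Finset.univ.filter ((fun s : Fin n => (s : ℕ) < (i p).castSucc) ∘ i.toEmbedding)) =
      Finset.Iio p := by
    ext r
    simp
  rw [this, Fin.card_Iio]

lemma supp_injective {i i' : Fin k ↪o Fin n} (h : supp i = supp i') : i = i' := by
  apply RelEmbedding.ext
  intro p
  refine cnt_injOn (apply_mem_supp i p) (h ▸ apply_mem_supp i' p) ?_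
  rw [cnt_supp, h, cnt_supp]

lemma supp_del (i : Fin (k + 1) ↪o Fin n) (p : Fin (k + 1)) :
    supp (del i p) = (supp i).erase (i p) := by
  ext s
  rw [Finset.mem_erase, mem_supp, mem_supp]
  constructor
  · rintro ⟨a, rfl⟩
    exact ⟨fun h => Fin.succAbove_ne p a (i.injective h), _, rfl⟩
  · rintro ⟨hne, a, rfl⟩
    obtain ⟨b, rfl⟩ := Fin.exists_succAbove_eq (x := a) (y := p) fun h => hne (by rw [h])
    exact ⟨b, rfl⟩

lemma psiPart_eq_block (i : Fin (k + 1) ↪o Fin n) (l : Fin (k + 1)) :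
    psiPart n i l = block (supp i) (i l).succ := by
  ext w
  have hl := cnt_pos_iff (apply_mem_supp i l) w
  have hcard := card_supp i
  have hw := cnt_le (supp i) w
  have hl2 := l.2
  rw [cnt_supp] at hl
  rw [mem_block, lab_succ (apply_mem_supp i l), cnt_supp, hcard, psiPart, Finset.mem_filter, lab,
    hcard, hl]
  simp only [Finset.mem_univ, true_and]
  by_cases h : (l : ℕ) + 1 < k + 1
  · have hl' := cnt_pos_iff (apply_mem_supp i ⟨l + 1, h⟩) w
    rw [cnt_supp] at hl'
    rw [dif_pos h, ← not_lt, hl']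
    dsimp only
    rw [if_neg (show ¬(l : ℕ) + 1 = k + 1 by omega)]
    constructor
    · intro h'
      rw [if_neg (by omega)]
      omega
    · intro h'
      split_ifs at h'
      omega
  · have h0 := cnt_pos_iff (apply_mem_supp i 0) w
    rw [cnt_supp, Fin.val_zero] at h0
    rw [dif_neg h, ← not_lt, h0]
    split_ifs <;> omega

lemma image_psiPart (i : Fin (k + 1) ↪o Fin n) :
    Finset.univ.image (psiPart n i) = (cutPart (supp i)).parts := by
  have hcard := card_supp i
  ext W
  rw [mem_cutPart, Finset.mem_image]
  constructor
  · rintro ⟨l, _, rfl⟩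
    exact ⟨_, (psiPart_eq_block i l).symm⟩
  · rintro ⟨v, rfl⟩
    have hv := lab_lt ⟨_, apply_mem_supp i 0⟩ v
    rw [hcard] at hv
    -- The set number `l` starts just after the cut edge at position `l`, so it has label `l + 1`;
    -- the last set wraps around and has label 0.
    refine ⟨⟨if lab (supp i) v = 0 then k else lab (supp i) v - 1, by split_ifs <;> omega⟩,
      Finset.mem_univ _, ?_⟩
    rw [psiPart_eq_block, block_eq_iff, lab_succ (apply_mem_supp i _), cnt_supp, hcard]
    dsimp only
    split_ifs <;> omega

variable {q : ℕ}

lemma supp_card_eq (b : ENIndex n q) : (supp b.1).card = q + 2 := card_supp b.1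

/-- The orientation with the source at the position `v_2 + 1` and the sink at the position `0`. -/
def psiOri (b : ENIndex n q) (s : Fin n) : Bool :=
  decide (b.2.1.2 < cnt (supp b.1) s.castSucc)

/-- Directions start downward at the sink, block 0. A change from down to up between consecutive cut
edges makes a source, and a change from up to down makes a sink; so the only change is at block `m +
1`. -/
lemma ori_iff_sink_source {S : Finset (Fin n)} {o : Fin n → Bool} {m : ℕ} (hm : m + 1 < S.card) :
    ((∀ v, (∀ s ∈ S, lab S (tail s (o s)) ≠ lab S v) ↔ lab S v = 0) ∧
      ∀ v, (∀ s ∈ S, lab S (tail s !(o s)) ≠ lab S v) ↔ lab S v = m + 1) ↔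
    ∀ s ∈ S, o s = decide (m < cnt S s.castSucc) := by
  have hex : ∀ l, l < S.card → ∃ s ∈ S, cnt S s.castSucc = l := fun l => exists_cnt_eq
  constructor
  · rintro ⟨hsink, hsrc⟩
    have hF : ∀ l, l ≤ m → ∀ s ∈ S, cnt S s.castSucc = l → o s = false := by
      intro l
      induction l with
      | zero =>
        intro _ s hs h
        have := (hsink 0).2 (by simp) s hs
        by_contra ho
        rw [Bool.not_eq_false] at ho
        rw [ho, tail_true, lab_castSucc hs, h, lab_zero] at this
        exact this rfl
      | succ l ih =>
        intro hl s hs h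
        by_contra ho
        rw [Bool.not_eq_false] at ho
        have hlab : lab S s.castSucc = l + 1 := by rw [lab_castSucc hs, h]
        have := (hsrc s.castSucc).1 fun t ht heq => by
          rw [hlab] at heq
          cases hot : o t <;> rw [hot] at heq
          · rw [Bool.not_false, tail_true, lab_castSucc ht] at heq
            rw [cnt_injOn ht hs (heq.trans h.symm), ho] at hot
            exact Bool.noConfusion hot
          · rw [Bool.not_true, tail_false, lab_succ ht] at heq
            have : cnt S t.castSucc = l := by
              split_ifs at heq
              omega
            rw [ih (by omega) t ht this] at hot
            exact Bool.noConfusion hot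
        omega
    have hT : ∀ l, ∀ s ∈ S, cnt S s.castSucc = m + 1 + l → o s = true := by
      intro l
      induction l with
      | zero =>
        intro s hs h
        have hlab : lab S s.castSucc = m + 1 := by rw [lab_castSucc hs, h]
        have := (hsrc s.castSucc).2 hlab s hs
        by_contra ho
        rw [Bool.not_eq_true] at ho
        rw [ho] at this
        exact this rfl
      | succ l ih =>
        intro s hs h
        by_contra ho
        rw [Bool.not_eq_true] at ho
        have hlab : lab S s.castSucc = m + 1 + (l + 1) := by rw [lab_castSucc hs, h]
        have := (hsink s.castSucc).1 fun t ht heq => by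
          rw [hlab] at heq
          cases hot : o t <;> rw [hot] at heq
          · rw [tail_false, lab_succ ht] at heq
            have : cnt S t.castSucc = m + 1 + l := by
              split_ifs at heq
              omega
            rw [ih t ht this] at hot
            exact Bool.noConfusion hot
          · rw [tail_true, lab_castSucc ht] at heq
            rw [cnt_injOn ht hs (heq.trans h.symm), ho] at hot
            exact Bool.noConfusion hot
        omega
    intro s hs
    by_cases h : m < cnt S s.castSucc
    · rw [hT (cnt S s.castSucc - (m + 1)) s hs (by omega), eq_comm, decide_eq_true_iff]
      exact h
    · rw [hF _ (by omega) s hs rfl, eq_comm, decide_eq_false_iff_not]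
      exact h
  · intro ho
    have htail : ∀ s ∈ S, (cnt S s.castSucc ≤ m →
        o s = false ∧ lab S s.castSucc = cnt S s.castSucc ∧
        lab S s.succ = cnt S s.castSucc + 1) ∧ (m < cnt S s.castSucc → o s = true ∧
        lab S s.castSucc = cnt S s.castSucc ∧ lab S s.succ =
          if cnt S s.castSucc + 1 = S.card then 0 else cnt S s.castSucc + 1) := by
      intro s hs
      rw [ho s hs, lab_succ hs, lab_castSucc hs]
      refine ⟨fun h => ⟨by simpa using h, rfl, if_neg (by omega)⟩,
        fun h => ⟨by simpa using h, rfl, rfl⟩⟩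
    have hlt : ∀ v, lab S v < S.card := lab_lt (Finset.card_pos.1 (by omega))
    refine ⟨fun v => ⟨fun h => ?_, fun h s hs => ?_⟩, fun v => ⟨fun h => ?_, fun h s hs => ?_⟩⟩
    · by_contra hv
      rcases Nat.lt_or_ge m (lab S v) with hmv | hmv
      · obtain ⟨s, hs, hc⟩ := hex _ (hlt v)
        obtain ⟨h1, h2, _⟩ := (htail s hs).2 (by omega)
        have := h s hs
        rw [h1, tail_true, h2, hc] at this
        exact this rfl
      · obtain ⟨s, hs, hc⟩ := hex (lab S v - 1) (by have := hlt v; omega)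
        obtain ⟨h1, _, h2⟩ := (htail s hs).1 (by omega)
        have := h s hs
        rw [h1, tail_false, h2, hc] at this
        omega
    · rw [h]
      rcases Nat.lt_or_ge m (cnt S s.castSucc) with hc | hc
      · obtain ⟨h1, h2, _⟩ := (htail s hs).2 hc
        rw [h1, tail_true, h2]
        omega
      · obtain ⟨h1, _, h2⟩ := (htail s hs).1 hc
        rw [h1, tail_false, h2]
        omega
    · by_contra hv
      rcases Nat.lt_or_ge m (lab S v) with hmv | hmv
      · obtain ⟨s, hs, hc⟩ := hex (lab S v - 1) (by have := hlt v; omega)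
        obtain ⟨h1, _, h2⟩ := (htail s hs).2 (by omega)
        have := h s hs
        have := hlt v
        rw [h1, Bool.not_true, tail_false, h2, hc, if_neg (by omega)] at *
        omega
      · obtain ⟨s, hs, hc⟩ := hex _ (hlt v)
        obtain ⟨h1, h2, _⟩ := (htail s hs).1 (by omega)
        have := h s hs
        rw [h1, Bool.not_false, tail_true, h2, hc] at this
        exact this rfl
    · rw [h]
      rcases Nat.lt_or_ge m (cnt S s.castSucc) with hc | hc
      · obtain ⟨h1, _, h2⟩ := (htail s hs).2 hc
        rw [h1, Bool.not_true, tail_false, h2]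
        split_ifs <;> omega
      · obtain ⟨h1, h2, _⟩ := (htail s hs).1 hc
        rw [h1, Bool.not_false, tail_true, h2]
        omega

lemma isPsiPartition_iff (hn : 2 ≤ n) (b : ENIndex n q)
    (C : AcyclicPartition (partition n) (q + 2)) : IsPsiPartition b C ↔
      cut C = supp b.1 ∧ ∀ s ∈ supp b.1, ori C s = psiOri b s := by
  have hcard := supp_card_eq b
  have hv := b.2.2
  have hcut : C.part.parts = Finset.univ.image (psiPart n b.1) ↔ cut C = supp b.1 := by
    rw [image_psiPart]
    constructor
    · intro h
      exact cut_eq_of_part_eq (by omega) (Finpartition.ext h)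
    · intro h
      rw [part_eq_cutPart hn, h]
  have key : cut C = supp b.1 → (((∀ A ∈ C.part.parts, C.IsSink A ↔ {0, Fin.last n} ⊆ A) ∧
      ∀ A ∈ C.part.parts, C.IsSource A ↔
        (b.1 ⟨b.2.1.2, by have := b.2.2; omega⟩).succ ∈ A) ↔
      ∀ s ∈ supp b.1, ori C s = psiOri b s) := by
    intro h
    unfold psiOri
    rw [← ori_iff_sink_source (by omega), ← h, part_eq_cutPart hn, cutPart_parts]
    simp only [Finset.mem_image, Finset.mem_univ, true_and, forall_exists_index,
      forall_apply_eq_imp_iff, isSink_iff hn, isSource_iff hn]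
    have h1 : ∀ v, {0, Fin.last n} ⊆ block (cut C) v ↔ lab (cut C) v = 0 := by
      intro v
      simp [Finset.insert_subset_iff, mem_block, eq_comm]
    have h2 : ∀ v, (b.1 ⟨b.2.1.2, by have := b.2.2; omega⟩).succ ∈ block (cut C) v ↔
        lab (cut C) v = b.2.1.2 + 1 := by
      intro v
      rw [mem_block, h, lab_succ (apply_mem_supp _ _), cnt_supp, if_neg (by dsimp only; omega),
        eq_comm]
    simp only [h1, h2]
  constructor
  · intro h
    have hc := hcut.1 h.parts
    exact ⟨hc, (key hc).1 ⟨h.sink, h.source⟩⟩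
  · rintro ⟨hc, ho⟩
    obtain ⟨h1, h2⟩ := (key hc).2 ho
    exact ⟨hcut.2 hc, h1, h2⟩

lemma existsUnique_isPsiPartition (hn : 2 ≤ n) (b : ENIndex n q) :
    ∃! C, IsPsiPartition b C := by
  have hcard := supp_card_eq b
  have hv := b.2.2
  have ho : ∀ x, ∃ s ∈ supp b.1, psiOri b s = x := by
    intro x
    cases x
    · obtain ⟨s, hs, h⟩ := exists_cnt_eq (S := supp b.1) (l := 0) (by omega)
      exact ⟨s, hs, by simp [psiOri, h]⟩
    · obtain ⟨s, hs, h⟩ := exists_cnt_eq (S := supp b.1) (l := q + 1) (by omega)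
      exact ⟨s, hs, by simp only [psiOri, h, decide_eq_true_eq]; omega⟩
  refine ⟨ofCuts hn (supp b.1) (psiOri b) ho hcard, ?_, fun C hC => ?_⟩
  · exact (isPsiPartition_iff hn b _).2
      ⟨cut_ofCuts hn ho hcard, fun s hs => ori_ofCuts hn ho hcard hs⟩
  · obtain ⟨h1, h2⟩ := (isPsiPartition_iff hn b C).1 hC
    rw [eq_ofCuts (C := C) hn (by omega)]
    exact ofCuts_congr hn _ _ _ _ h1 fun s hs => h2 s (h1 ▸ hs)

/-- The class of the acyclic partition attached to `b`. -/
def psiClass (hn : 2 ≤ n) (b : ENIndex n q) : ChipClass (partition n) (q + 2) :=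
  (existsUnique_isPsiPartition hn b).exists.choose.cls

lemma psiVec_eq (K : Type*) [Field K] (hn : 2 ≤ n) (b : ENIndex n q) :
    psiVec K n q b = Finsupp.single (psiClass hn b) 1 :=
  dif_pos (existsUnique_isPsiPartition hn b).exists

lemma clsCut_psiClass (hn : 2 ≤ n) (b : ENIndex n q) : clsCut (psiClass hn b) = supp b.1 :=
  ((isPsiPartition_iff hn b _).1 (existsUnique_isPsiPartition hn b).exists.choose_spec).1

/-- The downward cut edges are those at positions 0, …, v_2. The shift by one reflects that both
directions must occur. -/
lemma clsNum_psiClass (hn : 2 ≤ n) (b : ENIndex n q) (x : Bool) :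
    clsNum hn (psiClass hn b) x = expo b.2 x + 1 := by
  have hcard := supp_card_eq b
  have hv := b.2.2
  suffices h : clsNum hn (psiClass hn b) false = b.2.1.2 + 1 by
    have := clsNum_add hn (by omega) (psiClass hn b)
    cases x
    · exact h
    · change _ = b.2.1.1 + 1
      omega
  obtain ⟨h1, h2⟩ :=
    (isPsiPartition_iff hn b _).1 (existsUnique_isPsiPartition hn b).exists.choose_spec
  rw [psiClass, clsNum_cls, numOri, h1, Finset.filter_congr
    (q := fun s => cnt (supp b.1) s.castSucc < b.2.1.2 + 1) fun s hs => by
      rw [h2 s hs, psiOri, decide_eq_false_iff_not, not_lt, Nat.lt_succ_iff],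
    ← Finset.card_image_of_injOn (f := fun s => cnt (supp b.1) s.castSucc) fun s hs t ht h =>
      cnt_injOn (Finset.mem_filter.1 hs).1 (Finset.mem_filter.1 ht).1 h]
  conv_rhs => rw [← Finset.card_range (b.2.1.2 + 1)]
  congr 1
  ext l
  simp only [Finset.mem_image, Finset.mem_filter, Finset.mem_range]
  constructor
  · rintro ⟨s, ⟨_, h⟩, rfl⟩
    exact h
  · intro hl
    obtain ⟨s, hs, h⟩ := exists_cnt_eq (S := supp b.1) (l := l) (by omega)
    exact ⟨s, ⟨hs, by omega⟩, h⟩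

lemma psiClass_bijective (hn : 2 ≤ n) (q : ℕ) :
    Function.Bijective (psiClass (q := q) hn) := by
  constructor
  · intro b b' h
    have h1 : b.1 = b'.1 :=
      supp_injective (by rw [← clsCut_psiClass hn b, h, clsCut_psiClass])
    have h2 := clsNum_psiClass hn b
    have h3 := clsNum_psiClass hn b'
    rw [h] at h2
    have h4 := (h2 true).symm.trans (h3 true)
    have h5 := (h2 false).symm.trans (h3 false)
    simp only [expo, if_true, Bool.false_eq_true, if_false] at h4 h5
    exact Prod.ext h1 (Subtype.ext (Prod.ext (by omega) (by omega)))
  · intro c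
    have hcard := card_clsCut hn (by omega) c
    have h1 := clsNum_pos hn (by omega) c true
    have h2 := clsNum_pos hn (by omega) c false
    have h3 := clsNum_add hn (by omega) c
    -- The inverse correspondence: the cut edges are the wedge indices, and the direction counts
    -- minus one are the exponents.
    refine ⟨((clsCut c).orderEmbOfFin hcard,
      ⟨(clsNum hn c true - 1, clsNum hn c false - 1), by dsimp only; omega⟩), ?_⟩
    refine chipClass_ext hn (by omega) ?_ true ?_
    · rw [clsCut_psiClass]
      ext s
      rw [mem_supp]
      conv_rhs => rw [← Finset.mem_coe, ← Finset.range_orderEmbOfFin (clsCut c) hcard]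
      rfl
    · rw [clsNum_psiClass]
      simp only [expo, if_true]
      omega

end PsiPartition

/-! ### Comparison of the differentials -/

section Isomorphism

variable (K : Type*) [Field K] {n : ℕ}

lemma psiSigned_enBasis (hn : 2 ≤ n) {q : ℕ} (ε : ENIndex n q → ℤˣ) (b : ENIndex n q) :
    psiSigned K n q ε (enBasis K n q b) =
      Finsupp.single (psiClass hn b) (((ε b : ℤˣ) : ℤ) : R K n) := by
  rw [psiSigned, Module.Basis.constr_basis, psiVec_eq K hn, Finsupp.smul_single, smul_eq_mul,
    mul_one]

lemma psiSigned_bijective (hn : 2 ≤ n) (q : ℕ) (ε : ENIndex n q → ℤˣ) :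
    Function.Bijective (psiSigned K n q ε) := by
  -- The standard basis of F, reindexed by `psiClass` and rescaled by units.
  let B : Module.Basis (ENIndex n q) (R K n) (TopplingModule K (partition n) (q + 1)) :=
    ((Finsupp.basisSingleOne (R := R K n)).reindex
      (Equiv.ofBijective _ (psiClass_bijective hn q)).symm).unitsSMul
        fun b => Units.map (Int.castRingHom (R K n)).toMonoidHom (ε b)
  have h : psiSigned K n q ε = ((enBasis K n q).equiv B (Equiv.refl _)).toLinearMap := by
    refine (enBasis K n q).ext fun b => ?_
    rw [psiSigned_enBasis K hn, LinearEquiv.coe_coe, Module.Basis.equiv_apply,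
      Module.Basis.unitsSMul_apply, Module.Basis.reindex_apply, Finsupp.coe_basisSingleOne]
    simp [Units.smul_def]
  rw [h]
  exact ((enBasis K n q).equiv B (Equiv.refl _)).bijective

lemma psiZero_bijective : Function.Bijective (psiZero K n) := by
  refine ⟨Finsupp.single_injective _, fun f => ⟨f (onePart n).cls, ?_⟩⟩
  ext1 c
  rw [chipClass_one_unique c]
  exact Finsupp.single_eq_same

open Classical in
/-- The summand of the differential of `e_c` that belongs to the edge `f`. -/
def edgeTerm (σ : SignFamily (partition n)) {j : ℕ} (c : ChipClass (partition n) (j + 2))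
    (f : Finset (Fin (n + 1)) × Finset (Fin (n + 1))) : TopplingModule K (partition n) j :=
  if h : ChipClass.Contractible (j := j + 1) c f then
    Finsupp.single (ChipClass.contract h)
      (((σ (j + 2) c f : ℤ) : MvPolynomial (Fin (n + 1)) K) * ChipClass.monomial K h)
  else 0

lemma topplingD_single (σ : SignFamily (partition n)) {j : ℕ}
    (c : ChipClass (partition n) (j + 2)) (r : R K n) :
    topplingD K σ j (Finsupp.single c r) = r • ∑ f, edgeTerm K σ c f := by
  rw [topplingD, Finsupp.linearCombination_single]
  rfl

/-- With at least three parts, directed edges correspond bijectively to cut edges with a direction.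
With two parts each edge would be counted twice, so degree 1 needs its own computation. -/
lemma sum_edgeTerm (hn : 2 ≤ n) (σ : SignFamily (partition n)) {q : ℕ}
    (c : ChipClass (partition n) (q + 3)) :
    ∑ f, edgeTerm K σ c f = ∑ s ∈ clsCut c, ∑ x, edgeTerm K σ c (eg (clsCut c) s x) := by
  have hcard : (clsCut c).card = q + 3 := card_clsCut hn (by omega) c
  rw [← Finset.sum_product', ← Finset.sum_image (s := clsCut c ×ˢ Finset.univ)
    (g := fun p : Fin n × Bool => eg (clsCut c) p.1 p.2) (f := edgeTerm K σ c)]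
  · refine (Finset.sum_subset (Finset.subset_univ _) fun f _ hf => ?_).symm
    rw [edgeTerm, dif_neg]
    intro h
    obtain ⟨s, hs, x, hfe⟩ := exists_eg_of_contractible hn h
    exact hf (Finset.mem_image.2 ⟨(s, x), by simpa using hs, hfe.symm⟩)
  · rintro ⟨s, x⟩ hs ⟨t, y⟩ ht h
    simp only [Finset.coe_product, Finset.coe_univ, Set.mem_prod, Finset.mem_coe, Set.mem_univ,
      and_true] at hs ht
    obtain ⟨rfl, rfl⟩ := eg_inj (by omega) hs ht h
    rfl

lemma contract_psiClass (hn : 2 ≤ n) {q : ℕ} (b : ENIndex n (q + 1)) (p : Fin (q + 3)) {x : Bool}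
    (h : 0 < expo b.2 x)
    (hc : ChipClass.Contractible (j := q + 2) (psiClass hn b)
      (eg (clsCut (psiClass hn b)) (b.1 p) x)) :
    ChipClass.contract hc = psiClass hn (del b.1 p, lowerExpo b.2 x h) := by
  have hs : b.1 p ∈ clsCut (psiClass hn b) := by
    rw [clsCut_psiClass]
    exact apply_mem_supp _ _
  refine chipClass_ext hn (by omega) ?_ true ?_
  · rw [clsCut_contract hn hs rfl hc, clsCut_psiClass, clsCut_psiClass, supp_del]
  · have h1 := clsNum_contract hn hs rfl hc true
    rw [clsNum_psiClass] at h1 ⊢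
    cases x
    · simpa [expo, lowerExpo] using h1
    · simp only [expo, lowerExpo, if_true] at h h1 ⊢
      omega

variable {K}

/-- The signs of the basis elements for sign functions that arise from `η`. -/
def basisSign (hn : 2 ≤ n) (η : ClassSigns n) (q : ℕ) (b : ENIndex n q) : ℤˣ :=
  (-1) ^ b.2.1.2 * η (q + 1) (psiClass hn b)

/-- The position of the cut edge gives the sign of Δ. The remaining minus for a downward edge is
absorbed by (-1)^(v_2), since exactly then v_2 drops by one. -/
lemma basisSign_mul (hn : 2 ≤ n) {σ : SignFamily (partition n)} {η : ClassSigns n}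
    (h : Compatible σ η) {q : ℕ} (b : ENIndex n (q + 1)) (p : Fin (q + 3)) {x : Bool}
    (hx : 0 < expo b.2 x)
    (hc : ChipClass.Contractible (j := q + 2) (psiClass hn b)
      (eg (clsCut (psiClass hn b)) (b.1 p) x)) :
    basisSign hn η (q + 1) b * σ (q + 3) (psiClass hn b) (eg (clsCut (psiClass hn b)) (b.1 p) x) =
      (-1) ^ (p : ℕ) * basisSign hn η q (del b.1 p, lowerExpo b.2 x hx) := by
  have hs : b.1 p ∈ clsCut (psiClass hn b) := by
    rw [clsCut_psiClass]
    exact apply_mem_supp _ _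
  have hcard : (clsCut (psiClass hn b)).card = q + 3 := card_clsCut hn (by omega) _
  have hpar : ((-1 : ℤˣ)) ^ b.2.1.2 * (if x then 1 else -1) =
      (-1) ^ (lowerExpo b.2 x hx).1.2 := by
    cases x
    · simp only [expo, lowerExpo, Bool.false_eq_true, if_false] at hx ⊢
      obtain ⟨m, hm⟩ : ∃ m, b.2.1.2 = m + 1 := ⟨b.2.1.2 - 1, by omega⟩
      rw [hm, Nat.add_sub_cancel, pow_succ, mul_assoc, neg_mul_neg, mul_one, mul_one]
    · simp [lowerExpo]
  rw [h.2 (q + 1) _ _ hc, contract_psiClass hn b p hx hc, sgn_eg (by omega) hs, edgeSign,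
    clsCut_psiClass, cnt_supp, basisSign, basisSign, ← hpar]
  generalize η (q + 1 + 1) (psiClass hn b) = a
  calc _ = (-1 : ℤˣ) ^ (p : ℕ) * ((-1) ^ b.2.1.2 * (if x then 1 else -1) *
        η (q + 1) (psiClass hn (del b.1 p, lowerExpo b.2 x hx))) * (a * a) := by
        ac_rfl
    _ = _ := by rw [Int.units_mul_self, mul_one]

lemma topplingD_comp_psiSigned (hn : 2 ≤ n) {σ : SignFamily (partition n)} {η : ClassSigns n}
    (h : Compatible σ η) (q : ℕ) :
    topplingD K σ (q + 1) ∘ₗ psiSigned K n (q + 1) (basisSign hn η (q + 1)) =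
      psiSigned K n q (basisSign hn η q) ∘ₗ enD K n q := by
  refine (enBasis K n (q + 1)).ext fun b => ?_
  rw [LinearMap.comp_apply, LinearMap.comp_apply, psiSigned_enBasis K hn, topplingD_single,
    sum_edgeTerm K hn, enD_enBasis, map_sum, Finset.smul_sum]
  conv_lhs => rw [clsCut_psiClass, supp, Finset.sum_map]
  refine Finset.sum_congr rfl fun p _ => ?_
  rw [map_sum, Finset.smul_sum]
  refine Finset.sum_congr rfl fun x _ => ?_
  rw [RelEmbedding.coe_toEmbedding]
  change _ • edgeTerm K σ (psiClass hn b) (eg (supp b.1) (b.1 p) x) = _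
  rw [← clsCut_psiClass hn b]
  have hs : b.1 p ∈ clsCut (psiClass hn b) := by
    rw [clsCut_psiClass]
    exact apply_mem_supp _ _
  -- Contractibility in the class is divisibility by the corresponding z, so the two differentials
  -- have the same nonzero terms.
  have hiff := contractible_iff hn hs x
  rw [clsNum_psiClass] at hiff
  by_cases hx : 0 < expo b.2 x
  · have hc := hiff.2 (by omega)
    rw [edgeTerm, dif_pos hc, dif_pos hx, contract_psiClass hn b p hx hc, monomial_eq K hn hs hc,
      map_smul, psiSigned_enBasis K hn, Finsupp.smul_single, Finsupp.smul_single]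
    congr 1
    have := congrArg (fun u : ℤˣ => ((u : ℤ) : R K n)) (basisSign_mul hn h b p hx hc)
    simp only [Units.val_mul, Units.val_pow_eq_pow_val, Units.val_neg, Units.val_one, Int.cast_mul,
      Int.cast_pow, Int.cast_neg, Int.cast_one] at this
    rw [smul_eq_mul, smul_eq_mul, ← mul_assoc, this]
    ring
  · rw [edgeTerm, dif_neg (fun hc => hx (by have := hiff.1 hc; omega)), dif_neg hx, smul_zero,
      map_zero]

/-- Only two directed edges exist, both written over the first cut edge. They carry opposite signs
and give the two products of the minor. -/
lemma topplingD_comp_psiSigned_zero (hn : 2 ≤ n) {σ : SignFamily (partition n)}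
    {η : ClassSigns n} (h : Compatible σ η) :
    topplingD K σ 0 ∘ₗ psiSigned K n 0 (basisSign hn η 0) = psiZero K n ∘ₗ enDZero K n := by
  refine (enBasis K n 0).ext fun b => ?_
  rw [LinearMap.comp_apply, LinearMap.comp_apply, psiSigned_enBasis K hn, topplingD_single,
    enDZero_enBasis]
  have hcut := clsCut_psiClass hn b
  have hs : b.1 0 ∈ clsCut (psiClass hn b) := hcut ▸ apply_mem_supp _ _
  have ht : b.1 1 ∈ clsCut (psiClass hn b) := hcut ▸ apply_mem_supp _ _
  have hst : b.1 0 ≠ b.1 1 := fun h => absurd (b.1.injective h) (by simp)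
  have hcard : (clsCut (psiClass hn b)).card = 2 := card_clsCut hn le_rfl _
  have hne : eg (clsCut (psiClass hn b)) (b.1 0) true ≠
      eg (clsCut (psiClass hn b)) (b.1 0) false := by
    intro h
    rcases eg_eq_cases hcard.ge hs hs h with ⟨_, h⟩ | ⟨_, h, _⟩
    · exact Bool.noConfusion h
    · exact h rfl
  have hsum : ∑ f, edgeTerm K σ (psiClass hn b) f =
      edgeTerm K σ (psiClass hn b) (eg (clsCut (psiClass hn b)) (b.1 0) true) +
        edgeTerm K σ (psiClass hn b) (eg (clsCut (psiClass hn b)) (b.1 0) false) := by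
    rw [← Finset.sum_pair hne]
    refine (Finset.sum_subset (Finset.subset_univ _) fun f _ hf => ?_).symm
    rw [edgeTerm, dif_neg]
    intro hc
    obtain ⟨s, hs', x, rfl⟩ := exists_eg_of_contractible hn hc
    apply hf
    have key : ∃ y, eg (clsCut (psiClass hn b)) s x =
        eg (clsCut (psiClass hn b)) (b.1 0) y := by
      by_cases h0 : s = b.1 0
      · exact ⟨x, by rw [h0]⟩
      · exact ⟨!x, (eg_eq_of_card_two hcard hs' hs h0 x).symm⟩
    obtain ⟨y, hy⟩ := key
    rw [hy]
    cases y <;> simp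
  have hsign : ∀ (x : Bool) (hc : ChipClass.Contractible (j := 1) (psiClass hn b)
      (eg (clsCut (psiClass hn b)) (b.1 0) x)), basisSign hn η 0 b *
      σ 2 (psiClass hn b) (eg (clsCut (psiClass hn b)) (b.1 0) x) = if x then 1 else -1 := by
    intro x hc
    have hv : b.2.1.2 = 0 := by have := b.2.2; omega
    rw [h.2 0 _ _ hc, h.1, sgn_eg hcard.ge hs, edgeSign, hcut, cnt_supp, basisSign, hv]
    simp only [Fin.val_zero, pow_zero, one_mul, mul_one]
    rw [mul_comm, mul_assoc, Int.units_mul_self, mul_one]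
  have hterm : ∀ x, (((basisSign hn η 0 b : ℤˣ) : ℤ) : R K n) •
      edgeTerm K σ (psiClass hn b) (eg (clsCut (psiClass hn b)) (b.1 0) x) =
      Finsupp.single (onePart n).cls ((if x then 1 else -1) *
        (MvPolynomial.X (tail (b.1 0) x) * MvPolynomial.X (tail (b.1 1) !x))) := by
    intro x
    have hc := contractible_two hn hs x
    have := congrArg (fun u : ℤˣ => ((u : ℤ) : R K n)) (hsign x hc)
    simp only [Units.val_mul, Int.cast_mul] at this
    rw [edgeTerm, dif_pos hc, monomial_two K hn hs ht hst hc, Finsupp.smul_single, smul_eq_mul,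
      ← mul_assoc, this, chipClass_one_unique (ChipClass.contract hc)]
    cases x <;> simp
  rw [hsum, smul_add, hterm, hterm, ← Finsupp.single_add]
  change _ = Finsupp.single _ _
  congr 1
  simp only [T_zero, T_one, if_true, Bool.false_eq_true, if_false, Bool.not_true, Bool.not_false]
  ring

lemma isComplexIso_of_compatible (hn : 2 ≤ n) {σ : SignFamily (partition n)} {η : ClassSigns n}
    (h : Compatible σ η) :
    IsComplexIso K n σ fun q => psiSigned K n q (basisSign hn η q) :=
  ⟨psiZero_bijective K, fun q => psiSigned_bijective K hn q _,
    topplingD_comp_psiSigned_zero hn h, topplingD_comp_psiSigned hn h⟩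

/-- Vanishing of the composites is transported from E along the surjections `Φ`. -/
lemma topplingIsComplex_of_isComplexIso {σ : SignFamily (partition n)}
    {Φ : ∀ q, ENModule K n q →ₗ[R K n] TopplingModule K (partition n) (q + 1)}
    (h : IsComplexIso K n σ Φ) : TopplingIsComplex K σ := by
  obtain ⟨_, hbij, h0, h1⟩ := h
  intro j
  rw [← LinearMap.cancel_right (hbij (j + 1)).surjective, LinearMap.comp_assoc, h1,
    ← LinearMap.comp_assoc, LinearMap.zero_comp]
  cases j with
  | zero => rw [h0, LinearMap.comp_assoc, enDZero_comp, LinearMap.comp_zero]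
  | succ j => rw [h1, LinearMap.comp_assoc, enD_comp, LinearMap.comp_zero]

/-- The change of signs between the strict sign functions and those for which `Ψ` needs no
signs. -/
def altSigns (hn : 2 ≤ n) : ClassSigns n
  | 0, _ => 1
  | _ + 1, c => (-1) ^ (clsNum hn c false - 1)

/-- The class of `b` has v_2 + 1 downward edges, so the change of signs is again (-1)^(v_2) and
cancels the sign of (b). -/
lemma basisSign_altSigns (hn : 2 ≤ n) (q : ℕ) (b : ENIndex n q) :
    basisSign hn (altSigns hn) q b = 1 := by
  rw [basisSign, altSigns, clsNum_psiClass, Nat.add_sub_cancel]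
  exact Int.units_mul_self _

lemma psiSigned_one (q : ℕ) : psiSigned K n q (fun _ => 1) = psi K n q := by
  rw [psiSigned, psi]
  congr 1
  funext b
  simp

lemma exists_isWeakSign_psi (hn : 2 ≤ n) : ∃ σ : SignFamily (partition n), σ.IsWeakSign ∧
    TopplingIsComplex K σ ∧ IsComplexIso K n σ (psi K n) := by
  have h := isComplexIso_of_compatible (K := K) hn
    (twist_compatible (η := altSigns hn) fun _ => rfl)
  have hpsi : (fun q => psiSigned K n q (basisSign hn (altSigns hn) q)) = psi K n := by
    funext q
    rw [← psiSigned_one, funext (basisSign_altSigns hn q)]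
  rw [hpsi] at h
  exact ⟨twist (altSigns hn), twist_isWeakSign hn _, topplingIsComplex_of_isComplexIso h, h⟩

lemma exists_isSign_psiSigned (hn : 2 ≤ n) : ∃ σ : SignFamily (partition n), σ.IsSign ∧
    TopplingIsComplex K σ ∧
      IsComplexIso K n σ (fun q => psiSigned K n q fun b => (-1) ^ b.2.1.2) := by
  have h := isComplexIso_of_compatible (K := K) hn
    (twist_compatible (η := fun _ _ => 1) fun _ => rfl)
  have hpsi : (fun q => psiSigned K n q (basisSign hn (fun _ _ => 1) q)) =
      fun q => psiSigned K n q fun b => (-1) ^ b.2.1.2 := by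
    funext q
    congr 1
    funext b
    exact mul_one _
  rw [hpsi] at h
  exact ⟨_, twist_one_isSign hn, topplingIsComplex_of_isComplexIso h, h⟩

lemma exists_signs_of_isWeakSign (hn : 2 ≤ n) (σ : SignFamily (partition n))
    (hσ : σ.IsWeakSign) : TopplingIsComplex K σ ∧ ∃ ε : ∀ q, ENIndex n q → ℤˣ,
      IsComplexIso K n σ (fun q => psiSigned K n q (ε q)) :=
  have h := isComplexIso_of_compatible (K := K) hn (gauge_compatible hn hσ)
  ⟨topplingIsComplex_of_isComplexIso h, _, h⟩

end Isomorphism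

end RationalNormal

end

theorem mainTheorem12 (K : Type*) [Field K] (n : ℕ) (hn : 2 ≤ n) :
    -- `E` is a complex with `E_0 / d(E_1) = R / P_n`
    (RationalNormal.ENIsComplex K n ∧
      LinearMap.range (RationalNormal.enDZero K n) = RationalNormal.idealP K n) ∧
    -- the acyclic partition attached to a basis element exists and is unique
    (∀ (q : ℕ) (b : RationalNormal.ENIndex n q), ∃! C, RationalNormal.IsPsiPartition b C) ∧
    -- for compatible sign functions `Ψ` is an isomorphism of complexes
    (∃ σ : Parcycle.SignFamily (RationalNormal.partition n), σ.IsWeakSign ∧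
      Parcycle.TopplingIsComplex K σ ∧
      RationalNormal.IsComplexIso K n σ (RationalNormal.psi K n)) ∧
    -- there are sign functions for which both sign rules hold in all classes and `Ψ`, with the
    -- sign `(-1) ^ v_2`, is an isomorphism of complexes
    (∃ σ : Parcycle.SignFamily (RationalNormal.partition n), σ.IsSign ∧
      Parcycle.TopplingIsComplex K σ ∧
      RationalNormal.IsComplexIso K n σ
        (fun q => RationalNormal.psiSigned K n q (fun b => (-1) ^ b.2.1.2))) ∧
    -- for all sign functions `Ψ` is an isomorphism of complexes up to signs of basis elements
    (∀ σ : Parcycle.SignFamily (RationalNormal.partition n), σ.IsWeakSign →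
      Parcycle.TopplingIsComplex K σ ∧
      ∃ ε : ∀ q, RationalNormal.ENIndex n q → ℤˣ,
        RationalNormal.IsComplexIso K n σ
          (fun q => RationalNormal.psiSigned K n q (ε q))) :=
  ⟨⟨RationalNormal.enIsComplex K, RationalNormal.range_enDZero K⟩,
    fun _ b => RationalNormal.existsUnique_isPsiPartition hn b,
    RationalNormal.exists_isWeakSign_psi hn, RationalNormal.exists_isSign_psiSigned hn,
    RationalNormal.exists_signs_of_isWeakSign hn⟩
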